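/- **Setting.** Let $r>0$ be real and let $X$ be a ($C^r$) manifold of dimension $d\ge 1$ with a Borel probability measure $\mu$. $C^r$ norms of functions $f:X\to\mathbb R$ are computed in a fixed cover of $X$ by coordinate balls (open balls inside charts whose closures lie in the chart images): $\|f\|_{C^r}$ is the supremum over these balls of the derivatives of $f$ up to order $\lfloor r\rfloor$ and of the $(r-\lfloor r\rfloor)$-Hölder quotients of the derivatives of order $\lfloor r\rfloor$; $f\in C^r$ means that $f$ is $C^{\lfloor r\rfloor}$ with $\|f\|_{C^r}<\infty$. Let $(Y,\nu)$ be a probability space, $R:Y\to Y$ measure preserving, and for $y\in Y$ let $T_y:X\to X$ preserve $\mu$. Put $T_y^n=T_{R^{n-1}y}\circ\dots\circ T_{Ry}\circ T_y$. (If $T_y=T$ does not depend on $y$, then $T_y^n=T^n$.) For $B\subset X$ let $\varphi_{B,y}(x)=\min\{j\ge1: T_y^jx\in B\}\in\mathbb N\cup\{\infty\}$ and $\mu_B=\mu(\,\cdot\cap B)/\mu(B)$. *(MEM)* For $\nu$-a.e. $y$ there are $\gamma>0$ and, for every $n\ge1$, a constant $C_n>1$ such that for all $f_0,\dots,f_{n-1}\in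 C^r$ and $0\le k_0\le\dots\le k_{n-1}$ $$\Big|\int_X\prod_{j=0}^{n-1} f_j\circ T_y^{k_j}\,d\mu-\prod_{j=0}^{n-1}\int_X f_j\,d\mu\Big|\le C_n\,e^{-\gamma\min_{i<j}|k_i-k_j|}\prod_{j=0}^{n-1}\|f_j\|_{C^r}.$$ *Regular approximability.* A family of measurable sets is regularly approximable in $C^r$ if there is one $C>0$ such that for every member $B$ and every $0<\epsilon<\frac1{10}\mu(B)^{1/d}$ there are $\underline h,\overline h\in C^r$ with $\underline h\le 1_B\le\overline h$ and, for $h\in\{\underline h,\overline h\}$, $\mu(1_B\ne h)\le\mu(B)^{\frac{d-1}{d}}\epsilon$ and $\|h\|_{C^r}\le C\epsilon^{-r}$. **Proposition.** Assume (MEM). Let $K\ge1$ and let $A_l^{(k)}\subset X$ ($l\ge1$, $1\le k\le K$) form a regularly approximable family with $$\mu(A_l^{(k)})=\omega^{(k)}r_l^d+o(r_l^d)\quad(l\to\infty),\qquad \omega^{(k)}>0,\ r_l>0,\ r_l\to0.$$ Put $A_l=\bigcup_{k}A_l^{(k)}$, and let $p^{(1)},\dots,p^{(K)}>0$ with $\sum_kp^{(k)}=1$.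 Then for $\nu$-a.e. $y$ the following holds. Let $\kappa_l=(\kappa_l^{(n)})_{n\ge1}$ be sequences in $\{1,\dots,K\}$ with asymptotic frequencies $p^{(k)}$ on the scale $r_l^{-d}$: for every $k$ and every $t>0$, $$\frac1{t_l}\#\{1\le j\le t_l:\kappa_l^{(j)}=k\}\longrightarrow p^{(k)}\quad(l\to\infty),\qquad t_l=\lfloor t\,r_l^{-d}\rfloor,$$ and let $\alpha_l=(\alpha_l^{(n)})_{n\ge1}$ be sequences of positive integers. Suppose that one of the following holds: (I) $|\log\mu(A_l)|=o\big(\min_{i\ge2}\alpha_l^{(i)}\big)$; (II) there are $a_l\ge0$ with $|\log\mu(A_l)|=o(a_l)$ and $\sup_{n\ge0}\mu_{A_l}(\varphi_{A_l,R^ny}\le a_l)\to0$, and $|\log\mu(A_l)|=O\big(\min_{i\ge2}\alpha_l^{(i)}\big)$; (III) there are $a_l\ge0$ as in (II), and there is $c>0$ such that for all $l\ge1$ and $n\ge0$, $\varphi_{A_l,R^ny}(x)\ge c\,|\log\mu(A_l)|$ for $\mu$-a.e. $x\in A_l$. (If $T_y=T$ does not depend on $y$, the return conditions are just $\mu_{A_l}(\varphi_{A_l}\le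 a_l)\to0$ and $\varphi_{A_l}\ge c|\log\mu(A_l)|$ a.e. on $A_l$.) Let $\tilde\alpha_l^{(n)}=\sum_{j=1}^n\alpha_l^{(j)}$, let $\sigma^{(1)}<\sigma^{(2)}<\dots$ be the successive indices $n\ge1$ with $T_y^{\tilde\alpha_l^{(n)}}(x)\in A_l^{(\kappa_l^{(n)})}$, put $\sigma^{(0)}=0$, and let $$\Phi_{\kappa_l,\alpha_l,y}(x)=\big(\sigma^{(1)}-\sigma^{(0)},\,\sigma^{(2)}-\sigma^{(1)},\,\dots\big)\in[0,\infty]^{\mathbb N}$$ be the waiting times, an entry being $\infty$ if the next index does not exist. Then, with $\Omega=\sum_{k=1}^K\omega^{(k)}p^{(k)}$, $$\Omega\,r_l^d\,\Phi_{\kappa_l,\alpha_l,y}\Longrightarrow\Phi_{Exp}\quad(l\to\infty)$$ in distribution under $\mu$, as processes in $[0,\infty]^{\mathbb N}$ with the product topology, where $\Phi_{Exp}$ is a sequence of independent standard exponential random variables. -/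

import Mathlib

open MeasureTheory ProbabilityTheory Filter Topology Asymptotics
open scoped ENNReal NNReal Manifold

noncomputable section

/-- A cover of a `d`-dimensional manifold by coordinate balls, with respect to which `C^r` norms are
computed: charts of the maximal `C^⌊r⌋` atlas together with closed balls in their images, such that
the corresponding open balls cover `X`. On a compact manifold any two finite such covers give
equivalent `C^r` norms. -/
structure BallCover (d : ℕ) (r : ℝ) (X : Type*) [TopologicalSpace X]
    [ChartedSpace (EuclideanSpace ℝ (Fin d)) X] where
  /-- the index set of the cover -/
  Idx : Type
  /-- the charts -/
  chart : Idx → OpenPartialHomeomorph X (EuclideanSpace ℝ (Fin d))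
  /-- centres of the balls -/
  center : Idx → EuclideanSpace ℝ (Fin d)
  /-- radii of the balls -/
  radius : Idx → ℝ
  chart_mem : ∀ i, chart i ∈
    IsManifold.maximalAtlas (𝓡 d) ((⌊r⌋₊ : ℕ) : WithTop ℕ∞) X
  ball_subset : ∀ i, Metric.closedBall (center i) (radius i) ⊆ (chart i).target
  cover : ∀ x : X, ∃ i, x ∈ (chart i).source ∧
    chart i x ∈ Metric.ball (center i) (radius i)

section Regularity

variable {d : ℕ} {r : ℝ} {X : Type*} [TopologicalSpace X]
  [ChartedSpace (EuclideanSpace ℝ (Fin d)) X]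

/-- The `C^r` norm, for real `r > 0`, with values in `[0,∞]`: the supremum, over the coordinate balls
of the cover, of the norms of the derivatives of order `0, …, ⌊r⌋` of the function in the chart, and
of the Hölder quotients of exponent `r - ⌊r⌋` of the derivative of order `⌊r⌋`. For integer `r` these
quotients have exponent `0` and are at most twice the supremum of the derivative of order `r`. -/
def crNorm (N : BallCover d r X) (f : X → ℝ) : ℝ≥0∞ :=
  ⨆ i : N.Idx,
    (⨆ (j : ℕ) (_ : j ≤ ⌊r⌋₊),
      ⨆ u ∈ Metric.closedBall (N.center i) (N.radius i),
        ‖iteratedFDeriv ℝ j (f ∘ (N.chart i).symm) u‖ₑ) ⊔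
    (⨆ u ∈ Metric.closedBall (N.center i) (N.radius i),
      ⨆ v ∈ Metric.closedBall (N.center i) (N.radius i),
        ‖iteratedFDeriv ℝ ⌊r⌋₊ (f ∘ (N.chart i).symm) u
          - iteratedFDeriv ℝ ⌊r⌋₊ (f ∘ (N.chart i).symm) v‖ₑ
          / edist u v ^ (r - (⌊r⌋₊ : ℝ)))

/-- Functions of class `C^r` with finite `C^r` norm. -/
def IsCr (N : BallCover d r X) (f : X → ℝ) : Prop :=
  ContMDiff (𝓡 d) 𝓘(ℝ, ℝ) ((⌊r⌋₊ : ℕ) : WithTop ℕ∞) f ∧ crNorm N f < ⊤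

/-- The set `B` is regularly approximable in `C^r` with constant `C`. -/
def RegApproxWith [MeasurableSpace X] (N : BallCover d r X) (lam : Measure X) (C : ℝ)
    (B : Set X) : Prop :=
  MeasurableSet B ∧
  ∀ ε : ℝ, 0 < ε → ε < (1 / 10) * lam.real B ^ ((1 : ℝ) / d) →
    ∃ hlow hup : X → ℝ, IsCr N hlow ∧ IsCr N hup ∧
      (∀ x, hlow x ≤ B.indicator 1 x) ∧ (∀ x, B.indicator 1 x ≤ hup x) ∧
      ∀ h ∈ ({hlow, hup} : Set (X → ℝ)),
        lam.real {x | B.indicator 1 x ≠ h x} ≤ lam.real B ^ (((d : ℝ) - 1) / d) * ε ∧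
        (crNorm N h).toReal ≤ C * ε ^ (-r)

/-- The family `B` is regularly approximable in `C^r`: one constant serves for all members. -/
def RegApproxFamily [MeasurableSpace X] (N : BallCover d r X) (lam : Measure X) {ι : Type*}
    (B : ι → Set X) : Prop :=
  ∃ C : ℝ, 0 < C ∧ ∀ i, RegApproxWith N lam C (B i)

end Regularity

section Dynamics

variable {X Y : Type*}

/-- Fibrewise iterates: `fiberIter T R y n = T_{R^{n-1} y} ∘ ⋯ ∘ T_{R y} ∘ T_y`. -/
def fiberIter (T : Y → X → X) (R : Y → Y) (y : Y) : ℕ → X → X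
  | 0 => id
  | n + 1 => T (R^[n] y) ∘ fiberIter T R y n

/-- First return time to `A` in the fibre over `y`: the least `j ≥ 1` with `T_y^j x ∈ A`
(`⊤` if there is none). -/
def fiberReturn (T : Y → X → X) (R : Y → Y) (A : Set X) (y : Y) (x : X) : ℕ∞ :=
  ⨅ (j : ℕ) (_ : 1 ≤ j ∧ fiberIter T R y j x ∈ A), (j : ℕ∞)

/-- Exponential mixing of all orders along the fibre orbit of `y`. The condition on `p` says that `p`
is at most the minimal gap between the times `k j`. -/
def ExpMixingAt {d : ℕ} {r : ℝ} [TopologicalSpace X] [ChartedSpace (EuclideanSpace ℝ (Fin d)) X]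
    [MeasurableSpace X] (N : BallCover d r X) (μ : Measure X) (T : Y → X → X) (R : Y → Y)
    (y : Y) : Prop :=
  ∃ γ : ℝ, 0 < γ ∧ ∀ n : ℕ, 1 ≤ n → ∃ C : ℝ, 1 < C ∧
    ∀ f : Fin n → X → ℝ, (∀ j, IsCr N (f j)) →
    ∀ k : Fin n → ℕ, Monotone k →
    ∀ p : ℕ, (∀ i j, i < j → k i + p ≤ k j) →
      |(∫ x, ∏ j, f j (fiberIter T R y (k j) x) ∂μ) - ∏ j, ∫ x, f j x ∂μ|
        ≤ C * Real.exp (-γ * p) * ∏ j, (crNorm N (f j)).toReal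

/-- Partial sums `α̃ n = α 1 + ⋯ + α n` of a delay sequence (the entry `α 0` is not used). -/
def delaySum (α : ℕ → ℕ) (n : ℕ) : ℕ := ∑ j ∈ Finset.Icc 1 n, α j

/-- Index `n` is a hit for `x`: `T_y^{α̃ n} x ∈ A (κ n)`. -/
def IsHit {K : ℕ} (T : Y → X → X) (R : Y → Y) (A : Fin K → Set X) (κ : ℕ → Fin K)
    (α : ℕ → ℕ) (y : Y) (x : X) (n : ℕ) : Prop :=
  fiberIter T R y (delaySum α n) x ∈ A (κ n)

/-- The index of the `m`-th hit among the indices `n ≥ 1` (`⊤` if there is none); `0` for `m = 0`. -/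
def hitIndex {K : ℕ} (T : Y → X → X) (R : Y → Y) (A : Fin K → Set X) (κ : ℕ → Fin K)
    (α : ℕ → ℕ) (y : Y) (x : X) : ℕ → ℕ∞
  | 0 => 0
  | m + 1 => ⨅ (n : ℕ) (_ : hitIndex T R A κ α y x m < n ∧ IsHit T R A κ α y x n), (n : ℕ∞)

/-- The process `Φ_{κ,α,y}` of waiting times: its entry at `m = 0, 1, 2, …` is the number of indices
from the `m`-th hit to the next one (`⊤` if there is no next one). -/
def waitingProcess {K : ℕ} (T : Y → X → X) (R : Y → Y) (A : Fin K → Set X) (κ : ℕ → Fin K)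
    (α : ℕ → ℕ) (y : Y) (x : X) (m : ℕ) : ℕ∞ :=
  if hitIndex T R A κ α y x m = ⊤ then ⊤
  else hitIndex T R A κ α y x (m + 1) - hitIndex T R A κ α y x m

/-- The proportion of the indices `j = 1, …, t` with `κ j = k`. -/
def typeFreq {K : ℕ} (κ : ℕ → Fin K) (t : ℕ) (k : Fin K) : ℝ :=
  (((Finset.Icc 1 t).filter fun j => κ j = k).card : ℝ) / t

/-- The function `l ↦ |log μ(A_l)|`. -/
def absLogMeas [MeasurableSpace X] (μ : Measure X) (A : ℕ → Set X) (l : ℕ) : ℝ :=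
  |Real.log (μ.real (A l))|

/-- `min_{i ≥ 2} α i`. -/
def minDelay (α : ℕ → ℕ) : ℕ := sInf (α '' Set.Ici 2)

/-- Short returns to `A l` are rare, uniformly in the fibres along the orbit of `y`: there are `a l`
with `|log μ(A_l)| = o(a_l)` and `sup_n μ_{A_l}(φ_{A_l, R^n y} ≤ a_l) → 0`. -/
def ShortReturnsRare [MeasurableSpace X] (μ : Measure X) (T : Y → X → X) (R : Y → Y) (y : Y)
    (A : ℕ → Set X) : Prop :=
  ∃ a : ℕ → ℝ≥0, absLogMeas μ A =o[atTop] (fun l => (a l : ℝ)) ∧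
    Tendsto (fun l => ⨆ n : ℕ,
      μ[{x | (fiberReturn T R (A l) (R^[n] y) x : ℝ≥0∞) ≤ (a l : ℝ≥0∞)} | A l]) atTop (𝓝 0)

/-- Returns to `A l` are at least logarithmically large in all fibres along the orbit of `y`. -/
def ReturnsLogLarge [MeasurableSpace X] (μ : Measure X) (T : Y → X → X) (R : Y → Y) (y : Y)
    (A : ℕ → Set X) : Prop :=
  ∃ c : ℝ, 0 < c ∧ ∀ l n : ℕ, ∀ᵐ x ∂μ, x ∈ A l →
    ENNReal.ofReal (c * absLogMeas μ A l) ≤ (fiberReturn T R (A l) (R^[n] y) x : ℝ≥0∞)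

end Dynamics

/-- The law on `ℝ^ℕ` of a sequence of independent standard exponential random variables. -/
def stdExpSeq : Measure (ℕ → ℝ) := Measure.infinitePi fun _ : ℕ => expMeasure 1

instance stdExpSeq_isProbabilityMeasure : IsProbabilityMeasure stdExpSeq := by
  have : ∀ _ : ℕ, IsProbabilityMeasure (expMeasure 1) :=
    fun _ => isProbabilityMeasure_expMeasure one_pos
  unfold stdExpSeq
  infer_instance

end

/-! Fix `l` and let `ξ n` be the indicator that index `n` is a hit. Its mean `w n` is the measure of
the target of type `κ n`, of order `ρ ^ d`; by the frequency assumption the `w n` add up to about `Ω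
τ` over the indices up to `τ / ρ ^ d`. If the hits were independent, the rescaled gaps would clearly
be asymptotically i.i.d. exponential. It has to be shown that dependence does not matter.

Reduction to moments. The event that the first gaps lie in given intervals is a polynomial in the `ξ
n` (`gapPoly`, `gapPoly_hitInd`). Truncating it by the Bonferroni inequalities shows that its mean
depends, up to a small error, only on the moments `∫ ∏ n ∈ Q, ξ n` over sets `Q` of bounded size
(`abs_integral_gapPoly_sub_le`). If the discrepancies from `∏ n ∈ Q, w n`, summed over all `Q` of a
given size, tend to `0`, the box probabilities have the limit of the independent case
(`tendsto_integral_gapPoly`). Boxes determine convergence in distribution because the limit charges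
only sequences with positive finite entries (`tendstoInDistribution_of_tendsto_extBox`).

Separated sets. If the times in `Q` have gaps of at least `M |log μ(A_l)|`, exponential mixing,
applied to `C^r` functions sandwiching the targets, gives an error `ρ ^ m` with `m` as large as
desired (`exists_mixing_rate`), which beats the number of sets. The sandwiching functions must take
values in `[0,1]` for products to be sandwiched; they are made so by composition with a smooth step,
which raises their norms only polynomially.

Non-separated sets. There are few of them, so they contribute little to the independent moments. For
the true moments (`sum_abs_moment_sub_le`), the event that some hit is followed too closely by
another has small probability, but many sets may be hit on it. If `Z` is the number of hits, `Z ^ q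
≤ V + Z ^ (2 q) / V`; and `Z ^ (2 q)` is bounded in mean, because hits are at least `c |log μ(A_l)|`
apart, so that a fixed fraction of them is separated in the stronger sense, where mixing applies.
Letting `l → ∞` and then `V → ∞` finishes. Each of (I), (II), (III) supplies the two inputs used:
logarithmic spacing of hits (`exists_hits_separated`) and rarity of close hits
(`exists_closeHit_rare`). -/

noncomputable section

/-! ### Hölder norms under products and smooth composition -/

/-- On `U`, the derivatives of `f` of order at most `n` are bounded by `D`, and the derivative of
order `n` is `s`-Hölder with constant `D`; moreover `f` is of class `C^n` on `V`. -/
def HolderBound {E F : Type} [NormedAddCommGroup E] [NormedSpace ℝ E] [NormedAddCommGroup F]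
    [NormedSpace ℝ F] (s : ℝ) (U V : Set E) (n : ℕ) (f : E → F) (D : ℝ) : Prop :=
  ContDiffOn ℝ n f V ∧ (∀ j ≤ n, ∀ u ∈ U, ‖iteratedFDeriv ℝ j f u‖ ≤ D) ∧
    ∀ u ∈ U, ∀ v ∈ U, ‖iteratedFDeriv ℝ n f u - iteratedFDeriv ℝ n f v‖ ≤ D * ‖u - v‖ ^ s

namespace HolderBound

variable {E F G H : Type} [NormedAddCommGroup E] [NormedSpace ℝ E] [NormedAddCommGroup F]
  [NormedSpace ℝ F] [NormedAddCommGroup G] [NormedSpace ℝ G] [NormedAddCommGroup H]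
  [NormedSpace ℝ H] {s : ℝ} {U V : Set E} {n : ℕ} {f g : E → F} {D D' : ℝ}

lemma mono (h : HolderBound s U V n f D) (hD : D ≤ D') : HolderBound s U V n f D' :=
  ⟨h.1, fun j hj u hu => (h.2.1 j hj u hu).trans hD, fun u hu v hv =>
    (h.2.2 u hu v hv).trans (by gcongr)⟩

lemma congr (hV : IsOpen V) (hUV : U ⊆ V) (hfg : Set.EqOn f g V) (h : HolderBound s U V n f D) :
    HolderBound s U V n g D := by
  have key : ∀ j, ∀ u ∈ U, iteratedFDeriv ℝ j f u = iteratedFDeriv ℝ j g u := by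
    intro j u hu
    have : f =ᶠ[𝓝 u] g := hfg.eventuallyEq_of_mem (hV.mem_nhds (hUV hu))
    exact (this.iteratedFDeriv ℝ j).eq_of_nhds
  refine ⟨h.1.congr fun x hx => (hfg hx).symm, fun j hj u hu => ?_, fun u hu v hv => ?_⟩
  · rw [← key j u hu]; exact h.2.1 j hj u hu
  · rw [← key n u hu, ← key n v hv]; exact h.2.2 u hu v hv

lemma zero_iff : HolderBound s U V 0 f D ↔ ContinuousOn f V ∧ (∀ u ∈ U, ‖f u‖ ≤ D) ∧
    ∀ u ∈ U, ∀ v ∈ U, ‖f u - f v‖ ≤ D * ‖u - v‖ ^ s := by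
  have e : ∀ u v, ‖iteratedFDeriv ℝ 0 f u - iteratedFDeriv ℝ 0 f v‖ = ‖f u - f v‖ := by
    intro u v
    rw [iteratedFDeriv_zero_eq_comp, Function.comp, Function.comp, ← map_sub,
      LinearIsometryEquiv.norm_map]
  simp only [HolderBound, e]
  refine and_congr (by simp [contDiffOn_zero]) (and_congr ?_ Iff.rfl)
  constructor
  · intro h u hu; simpa using h 0 le_rfl u hu
  · intro h j hj u hu
    obtain rfl : j = 0 := by omega
    simpa using h u hu

/-- Together with `zero_iff` this turns the bound into a recursion on `fderiv`, so that product and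
chain rules can be proved by induction without formulas for higher derivatives. -/
lemma succ_iff (hV : IsOpen V) : HolderBound s U V (n + 1) f D ↔
    DifferentiableOn ℝ f V ∧ (∀ u ∈ U, ‖f u‖ ≤ D) ∧ HolderBound s U V n (fderiv ℝ f) D := by
  have e : ∀ u v, ‖iteratedFDeriv ℝ (n + 1) f u - iteratedFDeriv ℝ (n + 1) f v‖ =
      ‖iteratedFDeriv ℝ n (fderiv ℝ f) u - iteratedFDeriv ℝ n (fderiv ℝ f) v‖ := by
    intro u v
    rw [iteratedFDeriv_succ_eq_comp_right, iteratedFDeriv_succ_eq_comp_right, Function.comp,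
      Function.comp, ← dist_eq_norm, ← dist_eq_norm]
    exact (continuousMultilinearCurryRightEquiv' ℝ n E F).symm.isometry.dist_eq _ _
  have c : ContDiffOn ℝ ((n + 1 : ℕ) : WithTop ℕ∞) f V ↔
      DifferentiableOn ℝ f V ∧ ContDiffOn ℝ n (fderiv ℝ f) V := by
    rw [Nat.cast_add, Nat.cast_one, contDiffOn_succ_iff_fderiv_of_isOpen hV]
    simp
  simp only [HolderBound, e, c]
  constructor
  · rintro ⟨⟨h1, h2⟩, h3, h4⟩
    refine ⟨h1, fun u hu => by simpa using h3 0 (by omega) u hu, h2, fun j hj u hu => ?_, h4⟩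
    rw [norm_iteratedFDeriv_fderiv]; exact h3 (j + 1) (by omega) u hu
  · rintro ⟨h1, h2, h3, h4, h5⟩
    refine ⟨⟨h1, h3⟩, fun j hj u hu => ?_, h5⟩
    rcases j with _ | j
    · simpa using h2 u hu
    · rw [← norm_iteratedFDeriv_fderiv]; exact h4 j (by omega) u hu

lemma add (hV : IsOpen V) (hUV : U ⊆ V) (hf : HolderBound s U V n f D)
    (hg : HolderBound s U V n g D') : HolderBound s U V n (fun x => f x + g x) (D + D') := by
  have key : ∀ j ≤ n, ∀ u ∈ U, iteratedFDeriv ℝ j (fun x => f x + g x) u =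
      iteratedFDeriv ℝ j f u + iteratedFDeriv ℝ j g u := by
    intro j hj u hu
    have hn := hV.mem_nhds (hUV hu)
    exact iteratedFDeriv_add_apply
      ((hf.1.contDiffAt hn).of_le (by exact_mod_cast hj))
      ((hg.1.contDiffAt hn).of_le (by exact_mod_cast hj))
  refine ⟨hf.1.add hg.1, fun j hj u hu => ?_, fun u hu v hv => ?_⟩
  · rw [key j hj u hu]
    exact (norm_add_le _ _).trans (add_le_add (hf.2.1 j hj u hu) (hg.2.1 j hj u hu))
  · rw [key n le_rfl u hu, key n le_rfl v hv, add_sub_add_comm, add_mul]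
    exact (norm_add_le _ _).trans (add_le_add (hf.2.2 u hu v hv) (hg.2.2 u hu v hv))

/-- Nearby points are handled by the mean value inequality on the convex set `U` and `‖u - v‖ ≤ ‖u -
v‖ ^ s`; points at distance at least `1` by the triangle inequality, which is where the factor `2`
comes from. -/
lemma pred (hs : 0 ≤ s) (hs1 : s ≤ 1) (hV : IsOpen V) (hUV : U ⊆ V) (hU : Convex ℝ U)
    (h : HolderBound s U V (n + 1) f D) : HolderBound s U V n f (2 * D) := by
  by_cases hne : U.Nonempty
  swap
  · rw [Set.not_nonempty_iff_eq_empty] at hne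
    subst hne
    exact ⟨h.1.of_le (by exact_mod_cast Nat.le_succ n), by simp, by simp⟩
  obtain ⟨u₀, hu₀⟩ := hne
  have hD : 0 ≤ D := (norm_nonneg _).trans (h.2.1 0 (by omega) u₀ hu₀)
  refine ⟨h.1.of_le (by exact_mod_cast Nat.le_succ n),
    fun j hj u hu => (h.2.1 j (by omega) u hu).trans (by linarith), fun u hu v hv => ?_⟩
  have h1 : ‖iteratedFDeriv ℝ n f u - iteratedFDeriv ℝ n f v‖ ≤ D * ‖u - v‖ := by
    refine hU.norm_image_sub_le_of_norm_fderiv_le (𝕜 := ℝ) (fun x hx => ?_) (fun x hx => ?_) hv hu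
    · exact (h.1.contDiffAt (hV.mem_nhds (hUV hx))).differentiableAt_iteratedFDeriv
        (by exact_mod_cast Nat.lt_succ_self n)
    · rw [norm_fderiv_iteratedFDeriv]
      exact h.2.1 (n + 1) le_rfl x hx
  rcases le_total ‖u - v‖ 1 with h2 | h2
  · refine h1.trans ?_
    have : ‖u - v‖ ≤ ‖u - v‖ ^ s := by
      rcases (norm_nonneg (u - v)).eq_or_lt with h0 | h0
      · rw [← h0]; positivity
      · calc ‖u - v‖ = ‖u - v‖ ^ (1 : ℝ) := (Real.rpow_one _).symm
          _ ≤ _ := Real.rpow_le_rpow_of_exponent_ge h0 h2 hs1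
    nlinarith [norm_nonneg (u - v), mul_nonneg hD (norm_nonneg (u - v))]
  · have h3 : (1 : ℝ) ≤ ‖u - v‖ ^ s := Real.one_le_rpow h2 hs
    calc _ ≤ ‖iteratedFDeriv ℝ n f u‖ + ‖iteratedFDeriv ℝ n f v‖ := norm_sub_le _ _
      _ ≤ D + D := add_le_add (h.2.1 n (by omega) u hu) (h.2.1 n (by omega) v hv)
      _ ≤ 2 * D * ‖u - v‖ ^ s := by nlinarith

/-- Induction through the Leibniz rule: each of its two terms has one undifferentiated factor,
brought down an order by `pred` at cost `2`, hence `4` per derivative. The target spaces are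
quantified inside the induction because differentiating replaces `F` by `E →L[ℝ] F`. -/
lemma bilin (hs : 0 ≤ s) (hs1 : s ≤ 1) (hV : IsOpen V) (hUV : U ⊆ V) (hU : Convex ℝ U)
    (n : ℕ) : ∀ {F G H : Type} [NormedAddCommGroup F] [NormedSpace ℝ F] [NormedAddCommGroup G]
      [NormedSpace ℝ G] [NormedAddCommGroup H] [NormedSpace ℝ H] (B : F →L[ℝ] G →L[ℝ] H)
      {f : E → F} {g : E → G} {D D' : ℝ}, 0 ≤ D → 0 ≤ D' →
      HolderBound s U V n f D → HolderBound s U V n g D' →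
      HolderBound s U V n (fun x => B (f x) (g x)) (2 * 4 ^ n * ‖B‖ * D * D') := by
  induction n with
  | zero =>
    intro F G H _ _ _ _ _ _ B f g D D' hD hD' hf hg
    rw [zero_iff] at hf hg ⊢
    have hB : 0 ≤ ‖B‖ * D * D' := by positivity
    refine ⟨(B.continuous.comp_continuousOn hf.1).clm_apply hg.1, fun u hu => ?_,
      fun u hu v hv => ?_⟩
    · calc ‖B (f u) (g u)‖ ≤ ‖B‖ * ‖f u‖ * ‖g u‖ := B.le_opNorm₂ _ _
        _ ≤ ‖B‖ * D * D' := by gcongr; exacts [hf.2.1 u hu, hg.2.1 u hu]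
        _ ≤ _ := by linarith
    · have : B (f u) (g u) - B (f v) (g v) = B (f u - f v) (g u) + B (f v) (g u - g v) := by
        simp
      rw [this]
      calc _ ≤ ‖B‖ * ‖f u - f v‖ * ‖g u‖ + ‖B‖ * ‖f v‖ * ‖g u - g v‖ :=
            (norm_add_le _ _).trans (add_le_add (B.le_opNorm₂ _ _) (B.le_opNorm₂ _ _))
        _ ≤ ‖B‖ * (D * ‖u - v‖ ^ s) * D' + ‖B‖ * D * (D' * ‖u - v‖ ^ s) := by
            gcongr
            exacts [hf.2.2 u hu v hv, hg.2.1 u hu, hf.2.1 v hv, hg.2.2 u hu v hv]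
        _ = _ := by ring
  | succ n ih =>
    intro F G H _ _ _ _ _ _ B f g D D' hD hD' hf hg
    have hf' := hf.pred hs hs1 hV hUV hU
    have hg' := hg.pred hs hs1 hV hUV hU
    rw [succ_iff hV] at hf hg ⊢
    have hB : 0 ≤ ‖B‖ * D * D' := by positivity
    have h4 : (1 : ℝ) ≤ 4 ^ (n + 1) := one_le_pow₀ (by norm_num)
    refine ⟨fun x hx => ?_, fun u hu => ?_, ?_⟩
    · exact ((B.differentiableAt.comp_differentiableWithinAt x (hf.1 x hx))).clm_apply (hg.1 x hx)
    · calc ‖B (f u) (g u)‖ ≤ ‖B‖ * ‖f u‖ * ‖g u‖ := B.le_opNorm₂ _ _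
        _ ≤ ‖B‖ * D * D' := by gcongr; exacts [hf.2.1 u hu, hg.2.1 u hu]
        _ ≤ _ := by nlinarith
    · have h1 := ih (B.precompR E) (by positivity) hD' hf' hg.2.2
      have h2 := ih (B.precompL E) hD (by positivity) hf.2.2 hg'
      refine (((h1.add hV hUV h2).congr hV hUV ?_)).mono ?_
      · intro x hx
        exact (B.fderiv_of_bilinear ((hf.1 x hx).differentiableAt (hV.mem_nhds hx))
          ((hg.1 x hx).differentiableAt (hV.mem_nhds hx))).symm
      · have e1 := B.norm_precompR_le E
        have e2 := B.norm_precompL_le E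
        calc _ ≤ 2 * 4 ^ n * ‖B‖ * (2 * D) * D' + 2 * 4 ^ n * ‖B‖ * D * (2 * D') := by gcongr
          _ = _ := by ring

/-- A smooth function with bounded derivatives of all orders acts on functions with bounded
`C^{n+s}` norm, with polynomial control of the norm. -/
lemma exists_comp (hs : 0 ≤ s) (hs1 : s ≤ 1) (n : ℕ) : ∀ ψ : ℝ → ℝ, (∀ m : ℕ, ContDiff ℝ m ψ) →
    (∀ j, ∃ C, ∀ t, ‖iteratedDeriv j ψ t‖ ≤ C) →
    ∃ C : ℝ, 1 ≤ C ∧ ∀ (U V : Set E), IsOpen V → U ⊆ V → Convex ℝ U → ∀ (f : E → ℝ) (D : ℝ),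
      1 ≤ D → HolderBound s U V n f D → HolderBound s U V n (fun x => ψ (f x)) (C * D ^ (n + 1)) := by
  induction n with
  | zero =>
    intro ψ hψ hb
    obtain ⟨C₀, h0⟩ := hb 0
    obtain ⟨C₁, h1⟩ := hb 1
    refine ⟨max 1 (max C₀ C₁), le_max_left _ _, fun U V hV hUV hU f D hD hf => ?_⟩
    rw [zero_iff] at hf ⊢
    have hm : (1 : ℝ) ≤ max 1 (max C₀ C₁) := le_max_left _ _
    have hm0 : C₀ ≤ max 1 (max C₀ C₁) := (le_max_left _ _).trans (le_max_right _ _)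
    have hm1 : C₁ ≤ max 1 (max C₀ C₁) := (le_max_right _ _).trans (le_max_right _ _)
    refine ⟨(hψ 0).continuous.comp_continuousOn hf.1, fun u hu => ?_, fun u hu v hv => ?_⟩
    · have := h0 (f u)
      rw [iteratedDeriv_zero] at this
      rw [zero_add, pow_one]
      nlinarith
    · have : ‖ψ (f u) - ψ (f v)‖ ≤ max 1 (max C₀ C₁) * ‖f u - f v‖ := by
        refine Convex.norm_image_sub_le_of_norm_deriv_le (s := Set.univ) (fun x _ => ?_)
          (fun x _ => ?_) convex_univ (Set.mem_univ _) (Set.mem_univ _)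
        · exact ((hψ 1).differentiable (by simp)).differentiableAt
        · have := h1 x
          rw [iteratedDeriv_one] at this
          exact this.trans hm1
      refine this.trans ?_
      rw [zero_add, pow_one, mul_assoc]
      exact mul_le_mul_of_nonneg_left (hf.2.2 u hu v hv) (by linarith)
  | succ n ih =>
    intro ψ hψ hb
    obtain ⟨C₀, h0⟩ := hb 0
    obtain ⟨C, hC1, hC⟩ := ih (deriv ψ) (fun m => by
        have := hψ (m + 1)
        rw [Nat.cast_add, Nat.cast_one, contDiff_succ_iff_deriv] at this
        exact this.2.2) (fun j => by
      obtain ⟨C, h⟩ := hb (j + 1)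
      exact ⟨C, fun t => by rw [← iteratedDeriv_succ']; exact h t⟩)
    refine ⟨max (max 1 C₀) (2 * 4 ^ n * (C * 2 ^ (n + 1))),
      (le_max_left _ _).trans (le_max_left _ _), fun U V hV hUV hU f D hD hf => ?_⟩
    -- Chain rule: the derivative of `ψ ∘ f` is `ψ' (f)` times that of `f`. The induction hypothesis
    -- for `ψ'` controls the first factor, with `2 * D` in place of `D` since `f` is used at one
    -- order less; `bilin` multiplies the two.
    have hf' := hC U V hV hUV hU f (2 * D) (by linarith) (hf.pred hs hs1 hV hUV hU)
    rw [succ_iff hV] at hf ⊢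
    have hd : Differentiable ℝ ψ := (hψ 1).differentiable (by simp)
    have hp : (1 : ℝ) ≤ D ^ (n + 1 + 1) := one_le_pow₀ hD
    refine ⟨fun x hx => hd.differentiableAt.comp_differentiableWithinAt x (hf.1 x hx),
      fun u hu => ?_, ?_⟩
    · have := h0 (f u)
      rw [iteratedDeriv_zero] at this
      have hm : (1 : ℝ) ≤ max (max 1 C₀) (2 * 4 ^ n * (C * 2 ^ (n + 1))) :=
        (le_max_left _ _).trans (le_max_left _ _)
      have hm0 : C₀ ≤ max (max 1 C₀) (2 * 4 ^ n * (C * 2 ^ (n + 1))) :=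
        (le_max_right _ _).trans (le_max_left _ _)
      nlinarith
    · have h1 := bilin hs hs1 hV hUV hU n
        (ContinuousLinearMap.lsmul ℝ ℝ (E := E →L[ℝ] ℝ)) (by positivity) (by linarith) hf' hf.2.2
      refine (h1.congr hV hUV fun x hx => ?_).mono ?_
      · have hfx := (hf.1 x hx).differentiableAt (hV.mem_nhds hx)
        have := (hd.differentiableAt (x := f x)).hasDerivAt.comp_hasFDerivAt x hfx.hasFDerivAt
        exact this.fderiv.symm
      · have hB := ContinuousLinearMap.opNorm_lsmul_le (𝕜 := ℝ) (R := ℝ) (E := E →L[ℝ] ℝ)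
        calc _ ≤ 2 * 4 ^ n * 1 * (C * (2 * D) ^ (n + 1)) * D := by gcongr
          _ = 2 * 4 ^ n * (C * 2 ^ (n + 1)) * D ^ (n + 1 + 1) := by ring
          _ ≤ _ := by gcongr; exact le_max_right _ _

end HolderBound

/-- The function is constant on both sides of `[0, 1]`, and on that compact interval continuity
suffices. -/
lemma Real.smoothTransition.exists_iteratedDeriv_le (j : ℕ) :
    ∃ C, ∀ t, ‖iteratedDeriv j Real.smoothTransition t‖ ≤ C := by
  have hc : Continuous (iteratedDeriv j Real.smoothTransition) :=
    (Real.smoothTransition.contDiff (n := (j : ℕ∞))).continuous_iteratedDeriv j le_rfl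
  obtain ⟨C, hC⟩ := (isCompact_Icc (a := (0 : ℝ)) (b := 1)).exists_bound_of_continuousOn
    hc.continuousOn
  have hk : ∀ c : ℝ, |c| ≤ 1 → ∀ t, ‖iteratedDeriv j (fun _ : ℝ => c) t‖ ≤ 1 := by
    intro c hc t
    rw [iteratedDeriv_const]
    split_ifs <;> simp [hc]
  refine ⟨max C 1, fun t => ?_⟩
  rcases lt_or_ge t 0 with h | h
  · have : Real.smoothTransition =ᶠ[𝓝 t] fun _ => 0 := by
      filter_upwards [Iio_mem_nhds h] with x hx
      exact Real.smoothTransition.zero_of_nonpos (le_of_lt hx)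
    rw [this.iteratedDeriv_eq]
    exact (hk 0 (by simp) t).trans (le_max_right _ _)
  rcases lt_or_ge 1 t with h' | h'
  · have : Real.smoothTransition =ᶠ[𝓝 t] fun _ => 1 := by
      filter_upwards [Ioi_mem_nhds h'] with x hx
      exact Real.smoothTransition.one_of_one_le (le_of_lt hx)
    rw [this.iteratedDeriv_eq]
    exact (hk 1 (by simp) t).trans (le_max_right _ _)
  · exact (hC t ⟨h, h'⟩).trans (le_max_left _ _)

/-! ### `C^r` norms on the manifold -/

section CrNorm

variable {d : ℕ} {r : ℝ} {X : Type*} [TopologicalSpace X]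
  [ChartedSpace (EuclideanSpace ℝ (Fin d)) X]

/-- On the diagonal the quotient in `[0,∞]` is harmless only because its numerator vanishes, which
is what `ha` provides; for `s = 0` the denominator there is `1`. -/
lemma enorm_sub_div_edist_rpow_le_iff {E F : Type*} [NormedAddCommGroup E] [NormedAddCommGroup F]
    {s D : ℝ} (hs : 0 ≤ s) (hD : 0 ≤ D) (u v : E) (a : F) (ha : u = v → a = 0) :
    ‖a‖ₑ / edist u v ^ s ≤ ENNReal.ofReal D ↔ ‖a‖ ≤ D * ‖u - v‖ ^ s := by
  rcases eq_or_ne u v with rfl | huv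
  · simp only [ha rfl, enorm_zero, ENNReal.zero_div, zero_le, norm_zero, true_iff]
    positivity
  · have hpos : 0 < ‖u - v‖ := norm_pos_iff.2 (sub_ne_zero.2 huv)
    have hpos' : 0 < ‖u - v‖ ^ s := Real.rpow_pos_of_pos hpos s
    have he : edist u v ^ s = ENNReal.ofReal (‖u - v‖ ^ s) := by
      rw [edist_dist, dist_eq_norm, ENNReal.ofReal_rpow_of_nonneg hpos.le hs]
    rw [he, ENNReal.div_le_iff (by simpa using hpos') ENNReal.ofReal_ne_top,
      ← ENNReal.ofReal_mul hD, ← ofReal_norm,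
      ENNReal.ofReal_le_ofReal_iff (by positivity)]

lemma crNorm_le_ofReal_iff (hr : 0 < r) (N : BallCover d r X) {f : X → ℝ}
    (hf : ContMDiff (𝓡 d) 𝓘(ℝ, ℝ) ((⌊r⌋₊ : ℕ) : WithTop ℕ∞) f) {D : ℝ} (hD : 0 ≤ D) :
    crNorm N f ≤ ENNReal.ofReal D ↔ ∀ i, HolderBound (r - ⌊r⌋₊)
      (Metric.closedBall (N.center i) (N.radius i)) (N.chart i).target ⌊r⌋₊
      (f ∘ (N.chart i).symm) D := by
  have hs : 0 ≤ r - ⌊r⌋₊ := sub_nonneg.2 (Nat.floor_le hr.le)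
  unfold crNorm
  rw [iSup_le_iff]
  refine forall_congr' fun i => ?_
  have hc : ContDiffOn ℝ ((⌊r⌋₊ : ℕ) : WithTop ℕ∞) (f ∘ (N.chart i).symm) (N.chart i).target := by
    rw [← contMDiffOn_iff_contDiffOn]
    exact hf.comp_contMDiffOn (contMDiffOn_symm_of_mem_maximalAtlas (N.chart_mem i))
  rw [sup_le_iff, HolderBound, and_iff_right hc]
  simp only [iSup_le_iff]
  refine and_congr ?_ ?_
  · refine forall_congr' fun j => forall_congr' fun hj => forall_congr' fun u =>
      forall_congr' fun hu => ?_
    rw [← ofReal_norm, ENNReal.ofReal_le_ofReal_iff hD]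
  · refine forall_congr' fun u => forall_congr' fun hu => forall_congr' fun v =>
      forall_congr' fun hv => ?_
    exact enorm_sub_div_edist_rpow_le_iff hs hD u v _ (by rintro rfl; simp)

/-- Composition with the smooth transition function controls `C^r` norms polynomially. -/
lemma exists_crNorm_smoothTransition_comp_le (hr : 0 < r) (N : BallCover d r X) :
    ∃ C : ℝ, 1 ≤ C ∧ ∀ f : X → ℝ, IsCr N f → ∀ D : ℝ, 1 ≤ D → (crNorm N f).toReal ≤ D →
      IsCr N (fun x => Real.smoothTransition (f x)) ∧
      (crNorm N (fun x => Real.smoothTransition (f x))).toReal ≤ C * D ^ (⌊r⌋₊ + 1) := by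
  have hs : 0 ≤ r - ⌊r⌋₊ := sub_nonneg.2 (Nat.floor_le hr.le)
  have hs1 : r - ⌊r⌋₊ ≤ 1 := by linarith [Nat.lt_floor_add_one r]
  obtain ⟨C, hC, h⟩ := HolderBound.exists_comp (E := EuclideanSpace ℝ (Fin d)) hs hs1 ⌊r⌋₊
    Real.smoothTransition (fun m => Real.smoothTransition.contDiff (n := (m : ℕ∞)))
    Real.smoothTransition.exists_iteratedDeriv_le
  refine ⟨C, hC, fun f hf D hD hfD => ?_⟩
  have h1 : crNorm N f ≤ ENNReal.ofReal D := ENNReal.le_ofReal_iff_toReal_le hf.2.ne (by linarith)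
    |>.2 hfD
  rw [crNorm_le_ofReal_iff hr N hf.1 (by linarith)] at h1
  have hsm : ContMDiff (𝓡 d) 𝓘(ℝ, ℝ) ((⌊r⌋₊ : ℕ) : WithTop ℕ∞)
      (fun x => Real.smoothTransition (f x)) :=
    (Real.smoothTransition.contDiff (n := (⌊r⌋₊ : ℕ∞))).contMDiff.comp hf.1
  have h2 : crNorm N (fun x => Real.smoothTransition (f x)) ≤
      ENNReal.ofReal (C * D ^ (⌊r⌋₊ + 1)) := by
    rw [crNorm_le_ofReal_iff hr N hsm (by positivity)]
    exact fun i => h _ _ (N.chart i).open_target (N.ball_subset i) (convex_closedBall _ _) _ D hD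
      (h1 i)
  exact ⟨⟨hsm, h2.trans_lt ENNReal.ofReal_lt_top⟩, ENNReal.toReal_le_of_le_ofReal (by positivity) h2⟩

end CrNorm

/-- Replace the factors one at a time; all the others are at most `1` in absolute value. -/
lemma Finset.abs_prod_sub_prod_le_sum {ι : Type*} (s : Finset ι) (a b : ι → ℝ)
    (ha : ∀ i ∈ s, |a i| ≤ 1) (hb : ∀ i ∈ s, |b i| ≤ 1) :
    |∏ i ∈ s, a i - ∏ i ∈ s, b i| ≤ ∑ i ∈ s, |a i - b i| := by
  classical
  induction s using Finset.induction_on with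
  | empty => simp
  | insert i s hi ih =>
    rw [Finset.prod_insert hi, Finset.prod_insert hi, Finset.sum_insert hi]
    have h1 := ih (fun j hj => ha j (Finset.mem_insert_of_mem hj))
      (fun j hj => hb j (Finset.mem_insert_of_mem hj))
    have h2 : |∏ j ∈ s, a j| ≤ 1 := by
      rw [Finset.abs_prod]
      exact Finset.prod_le_one (fun _ _ => abs_nonneg _)
        (fun j hj => ha j (Finset.mem_insert_of_mem hj))
    have h3 := hb i (Finset.mem_insert_self _ _)
    have e : a i * ∏ j ∈ s, a j - b i * ∏ j ∈ s, b j =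
      (a i - b i) * ∏ j ∈ s, a j + b i * (∏ j ∈ s, a j - ∏ j ∈ s, b j) := by ring
    rw [e]
    refine (abs_add_le _ _).trans ?_
    rw [abs_mul, abs_mul]
    nlinarith [abs_nonneg (a i - b i), abs_nonneg (∏ j ∈ s, a j - ∏ j ∈ s, b j)]

/-! ### Fibrewise iterates -/

section FiberIter

variable {X Y : Type*} {T : Y → X → X} {R : Y → Y}

lemma measurePreserving_fiberIter [MeasurableSpace X] {μ : Measure X}
    (hT : ∀ y, MeasurePreserving (T y) μ μ) (y : Y) (n : ℕ) :
    MeasurePreserving (fiberIter T R y n) μ μ := by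
  induction n with
  | zero => exact MeasurePreserving.id μ
  | succ n ih => exact (hT _).comp ih

lemma fiberIter_add (y : Y) (m n : ℕ) (x : X) :
    fiberIter T R y (m + n) x = fiberIter T R (R^[m] y) n (fiberIter T R y m x) := by
  induction n with
  | zero => rfl
  | succ n ih =>
    rw [← add_assoc]
    simp only [fiberIter, Function.comp, ih]
    rw [← Function.iterate_add_apply, add_comm n m]

end FiberIter

/-! ### Mixing for sets by sandwiching with `C^r` functions -/

section Approx

variable {d : ℕ} {r : ℝ} {X : Type*} [TopologicalSpace X]
  [ChartedSpace (EuclideanSpace ℝ (Fin d)) X] [MeasurableSpace X]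

/-- `g` is a `[0,1]`-valued `C^r` function of norm at most `D` with integral `ε`-close to `b`. -/
structure IsCrApprox (N : BallCover d r X) (μ : Measure X) (ε D b : ℝ) (g : X → ℝ) : Prop where
  isCr : IsCr N g
  nonneg : ∀ x, 0 ≤ g x
  le_one : ∀ x, g x ≤ 1
  norm_le : (crNorm N g).toReal ≤ D
  integral_sub_le : |∫ x, g x ∂μ - b| ≤ ε

/-- The functions from regular approximability need not lie in `[0,1]`. Composing with the smooth
step forces this, preserves both inequalities and every point where the function already equals the
indicator, and worsens the norm from `ε ^ (-r)` only to the power `⌊r⌋₊ + 1` of it. -/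
lemma exists_isCrApprox [BorelSpace X] (hr : 0 < r) (hd : 1 ≤ d) (N : BallCover d r X)
    (μ : Measure X) [IsProbabilityMeasure μ] (C : ℝ) :
    ∃ C' : ℝ, 1 ≤ C' ∧ ∀ B : Set X, RegApproxWith N μ C B → ∀ ε : ℝ, 0 < ε → ε ≤ 1 →
      ε < (1 / 10) * μ.real B ^ ((1 : ℝ) / d) →
      ∃ glow gup : X → ℝ, IsCrApprox N μ ε (C' * ε ^ (-(r * (⌊r⌋₊ + 1)))) (μ.real B) glow ∧
        IsCrApprox N μ ε (C' * ε ^ (-(r * (⌊r⌋₊ + 1)))) (μ.real B) gup ∧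
        (∀ x, glow x ≤ B.indicator 1 x) ∧ (∀ x, B.indicator 1 x ≤ gup x) := by
  obtain ⟨C₀, hC₀, h⟩ := exists_crNorm_smoothTransition_comp_le hr N
  set C₁ := max 1 C with hC₁
  have h1 : 1 ≤ C₁ := le_max_left _ _
  refine ⟨C₀ * C₁ ^ (⌊r⌋₊ + 1), one_le_mul_of_one_le_of_one_le hC₀ (one_le_pow₀ h1),
    fun B hB ε hε hε1 hεB => ?_⟩
  obtain ⟨hlow, hup, hlow1, hup1, hlow2, hup2, happ⟩ := hB.2 ε hε hεB
  have hpow : 1 ≤ ε ^ (-r) := by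
    rw [Real.rpow_neg hε.le]
    exact (one_le_inv₀ (by positivity)).2 (Real.rpow_le_one hε.le hε1 hr.le)
  have hD : 1 ≤ C₁ * ε ^ (-r) := one_le_mul_of_one_le_of_one_le h1 hpow
  have hDe : C₀ * (C₁ * ε ^ (-r)) ^ (⌊r⌋₊ + 1) =
      C₀ * C₁ ^ (⌊r⌋₊ + 1) * ε ^ (-(r * (⌊r⌋₊ + 1))) := by
    rw [mul_pow, mul_assoc, ← Real.rpow_natCast (ε ^ (-r)), ← Real.rpow_mul hε.le]
    push_cast
    ring_nf
  have key : ∀ f ∈ ({hlow, hup} : Set (X → ℝ)), IsCr N f →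
      (∀ x, B.indicator 1 x = f x → Real.smoothTransition (f x) = B.indicator 1 x) →
      IsCrApprox N μ ε (C₀ * C₁ ^ (⌊r⌋₊ + 1) * ε ^ (-(r * (⌊r⌋₊ + 1)))) (μ.real B)
        (fun x => Real.smoothTransition (f x)) := by
    intro f hf hfCr heq
    obtain ⟨hm, hn⟩ := happ f hf
    obtain ⟨hs1, hs2⟩ := h f hfCr _ hD (hn.trans (by gcongr; exact le_max_right _ _))
    have hmeas : Measurable (fun x => Real.smoothTransition (f x)) := hs1.1.continuous.measurable
    have hmf : Measurable f := hfCr.1.continuous.measurable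
    have hind : Measurable (B.indicator (1 : X → ℝ)) := measurable_one.indicator hB.1
    refine ⟨hs1, fun x => Real.smoothTransition.nonneg _, fun x => Real.smoothTransition.le_one _,
      hs2.trans hDe.le, ?_⟩
    have hi1 : Integrable (fun x => Real.smoothTransition (f x)) μ :=
      Integrable.of_bound hmeas.aestronglyMeasurable 1 (ae_of_all _ fun x => by
        rw [Real.norm_of_nonneg (Real.smoothTransition.nonneg _)]
        exact Real.smoothTransition.le_one _)
    have hi2 : Integrable (B.indicator (1 : X → ℝ)) μ := (integrable_const (1 : ℝ)).indicator hB.1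
    set S : Set X := {x | B.indicator 1 x ≠ f x} with hS
    have hSm : MeasurableSet S := (measurableSet_eq_fun hind hmf).compl
    rw [← integral_indicator_one hB.1, ← integral_sub hi1 hi2]
    calc |∫ x, (Real.smoothTransition (f x) - B.indicator 1 x) ∂μ|
        ≤ ∫ x, |Real.smoothTransition (f x) - B.indicator 1 x| ∂μ := abs_integral_le_integral_abs
      _ ≤ ∫ x, S.indicator 1 x ∂μ := by
          refine integral_mono (hi1.sub hi2).abs ((integrable_const (1 : ℝ)).indicator hSm) ?_
          intro x
          by_cases hx : x ∈ S
          · simp only [Set.indicator_of_mem hx, Pi.one_apply]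
            have a := Real.smoothTransition.nonneg (f x)
            have b := Real.smoothTransition.le_one (f x)
            by_cases hxB : x ∈ B
            · simp only [Set.indicator_of_mem hxB, Pi.one_apply]
              rw [abs_le]; constructor <;> linarith
            · simp only [Set.indicator_of_notMem hxB]
              rw [abs_le]; constructor <;> linarith
          · simp only [Set.indicator_of_notMem hx]
            have : B.indicator 1 x = f x := by simpa [hS] using hx
            rw [heq x this, sub_self, abs_zero]
      _ = μ.real S := integral_indicator_one hSm
      _ ≤ μ.real B ^ (((d : ℝ) - 1) / d) * ε := hm
      -- The gain `μ(B) ^ ((d - 1) / d)` is given away: `ε` will be a high power of `ρ`, so it is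
      -- not needed.
      _ ≤ 1 * ε := by
          gcongr
          refine Real.rpow_le_one measureReal_nonneg measureReal_le_one ?_
          have : (1 : ℝ) ≤ d := by exact_mod_cast hd
          apply div_nonneg <;> linarith
      _ = ε := one_mul ε
  have heq : ∀ f : X → ℝ, ∀ x, B.indicator 1 x = f x →
      Real.smoothTransition (f x) = B.indicator 1 x := by
    intro f x hx
    rw [← hx]
    by_cases hxB : x ∈ B <;> simp [hxB]
  refine ⟨fun x => Real.smoothTransition (hlow x), fun x => Real.smoothTransition (hup x),
    key _ (by simp) hlow1 (heq _), key _ (by simp) hup1 (heq _),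
    fun x => ?_, fun x => ?_⟩
  · by_cases hxB : x ∈ B
    · simpa [hxB] using Real.smoothTransition.le_one _
    · have := hlow2 x
      simp only [hxB, not_false_eq_true, Set.indicator_of_notMem] at this ⊢
      rw [Real.smoothTransition.zero_of_nonpos this]
  · by_cases hxB : x ∈ B
    · have := hup2 x
      simp only [hxB, Set.indicator_of_mem, Pi.one_apply] at this ⊢
      rw [Real.smoothTransition.one_of_one_le this]
    · simpa [hxB] using Real.smoothTransition.nonneg _

variable {Y : Type*}

/-- Since all functions are nonnegative, products of lower and of upper approximations sandwich the
product of indicators. Mixing costs the exponential term, and replacing the integrals by the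
measures costs `ε` per factor. -/
lemma abs_measureReal_sub_prod_le [BorelSpace X] (N : BallCover d r X)
    (μ : Measure X) [IsProbabilityMeasure μ] {T : Y → X → X} {R : Y → Y}
    (hT : ∀ y, MeasurePreserving (T y) μ μ) {y : Y} {q p : ℕ} {C γ ε D : ℝ} (hC : 0 ≤ C)
    {k : Fin q → ℕ}
    (hmix : ∀ f : Fin q → X → ℝ, (∀ j, IsCr N (f j)) →
      |(∫ x, ∏ j, f j (fiberIter T R y (k j) x) ∂μ) - ∏ j, ∫ x, f j x ∂μ|
        ≤ C * Real.exp (-γ * p) * ∏ j, (crNorm N (f j)).toReal)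
    {B : Fin q → Set X} (hB : ∀ j, MeasurableSet (B j))
    (happ : ∀ j, ∃ glow gup : X → ℝ, IsCrApprox N μ ε D (μ.real (B j)) glow ∧
        IsCrApprox N μ ε D (μ.real (B j)) gup ∧
        (∀ x, glow x ≤ (B j).indicator 1 x) ∧ (∀ x, (B j).indicator 1 x ≤ gup x)) :
    |μ.real {x | ∀ j, fiberIter T R y (k j) x ∈ B j} - ∏ j, μ.real (B j)| ≤
      q * ε + C * Real.exp (-γ * p) * D ^ q := by
  choose glow gup h1 h2 h3 h4 using happ
  have hTm : ∀ n, Measurable (fiberIter T R y n) :=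
    fun n => (measurePreserving_fiberIter hT y n).measurable
  set S : Set X := {x | ∀ j, fiberIter T R y (k j) x ∈ B j} with hS
  have hSm : MeasurableSet S := by
    rw [hS, Set.ofPred_forall]
    exact MeasurableSet.iInter fun j => hTm _ (hB j)
  have hind : ∀ x, S.indicator (1 : X → ℝ) x =
      ∏ j, (B j).indicator (1 : X → ℝ) (fiberIter T R y (k j) x) := by
    intro x
    by_cases hx : x ∈ S
    · rw [Set.indicator_of_mem hx]
      exact (Finset.prod_eq_one fun j _ => by rw [Set.indicator_of_mem (hx j)]; rfl).symm
    · rw [Set.indicator_of_notMem hx]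
      have : ∃ j, fiberIter T R y (k j) x ∉ B j := by simpa [hS] using hx
      obtain ⟨j, hj⟩ := this
      exact (Finset.prod_eq_zero (Finset.mem_univ j) (Set.indicator_of_notMem hj _)).symm
  have key : ∀ g : Fin q → X → ℝ, (∀ j, IsCrApprox N μ ε D (μ.real (B j)) (g j)) →
      Integrable (fun x => ∏ j, g j (fiberIter T R y (k j) x)) μ ∧
      |(∫ x, ∏ j, g j (fiberIter T R y (k j) x) ∂μ) - ∏ j, μ.real (B j)| ≤
        q * ε + C * Real.exp (-γ * p) * D ^ q := by
    intro g hg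
    have hgm : ∀ j, Measurable (g j) := fun j => (hg j).isCr.1.continuous.measurable
    refine ⟨Integrable.of_bound (Finset.measurable_prod _ fun j _ =>
      (hgm j).comp (hTm _)).aestronglyMeasurable 1 (ae_of_all _ fun x => ?_), ?_⟩
    · rw [Real.norm_of_nonneg (Finset.prod_nonneg fun j _ => (hg j).nonneg _)]
      exact Finset.prod_le_one (fun j _ => (hg j).nonneg _) (fun j _ => (hg j).le_one _)
    · have a1 := hmix g fun j => (hg j).isCr
      have a2 : ∏ j, (crNorm N (g j)).toReal ≤ D ^ q := by
        calc _ ≤ ∏ _j : Fin q, D :=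
              Finset.prod_le_prod (fun _ _ => ENNReal.toReal_nonneg) fun j _ => (hg j).norm_le
          _ = D ^ q := by simp
      have a3 : |∏ j, ∫ x, g j x ∂μ - ∏ j, μ.real (B j)| ≤ q * ε := by
        calc _ ≤ ∑ j : Fin q, |∫ x, g j x ∂μ - μ.real (B j)| := by
              refine Finset.abs_prod_sub_prod_le_sum _ _ _ (fun j _ => ?_) (fun j _ => ?_)
              · rw [abs_of_nonneg (integral_nonneg (hg j).nonneg)]
                have hi : Integrable (g j) μ :=
                  Integrable.of_bound (hgm j).aestronglyMeasurable 1 (ae_of_all _ fun x => by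
                    rw [Real.norm_of_nonneg ((hg j).nonneg x)]; exact (hg j).le_one x)
                calc ∫ x, g j x ∂μ ≤ ∫ _x, (1 : ℝ) ∂μ :=
                      integral_mono hi (integrable_const _) (hg j).le_one
                  _ = 1 := by simp
              · rw [abs_of_nonneg measureReal_nonneg]; exact measureReal_le_one
          _ ≤ ∑ _j : Fin q, ε := Finset.sum_le_sum fun j _ => (hg j).integral_sub_le
          _ = q * ε := by simp
      calc _ ≤ |(∫ x, ∏ j, g j (fiberIter T R y (k j) x) ∂μ) - ∏ j, ∫ x, g j x ∂μ| +
            |∏ j, ∫ x, g j x ∂μ - ∏ j, μ.real (B j)| := abs_sub_le _ _ _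
        _ ≤ C * Real.exp (-γ * p) * D ^ q + q * ε := by
            refine add_le_add (a1.trans ?_) a3
            gcongr
        _ = _ := add_comm _ _
  obtain ⟨i1, b1⟩ := key glow h1
  obtain ⟨i2, b2⟩ := key gup h2
  have hSi : Integrable (S.indicator (1 : X → ℝ)) μ := (integrable_const (1 : ℝ)).indicator hSm
  have hp0 : ∀ j x, 0 ≤ (B j).indicator (1 : X → ℝ) x := fun j x =>
    Set.indicator_nonneg (fun _ _ => zero_le_one) x
  have c1 : ∫ x, ∏ j, glow j (fiberIter T R y (k j) x) ∂μ ≤ μ.real S := by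
    rw [← integral_indicator_one hSm]
    refine integral_mono i1 hSi fun x => ?_
    dsimp only
    rw [hind]
    exact Finset.prod_le_prod (fun j _ => (h1 j).nonneg _) fun j _ => h3 j _
  have c2 : μ.real S ≤ ∫ x, ∏ j, gup j (fiberIter T R y (k j) x) ∂μ := by
    rw [← integral_indicator_one hSm]
    refine integral_mono hSi i2 fun x => ?_
    dsimp only
    rw [hind]
    exact Finset.prod_le_prod (fun j _ => hp0 _ _) fun j _ => h4 j _
  rw [abs_le] at b1 b2 ⊢
  constructor <;> linarith [b1.1, b2.2]

end Approx

/-! ### Size of the targets and of their logarithm -/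

section Asymp

variable {X : Type*} [MeasurableSpace X] {μ : Measure X} [IsProbabilityMeasure μ] {K : ℕ}
  {A : ℕ → Fin K → Set X} {ω : Fin K → ℝ} {ρ : ℕ → ℝ} {d : ℕ}

lemma exists_measureReal_bounds (hω : ∀ k, 0 < ω k) (hρ : ∀ l, 0 < ρ l)
    (hmeas : ∀ k, (fun l => μ.real (A l k) - ω k * ρ l ^ d) =o[atTop] (fun l => ρ l ^ d))
    (k₀ : Fin K) :
    ∃ c C : ℝ, 0 < c ∧ 0 < C ∧ ∀ᶠ l in atTop,
      (∀ k, c * ρ l ^ d ≤ μ.real (A l k) ∧ μ.real (A l k) ≤ C * ρ l ^ d) ∧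
      c * ρ l ^ d ≤ μ.real (⋃ k, A l k) ∧ μ.real (⋃ k, A l k) ≤ C * ρ l ^ d := by
  have : Nonempty (Fin K) := ⟨k₀⟩
  obtain ⟨k₁, hk₁⟩ := Finite.exists_min ω
  have hS : 0 < ∑ k, ω k := Finset.sum_pos (fun k _ => hω k) ⟨k₀, Finset.mem_univ _⟩
  refine ⟨ω k₁ / 2, 2 * ∑ k, ω k, by linarith [hω k₁], by linarith, ?_⟩
  have hev : ∀ᶠ l in atTop, ∀ k, |μ.real (A l k) - ω k * ρ l ^ d| ≤ ω k / 2 * ρ l ^ d := by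
    rw [eventually_all]
    intro k
    filter_upwards [(hmeas k).def (half_pos (hω k))] with l hl
    rw [Real.norm_eq_abs, Real.norm_of_nonneg (pow_pos (hρ l) d).le] at hl
    exact hl
  filter_upwards [hev] with l hl
  have hp : 0 < ρ l ^ d := pow_pos (hρ l) d
  have h1 : ∀ k, ω k / 2 * ρ l ^ d ≤ μ.real (A l k) ∧ μ.real (A l k) ≤ 2 * ω k * ρ l ^ d := by
    intro k
    have := abs_le.1 (hl k)
    have h2 := mul_pos (hω k) hp
    constructor <;> nlinarith [this.1, this.2]
  refine ⟨fun k => ⟨le_trans (by gcongr; exact hk₁ k) (h1 k).1, (h1 k).2.trans ?_⟩,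
    (h1 k₁).1.trans ?_, ?_⟩
  · gcongr
    exact Finset.single_le_sum (f := ω) (fun i _ => (hω i).le) (Finset.mem_univ k)
  · exact measureReal_mono (Set.subset_iUnion _ k₁)
  · calc μ.real (⋃ k, A l k) ≤ ∑ k, μ.real (A l k) := measureReal_iUnion_fintype_le _
      _ ≤ ∑ k, 2 * ω k * ρ l ^ d := Finset.sum_le_sum fun k _ => (h1 k).2
      _ = _ := by rw [← Finset.sum_mul, Finset.mul_sum]

lemma absLogMeas_eq (A : ℕ → Set X) (l : ℕ) :
    absLogMeas μ A l = -Real.log (μ.real (A l)) :=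
  abs_of_nonpos (Real.log_nonpos measureReal_nonneg measureReal_le_one)

variable {c C : ℝ}

/-- The second limit says that a logarithmic time window is negligible against the time scale `ρ ^
(-d)`; it follows from `t log t → 0` as `t → 0` and comparability of `μ(A_l)` with `ρ ^ d`. -/
lemma tendsto_absLogMeas (hd : 1 ≤ d) (hc : 0 < c) (hρ : ∀ l, 0 < ρ l)
    (hρ0 : Tendsto ρ atTop (𝓝 0)) {A : ℕ → Set X}
    (h : ∀ᶠ l in atTop, c * ρ l ^ d ≤ μ.real (A l) ∧ μ.real (A l) ≤ C * ρ l ^ d) :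
    Tendsto (absLogMeas μ A) atTop atTop ∧
      Tendsto (fun l => absLogMeas μ A l * ρ l ^ d) atTop (𝓝 0) := by
  have hp : Tendsto (fun l => ρ l ^ d) atTop (𝓝 0) := by
    have := hρ0.pow d
    rwa [zero_pow (by omega)] at this
  have hpC : Tendsto (fun l => C * ρ l ^ d) atTop (𝓝 0) := by simpa using hp.const_mul C
  have h0 : Tendsto (fun l => μ.real (A l)) atTop (𝓝 0) := by
    refine tendsto_of_tendsto_of_tendsto_of_le_of_le' tendsto_const_nhds
      hpC (Eventually.of_forall fun _ => measureReal_nonneg)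
      (h.mono fun l hl => hl.2)
  have h0' : Tendsto (fun l => μ.real (A l)) atTop (𝓝[>] 0) :=
    tendsto_nhdsWithin_iff.2 ⟨h0, h.mono fun l hl =>
      (mul_pos hc (pow_pos (hρ l) d)).trans_le hl.1⟩
  constructor
  · exact (tendsto_neg_atBot_atTop.comp (Real.tendsto_log_nhdsGT_zero.comp h0')).congr
      fun l => (absLogMeas_eq A l).symm
  · have h1 : Tendsto (fun l => Real.negMulLog (μ.real (A l)) / c) atTop (𝓝 0) := by
      have := (Real.continuous_negMulLog.tendsto 0).comp h0
      rw [Real.negMulLog_zero] at this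
      have h := this.div_const c
      rw [zero_div] at h
      exact h
    refine tendsto_of_tendsto_of_tendsto_of_le_of_le' tendsto_const_nhds h1
      (Eventually.of_forall fun l => mul_nonneg (abs_nonneg _) (pow_pos (hρ l) d).le)
      (h.mono fun l hl => ?_)
    rw [absLogMeas_eq, Real.negMulLog, le_div_iff₀ hc]
    have h2 : 0 ≤ -Real.log (μ.real (A l)) := by
      rw [← absLogMeas_eq]; exact abs_nonneg _
    nlinarith [mul_le_mul_of_nonneg_left hl.1 h2]

end Asymp

/-! ### Mixing with polynomially small error along logarithmic gaps -/

section Rate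

variable {d : ℕ} {r : ℝ} {X Y : Type*} [TopologicalSpace X]
  [ChartedSpace (EuclideanSpace ℝ (Fin d)) X] [MeasurableSpace X] [BorelSpace X]

/-- Multiple mixing for the sets `A l k` along sufficiently separated times, with an error of
arbitrary polynomial order. -/
lemma exists_mixing_rate (hd : 1 ≤ d) (hr : 0 < r) (N : BallCover d r X) (μ : Measure X)
    [IsProbabilityMeasure μ] {T : Y → X → X} {R : Y → Y}
    (hT : ∀ y, MeasurePreserving (T y) μ μ) {y : Y} (hy : ExpMixingAt N μ T R y)
    {K : ℕ} {A : ℕ → Fin K → Set X} {ρ : ℕ → ℝ}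
    (hA : RegApproxFamily N μ (fun q : ℕ × Fin K => A q.1 q.2))
    (hρ : ∀ l, 0 < ρ l) (hρ0 : Tendsto ρ atTop (𝓝 0)) {c C : ℝ} (hc : 0 < c) (hC : 0 < C)
    (hm : ∀ᶠ l in atTop, (∀ k, c * ρ l ^ d ≤ μ.real (A l k) ∧ μ.real (A l k) ≤ C * ρ l ^ d) ∧
      c * ρ l ^ d ≤ μ.real (⋃ k, A l k) ∧ μ.real (⋃ k, A l k) ≤ C * ρ l ^ d)
    (q Q : ℕ) (hQ : 2 ≤ Q) :
    ∃ M C' : ℝ, 0 < M ∧ 0 < C' ∧ ∀ᶠ l in atTop, ∀ p : ℕ,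
      M * absLogMeas μ (fun l => ⋃ k, A l k) l ≤ p → ∀ (κ : Fin q → Fin K) (k : Fin q → ℕ),
      Monotone k → (∀ i j, i < j → k i + p ≤ k j) →
      |μ.real {x | ∀ j, fiberIter T R y (k j) x ∈ A l (κ j)} - ∏ j, μ.real (A l (κ j))| ≤
        C' * ρ l ^ Q := by
  -- Mixing is assumed for at least one factor only; the empty product is trivial.
  rcases Nat.eq_zero_or_pos q with rfl | hq
  · exact ⟨1, 1, one_pos, one_pos, Eventually.of_forall fun l p _ κ k _ _ => by
      simp [(hρ l).le]⟩
  obtain ⟨γ, hγ, hmix⟩ := hy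
  obtain ⟨Cq, hCq, hmix⟩ := hmix q hq
  obtain ⟨C₀, -, hA⟩ := hA
  obtain ⟨C₁, hC₁, happ⟩ := exists_isCrApprox hr hd N μ C₀
  have hd0 : (0 : ℝ) < d := by exact_mod_cast hd
  set E : ℝ := r * (⌊r⌋₊ + 1) with hE
  have hE0 : 0 < E := by positivity
  -- A gap of `M |log μ(A_l)|` yields the factor `ρ ^ (d * γ * M)`, up to a constant. The norms cost
  -- `ρ ^ (-(Q * E * q))`, and `M` is chosen to leave exactly `ρ ^ Q`.
  set M : ℝ := (Q * E * q + Q) / (d * γ) with hM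
  have hQ0 : (0 : ℝ) < Q := by exact_mod_cast (by omega : 0 < Q)
  have hM0 : 0 < M := by positivity
  refine ⟨M, q + Cq * C ^ (γ * M) * C₁ ^ q, hM0, by positivity, ?_⟩
  have hsmall : ∀ᶠ l in atTop, ρ l < 1 / 10 * c ^ ((1 : ℝ) / d) :=
    hρ0.eventually_lt_const (by positivity)
  filter_upwards [hm, hsmall, hρ0.eventually_lt_const one_pos] with l hl hs hρ1 p hp κ k hk hgap
  have hρl := hρ l
  -- Since `Q ≥ 2`, this is eventually below the admissible bound `μ(B) ^ (1 / d) / 10`, which is of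
  -- order `ρ`.
  set ε : ℝ := ρ l ^ Q with hε
  have hε0 : 0 < ε := by positivity
  have hε1 : ε ≤ 1 := pow_le_one₀ hρl.le hρ1.le
  have hcr : ∀ k, c ^ ((1 : ℝ) / d) * ρ l ≤ μ.real (A l k) ^ ((1 : ℝ) / d) := by
    intro k
    calc c ^ ((1 : ℝ) / d) * ρ l = (c * ρ l ^ d) ^ ((1 : ℝ) / d) := by
          rw [Real.mul_rpow hc.le (by positivity), ← Real.rpow_natCast (ρ l), ← Real.rpow_mul hρl.le,
            mul_one_div_cancel hd0.ne', Real.rpow_one]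
      _ ≤ _ := Real.rpow_le_rpow (by positivity) (hl.1 k).1 (by positivity)
  have hεlt : ∀ k, ε < 1 / 10 * μ.real (A l k) ^ ((1 : ℝ) / d) := by
    intro k
    calc ε ≤ ρ l ^ 2 := pow_le_pow_of_le_one hρl.le hρ1.le hQ
      _ = ρ l * ρ l := sq _
      _ < 1 / 10 * c ^ ((1 : ℝ) / d) * ρ l := by gcongr
      _ = 1 / 10 * (c ^ ((1 : ℝ) / d) * ρ l) := by ring
      _ ≤ _ := by gcongr; exact hcr k
  have h1 := abs_measureReal_sub_prod_le N μ hT (y := y) (R := R) (q := q) (p := p) (C := Cq) (γ := γ)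
    (by linarith) (fun f hf => hmix f hf k hk p hgap) (B := fun j => A l (κ j))
    (fun j => (hA (l, κ j)).1) (fun j => happ _ (hA (l, κ j)) ε hε0 hε1 (hεlt _))
  refine h1.trans ?_
  have hmA : 0 < μ.real (⋃ k, A l k) := (by positivity : 0 < c * ρ l ^ d).trans_le hl.2.1
  have hexp : Real.exp (-γ * p) ≤ C ^ (γ * M) * ρ l ^ (d * γ * M) := by
    calc Real.exp (-γ * p) ≤ Real.exp (Real.log (μ.real (⋃ k, A l k)) * (γ * M)) := by
          rw [absLogMeas_eq] at hp
          apply Real.exp_le_exp.2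
          nlinarith
      _ = μ.real (⋃ k, A l k) ^ (γ * M) := (Real.rpow_def_of_pos hmA _).symm
      _ ≤ (C * ρ l ^ d) ^ (γ * M) := Real.rpow_le_rpow hmA.le hl.2.2 (by positivity)
      _ = _ := by
          rw [Real.mul_rpow hC.le (by positivity), ← Real.rpow_natCast (ρ l), ← Real.rpow_mul hρl.le,
            mul_assoc (d : ℝ)]
  have hDq : (C₁ * ε ^ (-E)) ^ q = C₁ ^ q * ρ l ^ (-(Q * E * q)) := by
    rw [mul_pow, hε, ← Real.rpow_natCast (ρ l), ← Real.rpow_mul hρl.le, ← Real.rpow_natCast (_ ^ _),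
      ← Real.rpow_mul hρl.le]
    congr 2
    ring
  have hcomb : ρ l ^ (d * γ * M) * ρ l ^ (-(Q * E * q)) = ε := by
    rw [← Real.rpow_add hρl, hε, ← Real.rpow_natCast]
    congr 1
    rw [hM]
    field_simp
    ring
  calc q * ε + Cq * Real.exp (-γ * p) * (C₁ * ε ^ (-E)) ^ q
      ≤ q * ε + Cq * (C ^ (γ * M) * ρ l ^ (d * γ * M)) * (C₁ * ε ^ (-E)) ^ q := by gcongr
    _ = q * ε + Cq * C ^ (γ * M) * C₁ ^ q * (ρ l ^ (d * γ * M) * ρ l ^ (-(Q * E * q))) := by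
        rw [hDq]; ring
    _ = _ := by rw [hcomb]; ring

end Rate

/-! ### Elementary symmetric functions and Bonferroni inequalities -/

/-- The elementary symmetric function of degree `j` in the variables `ξ n`, `n ∈ U`. -/
def elemSymm (ξ : ℕ → ℝ) (U : Finset ℕ) (j : ℕ) : ℝ := ∑ V ∈ U.powersetCard j, ∏ n ∈ V, ξ n

section ElemSymm

variable {ξ : ℕ → ℝ} {U : Finset ℕ}

@[simp] lemma elemSymm_zero (ξ : ℕ → ℝ) (U : Finset ℕ) : elemSymm ξ U 0 = 1 := by
  simp [elemSymm]

@[simp] lemma elemSymm_empty (ξ : ℕ → ℝ) (j : ℕ) : elemSymm ξ ∅ (j + 1) = 0 := by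
  rw [elemSymm, Finset.powersetCard_eq_empty.2 (by simp), Finset.sum_empty]

lemma elemSymm_insert {a : ℕ} (ha : a ∉ U) (j : ℕ) :
    elemSymm ξ (insert a U) (j + 1) = elemSymm ξ U (j + 1) + ξ a * elemSymm ξ U j := by
  unfold elemSymm
  rw [Finset.powersetCard_succ_insert ha, Finset.sum_union, Finset.sum_image, Finset.mul_sum]
  · congr 1
    refine Finset.sum_congr rfl fun V hV => ?_
    rw [Finset.prod_insert fun h => ha ((Finset.mem_powersetCard.1 hV).1 h)]
  · intro V hV V' hV' h
    have h1 : a ∉ V := fun h => ha ((Finset.mem_powersetCard.1 hV).1 h)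
    have h2 : a ∉ V' := fun h => ha ((Finset.mem_powersetCard.1 hV').1 h)
    rw [← Finset.erase_insert h1, ← Finset.erase_insert h2, h]
  · rw [Finset.disjoint_left]
    intro V hV hV'
    obtain ⟨W, -, rfl⟩ := Finset.mem_image.1 hV'
    exact ha ((Finset.mem_powersetCard.1 hV).1 (Finset.mem_insert_self _ _))

lemma pow_add_mul_pow_le {s a : ℝ} (hs : 0 ≤ s) (ha : 0 ≤ a) (j : ℕ) :
    s ^ (j + 1) + (j + 1) * a * s ^ j ≤ (s + a) ^ (j + 1) := by
  induction j with
  | zero => simp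
  | succ j ih =>
    calc s ^ (j + 1 + 1) + ((j + 1 : ℕ) + 1) * a * s ^ (j + 1)
        ≤ (s ^ (j + 1) + (j + 1) * a * s ^ j) * (s + a) := by
          have : 0 ≤ (j + 1) * a * s ^ j * a := by positivity
          push_cast
          rw [pow_succ s (j + 1), pow_succ s j] at *
          nlinarith
      _ ≤ _ := by rw [pow_succ (s + a) (j + 1)]; gcongr

/-- Induction on the index set, the two terms of `elemSymm_insert` being dominated by the first two
terms of the binomial expansion. The factorial makes the truncated expansions below converge. -/
lemma elemSymm_le (h0 : ∀ n ∈ U, 0 ≤ ξ n) (j : ℕ) :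
    elemSymm ξ U j ≤ (∑ n ∈ U, ξ n) ^ j / j.factorial := by
  induction U using Finset.induction_on generalizing j with
  | empty =>
    rcases j with _ | j
    · simp
    · simp
  | insert a U ha ih =>
    have h0' : ∀ n ∈ U, 0 ≤ ξ n := fun n hn => h0 n (Finset.mem_insert_of_mem hn)
    have hs : 0 ≤ ∑ n ∈ U, ξ n := Finset.sum_nonneg h0'
    have ha0 := h0 a (Finset.mem_insert_self _ _)
    rcases j with _ | j
    · simp
    · rw [elemSymm_insert ha, Finset.sum_insert ha]
      have h1 := ih h0' (j + 1)
      have h2 := ih h0' j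
      rw [le_div_iff₀ (by positivity)] at h1 h2 ⊢
      have h3 := pow_add_mul_pow_le hs ha0 j
      have h4 : ((j + 1).factorial : ℝ) = (j + 1) * j.factorial := by
        rw [Nat.factorial_succ]; push_cast; ring
      rw [h4] at h1 ⊢
      have h5 : (j + 1) * ξ a * (elemSymm ξ U j * j.factorial) ≤
        (j + 1) * ξ a * (∑ n ∈ U, ξ n) ^ j := by gcongr
      rw [add_comm (ξ a)]
      nlinarith

/-- The alternating partial sums of the expansion of `∏ (1 - ξ n)`. -/
def altSum (ξ : ℕ → ℝ) (U : Finset ℕ) (J : ℕ) : ℝ :=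
  ∑ j ∈ Finset.range J, (-1) ^ j * elemSymm ξ U j

lemma altSum_insert {a : ℕ} (ha : a ∉ U) (J : ℕ) :
    altSum ξ (insert a U) (J + 1) = altSum ξ U (J + 1) - ξ a * altSum ξ U J := by
  unfold altSum
  rw [Finset.sum_range_succ', Finset.sum_range_succ']
  simp only [elemSymm_insert ha, elemSymm_zero, Finset.mul_sum, mul_add, Finset.sum_add_distrib]
  rw [add_sub_right_comm, sub_eq_add_neg, ← Finset.sum_neg_distrib]
  congr 2
  refine Finset.sum_congr rfl fun j _ => ?_
  ring

/-- The Bonferroni inequalities for weights in `[0,1]`. -/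
lemma bonferroni (h0 : ∀ n ∈ U, 0 ≤ ξ n) (h1 : ∀ n ∈ U, ξ n ≤ 1) (J : ℕ) :
    0 ≤ (-1) ^ J * (∏ n ∈ U, (1 - ξ n) - altSum ξ U J) ∧
      (-1) ^ J * (∏ n ∈ U, (1 - ξ n) - altSum ξ U J) ≤ elemSymm ξ U J := by
  induction U using Finset.induction_on generalizing J with
  | empty =>
    rcases J with _ | J
    · simp [altSum]
    · have : altSum ξ ∅ (J + 1) = 1 := by
        unfold altSum
        rw [Finset.sum_range_succ']
        simp
      simp [this]
  | insert a U ha ih =>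
    have h0' : ∀ n ∈ U, 0 ≤ ξ n := fun n hn => h0 n (Finset.mem_insert_of_mem hn)
    have h1' : ∀ n ∈ U, ξ n ≤ 1 := fun n hn => h1 n (Finset.mem_insert_of_mem hn)
    have a0 := h0 a (Finset.mem_insert_self _ _)
    have a1 := h1 a (Finset.mem_insert_self _ _)
    rw [Finset.prod_insert ha]
    rcases J with _ | J
    · have := ih h0' h1' 0
      simp only [altSum, pow_zero, one_mul, Finset.range_zero, Finset.sum_empty, sub_zero,
        elemSymm_zero] at this ⊢
      constructor <;> nlinarith [this.1, this.2]
    -- The signed remainder satisfies the same recursion as `elemSymm` in `elemSymm_insert`, so both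
    -- bounds pass through the induction at once.
    · have e : (-1) ^ (J + 1) * ((1 - ξ a) * ∏ n ∈ U, (1 - ξ n) - altSum ξ (insert a U) (J + 1)) =
        (-1) ^ (J + 1) * (∏ n ∈ U, (1 - ξ n) - altSum ξ U (J + 1)) +
          ξ a * ((-1) ^ J * (∏ n ∈ U, (1 - ξ n) - altSum ξ U J)) := by
        rw [altSum_insert ha]; ring
      rw [e, elemSymm_insert ha]
      obtain ⟨b1, b2⟩ := ih h0' h1' (J + 1)
      obtain ⟨c1, c2⟩ := ih h0' h1' J
      constructor
      · positivity
      · gcongr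

lemma abs_prod_one_sub_sub_altSum_le (h0 : ∀ n ∈ U, 0 ≤ ξ n) (h1 : ∀ n ∈ U, ξ n ≤ 1) (J : ℕ) :
    |∏ n ∈ U, (1 - ξ n) - altSum ξ U J| ≤ elemSymm ξ U J := by
  obtain ⟨a, b⟩ := bonferroni h0 h1 J
  calc _ = |(-1) ^ J * (∏ n ∈ U, (1 - ξ n) - altSum ξ U J)| := by
        rw [abs_mul, abs_pow, abs_neg, abs_one, one_pow, one_mul]
    _ ≤ _ := by rwa [abs_of_nonneg a]

end ElemSymm

/-! ### Gap polynomials and their truncated expansions -/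

/-- The indicator that, for the successive hits after `n₀`, the gaps lie in the members of the
list, as a polynomial in the hit indicators `ξ n`. -/
def gapPoly (ξ : ℕ → ℝ) : ℕ → List (Finset ℕ) → ℝ
  | _, [] => 1
  | n₀, J :: I => ∑ k ∈ J, ξ (n₀ + k) * (∏ i ∈ Finset.Ioo n₀ (n₀ + k), (1 - ξ i)) *
      gapPoly ξ (n₀ + k) I

/-- The sets of hits with successive gaps in the members of the list. -/
def gapSets : ℕ → List (Finset ℕ) → Finset (Finset ℕ)
  | _, [] => {∅}
  | n₀, J :: I => J.biUnion fun k => (gapSets (n₀ + k) I).image (insert (n₀ + k))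

/-- An upper bound for the position of the last hit. -/
def gapBound (I : List (Finset ℕ)) : ℕ := (I.map fun J => J.sup id).sum

section GapPoly

variable {ξ : ℕ → ℝ}

lemma mem_gapSets {I : List (Finset ℕ)} (hI : ∀ J ∈ I, ∀ k ∈ J, 1 ≤ k) {n₀ : ℕ} {S : Finset ℕ}
    (hS : S ∈ gapSets n₀ I) :
    (∀ n ∈ S, n₀ < n) ∧ S.card = I.length ∧ ∀ n ∈ S, n ≤ n₀ + gapBound I := by
  induction I generalizing n₀ S with
  | nil =>
    simp only [gapSets, Finset.mem_singleton] at hS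
    simp [hS]
  | cons J I ih =>
    simp only [gapSets, Finset.mem_biUnion, Finset.mem_image] at hS
    obtain ⟨k, hk, S, hS, rfl⟩ := hS
    obtain ⟨h1, h2, h3⟩ := ih (fun J' hJ' => hI J' (List.mem_cons_of_mem _ hJ')) hS
    have hk1 := hI J (List.mem_cons_self) k hk
    have hk2 : k ≤ J.sup id := Finset.le_sup (f := id) hk
    have hb : gapBound (J :: I) = J.sup id + gapBound I := by simp [gapBound]
    refine ⟨fun n hn => ?_, ?_, fun n hn => ?_⟩
    · rcases Finset.mem_insert.1 hn with rfl | hn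
      · omega
      · have := h1 n hn; omega
    · rw [Finset.card_insert_of_notMem (fun h => lt_irrefl _ (h1 _ h)), h2, List.length_cons]
    · rcases Finset.mem_insert.1 hn with rfl | hn
      · omega
      · have := h3 n hn; omega

/-- Unfolding the nested sum, each choice of gaps is a choice of the hit set `S`, and the empty
stretches between hits make up `(n₀, max S] \ S`. For the empty list the set is `∅`, whose supremum
is `0`, and the second product is empty. -/
lemma gapPoly_eq_sum {I : List (Finset ℕ)} (hI : ∀ J ∈ I, ∀ k ∈ J, 1 ≤ k) (n₀ : ℕ) :
    gapPoly ξ n₀ I = ∑ S ∈ gapSets n₀ I,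
      (∏ n ∈ S, ξ n) * ∏ n ∈ Finset.Ioc n₀ (S.sup id) \ S, (1 - ξ n) := by
  induction I generalizing n₀ with
  | nil => simp [gapPoly, gapSets]
  | cons J I ih =>
    have hI' : ∀ J ∈ I, ∀ k ∈ J, 1 ≤ k := fun J' hJ' => hI J' (List.mem_cons_of_mem _ hJ')
    have hmin : ∀ k, ∀ S ∈ gapSets (n₀ + k) I, ∀ n ∈ S, n₀ + k < n :=
      fun k S hS => (mem_gapSets hI' hS).1
    rw [gapPoly, gapSets, Finset.sum_biUnion]
    · refine Finset.sum_congr rfl fun k hk => ?_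
      have hk1 := hI J (List.mem_cons_self) k hk
      rw [Finset.sum_image, ih hI', Finset.mul_sum]
      · refine Finset.sum_congr rfl fun S hS => ?_
        have hS1 := hmin k S hS
        have hnot : n₀ + k ∉ S := fun h => lt_irrefl _ (hS1 _ h)
        have hset : Finset.Ioc n₀ ((insert (n₀ + k) S).sup id) \ insert (n₀ + k) S =
            Finset.Ioo n₀ (n₀ + k) ∪ (Finset.Ioc (n₀ + k) (S.sup id) \ S) := by
          ext n
          have hsup : (insert (n₀ + k) S).sup id = max (n₀ + k) (S.sup id) := by
            rw [Finset.sup_insert]; rfl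
          have := hS1 n
          simp only [hsup, Finset.mem_sdiff, Finset.mem_Ioc, Finset.mem_insert, Finset.mem_union,
            Finset.mem_Ioo, le_max_iff, not_or]
          constructor
          · rintro ⟨⟨h1, h2⟩, h3, h4⟩
            rcases lt_or_gt_of_ne h3 with h | h
            · exact Or.inl ⟨h1, h⟩
            · exact Or.inr ⟨⟨h, by omega⟩, h4⟩
          · rintro (⟨h1, h2⟩ | ⟨⟨h1, h2⟩, h3⟩)
            · exact ⟨⟨h1, by omega⟩, by omega, fun h => by have := this h; omega⟩
            · exact ⟨⟨by omega, by omega⟩, by omega, h3⟩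
        rw [hset, Finset.prod_union, Finset.prod_insert hnot]
        · ring
        · rw [Finset.disjoint_left]
          intro n h1 h2
          simp only [Finset.mem_sdiff, Finset.mem_Ioc, Finset.mem_Ioo] at h1 h2
          omega
      · intro S hS S' hS' h
        have h1 : n₀ + k ∉ S := fun h => lt_irrefl _ (hmin k S hS _ h)
        have h2 : n₀ + k ∉ S' := fun h => lt_irrefl _ (hmin k S' hS' _ h)
        rw [← Finset.erase_insert h1, ← Finset.erase_insert h2, h]
    -- The first gap can be read off from the set: `n₀ + k` is its least element.
    · intro k hk k' hk' hne
      rw [Function.onFun, Finset.disjoint_left]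
      intro S hS hS'
      obtain ⟨S₁, h1, rfl⟩ := Finset.mem_image.1 hS
      obtain ⟨S₂, h2, h⟩ := Finset.mem_image.1 hS'
      have m1 : n₀ + k ∈ insert (n₀ + k') S₂ := h ▸ Finset.mem_insert_self _ _
      have m2 : n₀ + k' ∈ insert (n₀ + k) S₁ := h ▸ Finset.mem_insert_self _ _
      rw [Finset.mem_insert] at m1 m2
      rcases m1 with m1 | m1
      · omega
      rcases m2 with m2 | m2
      · omega
      have := hmin _ _ h2 _ m1
      have := hmin _ _ h1 _ m2
      omega

/-- The pair `(S, V)` is recovered from `S ∪ V` and `S`, and a set of size `m + j` has only `(m +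
j).choose m` subsets of size `m`. This collapses the double sums of the expansion into plain sums
over sets of a given size. -/
lemma sum_sum_union_le {W : Finset ℕ} {P : Finset (Finset ℕ)} {m : ℕ} (j : ℕ)
    (hP : P ⊆ W.powersetCard m) {U : Finset ℕ → Finset ℕ} (hU : ∀ S ∈ P, U S ⊆ W \ S)
    {F : Finset ℕ → ℝ} (hF : ∀ Q, 0 ≤ F Q) :
    ∑ S ∈ P, ∑ V ∈ (U S).powersetCard j, F (S ∪ V) ≤
      (m + j).choose m * ∑ Q ∈ W.powersetCard (m + j), F Q := by
  rw [Finset.sum_sigma', Finset.mul_sum]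
  have e : ∑ Q ∈ W.powersetCard (m + j), ((m + j).choose m : ℝ) * F Q =
      ∑ x ∈ (W.powersetCard (m + j)).sigma fun Q => Q.powersetCard m, F x.1 := by
    rw [Finset.sum_sigma]
    refine Finset.sum_congr rfl fun Q hQ => ?_
    dsimp only
    rw [Finset.sum_const, Finset.card_powersetCard, (Finset.mem_powersetCard.1 hQ).2, nsmul_eq_mul]
  rw [e]
  have hdisj : ∀ x ∈ P.sigma fun S => (U S).powersetCard j, Disjoint x.1 x.2 := by
    intro x hx
    obtain ⟨h1, h2⟩ := Finset.mem_sigma.1 hx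
    have := (Finset.mem_powersetCard.1 h2).1.trans (hU _ h1)
    exact (Finset.disjoint_of_subset_left this Finset.sdiff_disjoint).symm
  have hinj : Set.InjOn (fun x : (_ : Finset ℕ) × Finset ℕ =>
      (⟨x.1 ∪ x.2, x.1⟩ : (_ : Finset ℕ) × Finset ℕ))
      (P.sigma fun S => (U S).powersetCard j : Finset ((_ : Finset ℕ) × Finset ℕ)) := by
    rintro ⟨S, V⟩ hx ⟨S', V'⟩ hx' h
    have d1 := hdisj _ (Finset.mem_coe.1 hx)
    have d2 := hdisj _ (Finset.mem_coe.1 hx')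
    simp only [Sigma.mk.injEq, heq_eq_eq] at h d1 d2
    obtain ⟨h1, rfl⟩ := h
    have hV : V = V' := by
      rw [← Finset.union_sdiff_cancel_left d1, ← Finset.union_sdiff_cancel_left d2, h1]
    rw [hV]
  rw [← Finset.sum_image (f := fun x : (_ : Finset ℕ) × Finset ℕ => F x.1) hinj]
  refine Finset.sum_le_sum_of_subset_of_nonneg ?_ fun _ _ _ => hF _
  intro z hz
  obtain ⟨⟨S, V⟩, hx, rfl⟩ := Finset.mem_image.1 hz
  have hd := hdisj _ hx
  obtain ⟨h1, h2⟩ := Finset.mem_sigma.1 hx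
  simp only at h1 h2 hd
  have p1 := Finset.mem_powersetCard.1 (hP h1)
  have p2 := Finset.mem_powersetCard.1 h2
  simp only [Finset.mem_sigma, Finset.mem_powersetCard]
  refine ⟨⟨Finset.union_subset p1.1 ((p2.1.trans (hU _ h1)).trans Finset.sdiff_subset), ?_⟩,
    Finset.subset_union_left, p1.2⟩
  rw [Finset.card_union_of_disjoint hd, p1.2, p2.2]

/-- The truncated expansion of `gapPoly`. -/
def gapTrunc (ξ : ℕ → ℝ) (I : List (Finset ℕ)) (J : ℕ) : ℝ :=
  ∑ S ∈ gapSets 0 I, (∏ n ∈ S, ξ n) * altSum ξ (Finset.Ioc 0 (S.sup id) \ S) J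

variable {I : List (Finset ℕ)} {N : ℕ}

lemma gapSets_subset (hI : ∀ J ∈ I, ∀ k ∈ J, 1 ≤ k) (hN : gapBound I ≤ N) :
    gapSets 0 I ⊆ (Finset.Ioc 0 N).powersetCard I.length := by
  intro S hS
  obtain ⟨h1, h2, h3⟩ := mem_gapSets hI hS
  refine Finset.mem_powersetCard.2 ⟨fun n hn => Finset.mem_Ioc.2 ⟨h1 n hn, ?_⟩, h2⟩
  have := h3 n hn
  omega

lemma Ioc_sup_sdiff_subset (hI : ∀ J ∈ I, ∀ k ∈ J, 1 ≤ k) (hN : gapBound I ≤ N) {S : Finset ℕ}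
    (hS : S ∈ gapSets 0 I) : Finset.Ioc 0 (S.sup id) \ S ⊆ Finset.Ioc 0 N \ S := by
  refine Finset.sdiff_subset_sdiff (Finset.Ioc_subset_Ioc_right ?_) subset_rfl
  refine Finset.sup_le fun n hn => ?_
  have := (mem_gapSets hI hS).2.2 n hn
  simp only [id]
  omega

lemma prod_mul_elemSymm {S U : Finset ℕ} (h : Disjoint S U) (j : ℕ) :
    (∏ n ∈ S, ξ n) * elemSymm ξ U j = ∑ V ∈ U.powersetCard j, ∏ n ∈ S ∪ V, ξ n := by
  rw [elemSymm, Finset.mul_sum]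
  refine Finset.sum_congr rfl fun V hV => ?_
  rw [Finset.prod_union (Finset.disjoint_of_subset_right (Finset.mem_powersetCard.1 hV).1 h)]

/-- Apply the Bonferroni bound to each hit set; the remainders, multiplied by the hits themselves,
become elementary symmetric terms of degree `I.length + J`. -/
lemma abs_gapPoly_sub_gapTrunc_le (hI : ∀ J ∈ I, ∀ k ∈ J, 1 ≤ k) (hN : gapBound I ≤ N)
    (h0 : ∀ n, 0 ≤ ξ n) (h1 : ∀ n, ξ n ≤ 1) (J : ℕ) :
    |gapPoly ξ 0 I - gapTrunc ξ I J| ≤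
      (I.length + J).choose I.length * elemSymm ξ (Finset.Ioc 0 N) (I.length + J) := by
  rw [gapPoly_eq_sum hI, gapTrunc, ← Finset.sum_sub_distrib]
  refine (Finset.abs_sum_le_sum_abs _ _).trans (le_trans (Finset.sum_le_sum fun S hS => ?_)
    (sum_sum_union_le J (gapSets_subset hI hN) (U := fun S => Finset.Ioc 0 (S.sup id) \ S)
    (fun S hS => Ioc_sup_sdiff_subset hI hN hS) (F := fun Q => ∏ n ∈ Q, ξ n)
    (fun Q => Finset.prod_nonneg fun n _ => h0 n)))
  rw [← mul_sub, abs_mul, ← prod_mul_elemSymm Finset.disjoint_sdiff,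
    abs_of_nonneg (Finset.prod_nonneg fun n _ => h0 n)]
  exact mul_le_mul_of_nonneg_left
    (abs_prod_one_sub_sub_altSum_le (fun n _ => h0 n) (fun n _ => h1 n) J)
    (Finset.prod_nonneg fun n _ => h0 n)

lemma gapTrunc_eq (ξ : ℕ → ℝ) (I : List (Finset ℕ)) (J : ℕ) :
    gapTrunc ξ I J = ∑ j ∈ Finset.range J, (-1) ^ j * ∑ S ∈ gapSets 0 I,
      ∑ V ∈ (Finset.Ioc 0 (S.sup id) \ S).powersetCard j, ∏ n ∈ S ∪ V, ξ n := by
  simp only [gapTrunc, altSum, Finset.mul_sum]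
  rw [Finset.sum_comm]
  refine Finset.sum_congr rfl fun j _ => Finset.sum_congr rfl fun S _ => ?_
  rw [← Finset.mul_sum, ← prod_mul_elemSymm Finset.disjoint_sdiff]
  ring

variable {X : Type*} [MeasurableSpace X] {μ : Measure X} [IsProbabilityMeasure μ]

/-- A random sequence with values in `[0,1]` whose mixed moments are close to those of a
deterministic sequence has nearly the same gap polynomials. -/
lemma abs_integral_gapPoly_sub_le {ξ : X → ℕ → ℝ} {w : ℕ → ℝ}
    (hξm : ∀ n, Measurable fun x => ξ x n) (hξ0 : ∀ x n, 0 ≤ ξ x n) (hξ1 : ∀ x n, ξ x n ≤ 1)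
    (hw0 : ∀ n, 0 ≤ w n) (hw1 : ∀ n, w n ≤ 1)
    (hI : ∀ J ∈ I, ∀ k ∈ J, 1 ≤ k) (hN : gapBound I ≤ N) (J : ℕ) :
    |(∫ x, gapPoly (ξ x) 0 I ∂μ) - gapPoly w 0 I| ≤
      (∑ j ∈ Finset.range (J + 1), (I.length + j).choose I.length *
        ∑ Q ∈ (Finset.Ioc 0 N).powersetCard (I.length + j),
          |(∫ x, ∏ n ∈ Q, ξ x n ∂μ) - ∏ n ∈ Q, w n|) +
      2 * ((I.length + J).choose I.length * elemSymm w (Finset.Ioc 0 N) (I.length + J)) := by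
  set m := I.length with hm
  have hint : ∀ Q : Finset ℕ, Integrable (fun x => ∏ n ∈ Q, ξ x n) μ := fun Q =>
    Integrable.of_bound (Finset.measurable_prod _ fun n _ => hξm n).aestronglyMeasurable 1
      (ae_of_all _ fun x => by
        rw [Real.norm_of_nonneg (Finset.prod_nonneg fun n _ => hξ0 x n)]
        exact Finset.prod_le_one (fun n _ => hξ0 x n) (fun n _ => hξ1 x n))
  have htr : Integrable (fun x => gapTrunc (ξ x) I J) μ := by
    simp only [gapTrunc_eq]
    refine integrable_finsetSum _ fun j _ => Integrable.const_mul ?_ _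
    exact integrable_finsetSum _ fun S _ => integrable_finsetSum _ fun V _ => hint _
  have hes : Integrable (fun x => elemSymm (ξ x) (Finset.Ioc 0 N) (m + J)) μ := by
    unfold elemSymm
    exact integrable_finsetSum _ fun S _ => hint _
  have hgm : ∀ (I : List (Finset ℕ)) (n₀ : ℕ), Measurable fun x => gapPoly (ξ x) n₀ I := by
    intro I
    induction I with
    | nil => intro n₀; exact measurable_const
    | cons K I ih =>
      intro n₀
      unfold gapPoly
      exact Finset.measurable_sum _ fun k _ => ((hξm _).mul
        (Finset.measurable_prod _ fun n _ => measurable_const.sub (hξm n))).mul (ih _)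
  have hb := fun x => abs_gapPoly_sub_gapTrunc_le hI hN (hξ0 x) (hξ1 x) J
  have hgi : Integrable (fun x => gapPoly (ξ x) 0 I) μ := by
    have : Integrable (fun x => gapPoly (ξ x) 0 I - gapTrunc (ξ x) I J) μ := by
      refine (hes.const_mul ((m + J).choose m : ℝ)).mono'
        ((hgm I 0).aestronglyMeasurable.sub htr.aestronglyMeasurable) (ae_of_all _ fun x => ?_)
      rw [Real.norm_eq_abs]; exact hb x
    exact (this.add htr).congr (ae_of_all _ fun x => by simp)
  have t1 : |(∫ x, gapPoly (ξ x) 0 I ∂μ) - ∫ x, gapTrunc (ξ x) I J ∂μ| ≤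
      (m + J).choose m * ∑ Q ∈ (Finset.Ioc 0 N).powersetCard (m + J), ∫ x, ∏ n ∈ Q, ξ x n ∂μ := by
    rw [← integral_sub hgi htr]
    calc _ ≤ ∫ x, |gapPoly (ξ x) 0 I - gapTrunc (ξ x) I J| ∂μ := abs_integral_le_integral_abs
      _ ≤ ∫ x, (m + J).choose m * elemSymm (ξ x) (Finset.Ioc 0 N) (m + J) ∂μ :=
          integral_mono (hgi.sub htr).abs (hes.const_mul _) hb
      _ = _ := by
          rw [integral_const_mul]
          unfold elemSymm
          rw [integral_finsetSum _ fun Q _ => hint Q]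
  have t2 : |(∫ x, gapTrunc (ξ x) I J ∂μ) - gapTrunc w I J| ≤
      ∑ j ∈ Finset.range J, (m + j).choose m *
        ∑ Q ∈ (Finset.Ioc 0 N).powersetCard (m + j),
          |(∫ x, ∏ n ∈ Q, ξ x n ∂μ) - ∏ n ∈ Q, w n| := by
    have e : ∫ x, gapTrunc (ξ x) I J ∂μ = ∑ j ∈ Finset.range J, (-1) ^ j * ∑ S ∈ gapSets 0 I,
        ∑ V ∈ (Finset.Ioc 0 (S.sup id) \ S).powersetCard j, ∫ x, ∏ n ∈ S ∪ V, ξ x n ∂μ := by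
      simp only [gapTrunc_eq]
      rw [integral_finsetSum _ fun j _ => Integrable.const_mul
        (integrable_finsetSum _ fun S _ => integrable_finsetSum _ fun V _ => hint _) _]
      refine Finset.sum_congr rfl fun j _ => ?_
      rw [integral_const_mul, integral_finsetSum _ fun S _ =>
        integrable_finsetSum _ fun V _ => hint _]
      congr 1
      exact Finset.sum_congr rfl fun S _ => integral_finsetSum _ fun V _ => hint _
    rw [e, gapTrunc_eq, ← Finset.sum_sub_distrib]
    refine (Finset.abs_sum_le_sum_abs _ _).trans (Finset.sum_le_sum fun j _ => ?_)
    rw [← mul_sub, abs_mul, abs_pow, abs_neg, abs_one, one_pow, one_mul, ← Finset.sum_sub_distrib]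
    refine le_trans ?_ (sum_sum_union_le j (gapSets_subset hI hN)
      (U := fun S => Finset.Ioc 0 (S.sup id) \ S) (fun S hS => Ioc_sup_sdiff_subset hI hN hS)
      (F := fun Q => |(∫ x, ∏ n ∈ Q, ξ x n ∂μ) - ∏ n ∈ Q, w n|) (fun Q => abs_nonneg _))
    refine (Finset.abs_sum_le_sum_abs _ _).trans (Finset.sum_le_sum fun S _ => ?_)
    rw [← Finset.sum_sub_distrib]
    exact Finset.abs_sum_le_sum_abs _ _
  have t3 := abs_gapPoly_sub_gapTrunc_le hI hN hw0 hw1 J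
  -- The truncation error of the random sequence is itself a sum of moments. It is traded for that
  -- of `w` at the price of one more discrepancy, which explains `J + 1` and the factor `2` in the
  -- bound.
  have t4 : ∑ Q ∈ (Finset.Ioc 0 N).powersetCard (m + J), ∫ x, ∏ n ∈ Q, ξ x n ∂μ ≤
      (∑ Q ∈ (Finset.Ioc 0 N).powersetCard (m + J),
          |(∫ x, ∏ n ∈ Q, ξ x n ∂μ) - ∏ n ∈ Q, w n|) +
        elemSymm w (Finset.Ioc 0 N) (m + J) := by
    rw [elemSymm, ← Finset.sum_add_distrib]
    refine Finset.sum_le_sum fun Q _ => ?_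
    linarith [le_abs_self ((∫ x, ∏ n ∈ Q, ξ x n ∂μ) - ∏ n ∈ Q, w n)]
  have t5 : (0 : ℝ) ≤ (m + J).choose m := Nat.cast_nonneg _
  have t6 := mul_le_mul_of_nonneg_left t4 t5
  rw [Finset.sum_range_succ]
  rw [abs_le] at t1 t2 t3 ⊢
  constructor <;> linarith [t1.1, t1.2, t2.1, t2.2, t3.1, t3.2]

end GapPoly

/-! ### Exponential limit of the gap polynomials -/

section GapAsymptotics

/-- The integers `k` with `lam * k ∈ (a, b]`. -/
def scaledIoc (lam : ℝ) (ab : ℝ × ℝ) : Finset ℕ := Finset.Ioc ⌊ab.1 / lam⌋₊ ⌊ab.2 / lam⌋₊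

/-- Telescoping: the probability that the first hit is at `n₀ + k` is the drop of the survival
probability at that index. -/
lemma sum_mul_prod_one_sub (w : ℕ → ℝ) (n₀ A B : ℕ) (hAB : A ≤ B) :
    ∑ k ∈ Finset.Ioc A B, w (n₀ + k) * ∏ i ∈ Finset.Ioo n₀ (n₀ + k), (1 - w i) =
      ∏ i ∈ Finset.Ioc n₀ (n₀ + A), (1 - w i) - ∏ i ∈ Finset.Ioc n₀ (n₀ + B), (1 - w i) := by
  induction B, hAB using Nat.le_induction with
  | base => simp
  | succ B hAB ih =>
    rw [Finset.sum_Ioc_succ_top hAB, ih, ← add_assoc, Finset.prod_Ioc_succ_top (by omega)]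
    have : Finset.Ioo n₀ (n₀ + B + 1) = Finset.Ioc n₀ (n₀ + B) := by
      ext i; simp only [Finset.mem_Ioo, Finset.mem_Ioc]; omega
    rw [this]
    ring

lemma abs_exp_neg_sub_exp_neg_le {a b : ℝ} (ha : 0 ≤ a) (hb : 0 ≤ b) :
    |Real.exp (-a) - Real.exp (-b)| ≤ |a - b| := by
  wlog hab : a ≤ b generalizing a b
  · rw [abs_sub_comm, abs_sub_comm a]; exact this hb ha (le_of_not_ge hab)
  have h1 : Real.exp (-b) ≤ Real.exp (-a) := Real.exp_le_exp.2 (by linarith)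
  rw [abs_of_nonneg (by linarith), abs_of_nonpos (by linarith)]
  have h2 : Real.exp (-b) = Real.exp (-a) * Real.exp (-(b - a)) := by
    rw [← Real.exp_add]; ring_nf
  have h3 := Real.add_one_le_exp (-(b - a))
  have h4 : Real.exp (-a) ≤ 1 := Real.exp_le_one_iff.2 (by linarith)
  have h5 := Real.exp_pos (-a)
  rw [h2]
  nlinarith

variable {w : ℕ → ℕ → ℝ} {lam : ℕ → ℝ} {C : ℝ}

/-- Convergence at finitely many grid times becomes uniform, since `w` is nonnegative and at most `C
* lam`, so that partial sums can grow little between grid points. -/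
lemma eventually_abs_sum_sub_le (hlam : ∀ l, 0 < lam l) (hlam0 : Tendsto lam atTop (𝓝 0))
    (hw0 : ∀ l n, 0 ≤ w l n) (hC : 0 ≤ C) (hwC : ∀ᶠ l in atTop, ∀ n, 1 ≤ n → w l n ≤ C * lam l)
    (hsum : ∀ t : ℝ, 0 < t →
      Tendsto (fun l => ∑ n ∈ Finset.Ioc 0 ⌊t / lam l⌋₊, w l n) atTop (𝓝 t))
    (Tm : ℝ) {ε : ℝ} (hε : 0 < ε) :
    ∀ᶠ l in atTop, ∀ n : ℕ, n * lam l ≤ Tm → |∑ i ∈ Finset.Ioc 0 n, w l i - n * lam l| ≤ ε := by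
  -- Grid mesh and grid accuracy. Rounding down to an integer index may add another `lam l < η`,
  -- whence increments of up to `2 * C * η` between grid points.
  set η : ℝ := ε / (2 * C + 3) with hη
  have hη0 : 0 < η := by positivity
  have hgrid : ∀ᶠ l in atTop, ∀ i ∈ Finset.range (⌊Tm / η⌋₊ + 1),
      |∑ n ∈ Finset.Ioc 0 ⌊(i * η) / lam l⌋₊, w l n - i * η| ≤ η := by
    rw [Finset.eventually_all]
    intro i _
    -- `hsum` covers positive times only; at time `0` the sum is empty.
    rcases Nat.eq_zero_or_pos i with rfl | hi
    · simp [hη0.le]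
    · have h := hsum (i * η) (by positivity)
      filter_upwards [(Metric.tendsto_nhds.1 h) η hη0] with l hl
      exact hl.le
  filter_upwards [hgrid, hwC, hlam0.eventually_lt_const hη0] with l h1 h2 h3 n hn
  have hl := hlam l
  have ht0 : (0 : ℝ) ≤ n * lam l := by positivity
  set i : ℕ := ⌊n * lam l / η⌋₊ with hi
  have hi1 : (i : ℝ) * η ≤ n * lam l := by
    rw [← le_div_iff₀ hη0]; exact Nat.floor_le (by positivity)
  have hi2 : n * lam l < (i + 1) * η := by
    rw [← div_lt_iff₀ hη0]; exact Nat.lt_floor_add_one _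
  have hi3 : i ∈ Finset.range (⌊Tm / η⌋₊ + 1) := by
    rw [Finset.mem_range, Nat.lt_succ_iff]
    exact Nat.floor_le_floor (by gcongr)
  have hg := h1 i hi3
  set n₁ : ℕ := ⌊(i * η) / lam l⌋₊ with hn₁
  have hn1 : n₁ ≤ n := by
    have : (i * η) / lam l ≤ n := by rw [div_le_iff₀ hl]; exact hi1
    exact Nat.floor_le_of_le this
  have hn2 : (i * η) / lam l < n₁ + 1 := Nat.lt_floor_add_one _
  rw [div_lt_iff₀ hl] at hn2
  have hsplit : ∑ j ∈ Finset.Ioc 0 n, w l j =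
      ∑ j ∈ Finset.Ioc 0 n₁, w l j + ∑ j ∈ Finset.Ioc n₁ n, w l j := by
    rw [Finset.sum_Ioc_consecutive _ (Nat.zero_le _) hn1]
  have hrest0 : 0 ≤ ∑ j ∈ Finset.Ioc n₁ n, w l j := Finset.sum_nonneg fun j _ => hw0 l j
  have hrest : ∑ j ∈ Finset.Ioc n₁ n, w l j ≤ 2 * C * η := by
    calc ∑ j ∈ Finset.Ioc n₁ n, w l j ≤ ∑ _j ∈ Finset.Ioc n₁ n, C * lam l :=
          Finset.sum_le_sum fun j hj => h2 j (by have := Finset.mem_Ioc.1 hj; omega)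
      _ = C * ((n - n₁) * lam l) := by
          rw [Finset.sum_const, Nat.card_Ioc, nsmul_eq_mul, Nat.cast_sub hn1]; ring
      _ ≤ C * (2 * η) := mul_le_mul_of_nonneg_left (by nlinarith) hC
      _ = _ := by ring
  have hεη : ε = (2 * C + 3) * η := by rw [hη]; field_simp
  rw [hsplit]
  rw [abs_le] at hg ⊢
  constructor <;> nlinarith [hg.1, hg.2]

/-- Each factor `1 - w` differs from `exp (-w)` by at most `w ^ 2 ≤ C * lam * w`, which sums to
`O(lam)`; the exponent is then a difference of two partial sums controlled uniformly. -/
lemma eventually_abs_prod_sub_exp_le (hlam : ∀ l, 0 < lam l) (hlam0 : Tendsto lam atTop (𝓝 0))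
    (hw0 : ∀ l n, 0 ≤ w l n) (hw1 : ∀ l n, w l n ≤ 1)
    (hC : 0 ≤ C) (hwC : ∀ᶠ l in atTop, ∀ n, 1 ≤ n → w l n ≤ C * lam l)
    (hsum : ∀ t : ℝ, 0 < t →
      Tendsto (fun l => ∑ n ∈ Finset.Ioc 0 ⌊t / lam l⌋₊, w l n) atTop (𝓝 t))
    (Tm : ℝ) {ε : ℝ} (hε : 0 < ε) :
    ∀ᶠ l in atTop, ∀ n₀ k : ℕ, (n₀ + k : ℕ) * lam l ≤ Tm →
      |∏ i ∈ Finset.Ioc n₀ (n₀ + k), (1 - w l i) - Real.exp (-(k * lam l))| ≤ ε := by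
  have hsmall : Tendsto (fun l => C * lam l * (Tm + 1)) atTop (𝓝 0) := by
    simpa using (hlam0.const_mul C).mul_const (Tm + 1)
  -- The tolerance `ε / 4` is used at both ends of the block; the cap `1 / 2` only keeps the sum
  -- over the block below `Tm + 1`.
  filter_upwards [eventually_abs_sum_sub_le hlam hlam0 hw0 hC hwC hsum Tm (ε := min (ε / 4) (1 / 2))
    (by positivity), hwC, hsmall.eventually_lt_const (half_pos hε)] with l h1 h2 h3 n₀ k hk
  have hl := hlam l
  have a1 := h1 (n₀ + k) hk
  have a2 := h1 n₀ (le_trans (by gcongr; omega) hk)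
  have hsplit : ∑ j ∈ Finset.Ioc 0 (n₀ + k), w l j =
      ∑ j ∈ Finset.Ioc 0 n₀, w l j + ∑ j ∈ Finset.Ioc n₀ (n₀ + k), w l j := by
    rw [Finset.sum_Ioc_consecutive _ (Nat.zero_le _) (Nat.le_add_right _ _)]
  set s := ∑ j ∈ Finset.Ioc n₀ (n₀ + k), w l j with hs
  have hs0 : 0 ≤ s := Finset.sum_nonneg fun j _ => hw0 l j
  have m1 : min (ε / 4) (1 / 2) ≤ ε / 4 := min_le_left _ _
  have m2 : min (ε / 4) (1 / 2 : ℝ) ≤ 1 / 2 := min_le_right _ _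
  rw [abs_le] at a1 a2
  have hsk : |s - k * lam l| ≤ ε / 2 := by
    push_cast at a1
    rw [abs_le]; constructor <;> nlinarith [a1.1, a1.2, a2.1, a2.2]
  have hsT : s ≤ Tm + 1 := by
    have : 0 ≤ ∑ j ∈ Finset.Ioc 0 n₀, w l j := Finset.sum_nonneg fun j _ => hw0 l j
    linarith [a1.2]
  have b1 : |∏ i ∈ Finset.Ioc n₀ (n₀ + k), (1 - w l i) - Real.exp (-s)| ≤ ε / 2 := by
    have e : Real.exp (-s) = ∏ i ∈ Finset.Ioc n₀ (n₀ + k), Real.exp (-w l i) := by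
      rw [← Real.exp_sum, Finset.sum_neg_distrib]
    rw [e]
    calc _ ≤ ∑ i ∈ Finset.Ioc n₀ (n₀ + k), |(1 - w l i) - Real.exp (-w l i)| := by
          refine Finset.abs_prod_sub_prod_le_sum _ _ _ (fun i _ => ?_) (fun i _ => ?_)
          · rw [abs_le]; constructor <;> linarith [hw0 l i, hw1 l i]
          · rw [abs_of_pos (Real.exp_pos _)]
            exact Real.exp_le_one_iff.2 (by linarith [hw0 l i])
      _ ≤ ∑ i ∈ Finset.Ioc n₀ (n₀ + k), C * lam l * w l i := by
          refine Finset.sum_le_sum fun i hi => ?_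
          have hi1 : 1 ≤ i := by have := Finset.mem_Ioc.1 hi; omega
          have := Real.abs_exp_sub_one_sub_id_le (x := -w l i)
            (by rw [abs_neg, abs_of_nonneg (hw0 l i)]; exact hw1 l i)
          rw [abs_sub_comm]
          calc _ = |Real.exp (-w l i) - 1 - -w l i| := by congr 1; ring
            _ ≤ (-w l i) ^ 2 := this
            _ = w l i * w l i := by ring
            _ ≤ _ := mul_le_mul_of_nonneg_right (h2 i hi1) (hw0 l i)
      _ = C * lam l * s := by rw [← Finset.mul_sum]
      _ ≤ C * lam l * (Tm + 1) := by gcongr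
      _ ≤ ε / 2 := h3.le
  calc _ ≤ |∏ i ∈ Finset.Ioc n₀ (n₀ + k), (1 - w l i) - Real.exp (-s)| +
        |Real.exp (-s) - Real.exp (-(k * lam l))| := abs_sub_le _ _ _
    _ ≤ ε / 2 + ε / 2 := add_le_add b1
        ((abs_exp_neg_sub_exp_neg_le hs0 (by positivity)).trans hsk)
    _ = ε := add_halves ε

lemma abs_floor_div_mul_sub_le {a s : ℝ} (ha : 0 ≤ a) (hs : 0 < s) : |⌊a / s⌋₊ * s - a| ≤ s := by
  have h1 := Nat.floor_le (div_nonneg ha hs.le)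
  have h2 := Nat.lt_floor_add_one (a / s)
  rw [le_div_iff₀ hs] at h1
  rw [div_lt_iff₀ hs] at h2
  rw [abs_le]; constructor <;> linarith

/-- The limit of the gap polynomials: the probability that exponential gaps lie in the intervals. -/
def expProd (L : List (ℝ × ℝ)) : ℝ := (L.map fun ab => Real.exp (-ab.1) - Real.exp (-ab.2)).prod

lemma expProd_mem {L : List (ℝ × ℝ)} (hL : ∀ ab ∈ L, 0 ≤ ab.1 ∧ ab.1 ≤ ab.2) :
    0 ≤ expProd L ∧ expProd L ≤ 1 := by
  induction L with
  | nil => simp [expProd]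
  | cons ab L ih =>
    have h := ih fun x hx => hL x (List.mem_cons_of_mem _ hx)
    obtain ⟨h1, h2⟩ := hL ab List.mem_cons_self
    have e : expProd (ab :: L) = (Real.exp (-ab.1) - Real.exp (-ab.2)) * expProd L := by
      simp [expProd]
    have e1 : Real.exp (-ab.2) ≤ Real.exp (-ab.1) := Real.exp_le_exp.2 (by linarith)
    have e2 : Real.exp (-ab.1) ≤ 1 := Real.exp_le_one_iff.2 (by linarith)
    have e3 := Real.exp_pos (-ab.2)
    rw [e]
    exact ⟨mul_nonneg (by linarith) h.1, mul_le_one₀ (by linarith) h.1 h.2⟩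

/-- Induction on the list. The first gap contributes the telescoping difference of survival
probabilities. The remaining gaps start from a variable position `n₀ + k`, so the estimate has to be
uniform in the starting point up to a horizon, which grows by `b` at each step. -/
lemma eventually_abs_gapPoly_sub_le (hlam : ∀ l, 0 < lam l) (hlam0 : Tendsto lam atTop (𝓝 0))
    (hw0 : ∀ l n, 0 ≤ w l n) (hw1 : ∀ l n, w l n ≤ 1)
    (hC : 0 ≤ C) (hwC : ∀ᶠ l in atTop, ∀ n, 1 ≤ n → w l n ≤ C * lam l)
    (hsum : ∀ t : ℝ, 0 < t →
      Tendsto (fun l => ∑ n ∈ Finset.Ioc 0 ⌊t / lam l⌋₊, w l n) atTop (𝓝 t))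
    {L : List (ℝ × ℝ)} (hL : ∀ ab ∈ L, 0 ≤ ab.1 ∧ ab.1 ≤ ab.2)
    {Tm : ℝ} (hTm : 0 ≤ Tm) {ε : ℝ} (hε : 0 < ε) :
    ∀ᶠ l in atTop, ∀ n₀ : ℕ, n₀ * lam l ≤ Tm →
      |gapPoly (w l) n₀ (L.map (scaledIoc (lam l))) - expProd L| ≤ ε := by
  induction L generalizing Tm ε with
  | nil => simp [gapPoly, expProd, hε.le]
  | cons ab L ih =>
    have hL' : ∀ x ∈ L, 0 ≤ x.1 ∧ x.1 ≤ x.2 := fun x hx => hL x (List.mem_cons_of_mem _ hx)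
    obtain ⟨a, b⟩ := ab
    obtain ⟨ha, hab⟩ : 0 ≤ a ∧ a ≤ b := hL (a, b) List.mem_cons_self
    have hq := expProd_mem hL'
    -- Five errors of size `ε / 5`: one from the remaining gaps, and at each of the two end points
    -- one from the product and one from the integer part.
    filter_upwards [ih hL' (Tm := Tm + b) (by linarith) (ε := ε / 5) (by positivity),
      eventually_abs_prod_sub_exp_le hlam hlam0 hw0 hw1 hC hwC hsum (Tm + b)
        (ε := ε / 5) (by positivity), hlam0.eventually_lt_const (by positivity : 0 < ε / 5)]
      with l h1 h2 h3 n₀ hn₀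
    have hl := hlam l
    set A := ⌊a / lam l⌋₊ with hA
    set B := ⌊b / lam l⌋₊ with hB
    have hAB : A ≤ B := Nat.floor_le_floor (by gcongr)
    have hBb : B * lam l ≤ b := by
      rw [← le_div_iff₀ hl]; exact Nat.floor_le (div_nonneg (by linarith) hl.le)
    have hkb : ∀ k ≤ B, (n₀ + k : ℕ) * lam l ≤ Tm + b := by
      intro k hk
      have : (k : ℝ) * lam l ≤ B * lam l := by gcongr
      push_cast; linarith [add_mul (n₀ : ℝ) k (lam l)]
    set c : ℕ → ℝ := fun k => w l (n₀ + k) * ∏ i ∈ Finset.Ioo n₀ (n₀ + k), (1 - w l i) with hc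
    have hc0 : ∀ k, 0 ≤ c k := fun k => mul_nonneg (hw0 l _)
      (Finset.prod_nonneg fun i _ => by linarith [hw1 l i])
    have hsumc := sum_mul_prod_one_sub (w l) n₀ A B hAB
    have hpA := h2 n₀ A (hkb A hAB)
    have hpB := h2 n₀ B (hkb B le_rfl)
    set πA := ∏ i ∈ Finset.Ioc n₀ (n₀ + A), (1 - w l i) with hπA
    set πB := ∏ i ∈ Finset.Ioc n₀ (n₀ + B), (1 - w l i) with hπB
    have hπA1 : πA ≤ 1 := Finset.prod_le_one (fun i _ => by linarith [hw1 l i])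
      (fun i _ => by linarith [hw0 l i])
    have hπB0 : 0 ≤ πB := Finset.prod_nonneg fun i _ => by linarith [hw1 l i]
    have hsc : ∑ k ∈ Finset.Ioc A B, c k = πA - πB := hsumc
    have eA : |Real.exp (-(A * lam l)) - Real.exp (-a)| ≤ ε / 5 :=
      (abs_exp_neg_sub_exp_neg_le (by positivity) ha).trans
        ((abs_floor_div_mul_sub_le ha hl).trans h3.le)
    have eB : |Real.exp (-(B * lam l)) - Real.exp (-b)| ≤ ε / 5 :=
      (abs_exp_neg_sub_exp_neg_le (by positivity) (by linarith)).trans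
        ((abs_floor_div_mul_sub_le (by linarith) hl).trans h3.le)
    have hmain : |∑ k ∈ Finset.Ioc A B, c k * gapPoly (w l) (n₀ + k) (L.map (scaledIoc (lam l))) -
        (πA - πB) * expProd L| ≤ ε / 5 := by
      rw [← hsc, Finset.sum_mul, ← Finset.sum_sub_distrib]
      calc _ ≤ ∑ k ∈ Finset.Ioc A B, |c k * gapPoly (w l) (n₀ + k) (L.map (scaledIoc (lam l))) -
            c k * expProd L| := Finset.abs_sum_le_sum_abs _ _
        _ ≤ ∑ k ∈ Finset.Ioc A B, c k * (ε / 5) := by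
            refine Finset.sum_le_sum fun k hk => ?_
            rw [← mul_sub, abs_mul, abs_of_nonneg (hc0 k)]
            exact mul_le_mul_of_nonneg_left
              (h1 _ (hkb k (Finset.mem_Ioc.1 hk).2)) (hc0 k)
        _ = (πA - πB) * (ε / 5) := by rw [← Finset.sum_mul, hsc]
        _ ≤ ε / 5 := by nlinarith
    have e : expProd ((a, b) :: L) = (Real.exp (-a) - Real.exp (-b)) * expProd L := by
      simp [expProd]
    have e2 : |(πA - πB) * expProd L - expProd ((a, b) :: L)| ≤ 4 * (ε / 5) := by
      rw [e, ← sub_mul, abs_mul, abs_of_nonneg hq.1]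
      rw [abs_le] at hpA hpB eA eB
      have : |πA - πB - (Real.exp (-a) - Real.exp (-b))| ≤ 4 * (ε / 5) := by
        rw [abs_le]
        constructor <;> linarith [hpA.1, hpA.2, hpB.1, hpB.2, eA.1, eA.2, eB.1, eB.2]
      calc _ ≤ 4 * (ε / 5) * 1 := mul_le_mul this hq.2 hq.1 (by positivity)
        _ = _ := mul_one _
    calc _ ≤ _ := abs_sub_le _ ((πA - πB) * expProd L) _
      _ ≤ ε / 5 + 4 * (ε / 5) := add_le_add hmain e2
      _ = ε := by ring

lemma gapBound_map_scaledIoc_le {s : ℝ} (hs : 0 < s) {L : List (ℝ × ℝ)}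
    (hL : ∀ ab ∈ L, 0 ≤ ab.1 ∧ ab.1 ≤ ab.2) :
    0 ≤ (L.map Prod.snd).sum ∧ gapBound (L.map (scaledIoc s)) * s ≤ (L.map Prod.snd).sum := by
  induction L with
  | nil => simp [gapBound]
  | cons ab L ih =>
    obtain ⟨h1, h2⟩ := ih fun x hx => hL x (List.mem_cons_of_mem _ hx)
    obtain ⟨ha, hab⟩ := hL ab List.mem_cons_self
    have e : gapBound ((ab :: L).map (scaledIoc s)) =
        (scaledIoc s ab).sup id + gapBound (L.map (scaledIoc s)) := by simp [gapBound]
    have h3 : (scaledIoc s ab).sup id ≤ ⌊ab.2 / s⌋₊ :=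
      Finset.sup_le fun n hn => (Finset.mem_Ioc.1 hn).2
    have h4 : (((scaledIoc s ab).sup id : ℕ) : ℝ) * s ≤ ab.2 := by
      rw [← le_div_iff₀ hs]
      exact (Nat.cast_le.2 h3).trans (Nat.floor_le (div_nonneg (by linarith) hs.le))
    rw [e, List.map_cons, List.sum_cons]
    push_cast
    constructor
    · linarith
    · linarith [add_mul (((scaledIoc s ab).sup id : ℕ) : ℝ) (gapBound (L.map (scaledIoc s))) s]

variable {X : Type*} [MeasurableSpace X] {μ : Measure X} [IsProbabilityMeasure μ]

/-- If the mixed moments of random sequences in `[0,1]` are asymptotically those of independent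
rare events of given probabilities, then the gap probabilities are asymptotically exponential. -/
lemma tendsto_integral_gapPoly {ξ : ℕ → X → ℕ → ℝ}
    (hξm : ∀ l n, Measurable fun x => ξ l x n) (hξ0 : ∀ l x n, 0 ≤ ξ l x n)
    (hξ1 : ∀ l x n, ξ l x n ≤ 1)
    (hlam : ∀ l, 0 < lam l) (hlam0 : Tendsto lam atTop (𝓝 0))
    (hw0 : ∀ l n, 0 ≤ w l n) (hw1 : ∀ l n, w l n ≤ 1)
    (hC : 0 ≤ C) (hwC : ∀ᶠ l in atTop, ∀ n, 1 ≤ n → w l n ≤ C * lam l)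
    (hsum : ∀ t : ℝ, 0 < t →
      Tendsto (fun l => ∑ n ∈ Finset.Ioc 0 ⌊t / lam l⌋₊, w l n) atTop (𝓝 t))
    (hmom : ∀ (q : ℕ) (t : ℝ), 0 < t → Tendsto (fun l =>
      ∑ Q ∈ (Finset.Ioc 0 ⌊t / lam l⌋₊).powersetCard q,
        |(∫ x, ∏ n ∈ Q, ξ l x n ∂μ) - ∏ n ∈ Q, w l n|) atTop (𝓝 0))
    {L : List (ℝ × ℝ)} (hL : ∀ ab ∈ L, 0 ≤ ab.1 ∧ ab.1 ≤ ab.2) :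
    Tendsto (fun l => ∫ x, gapPoly (ξ l x) 0 (L.map (scaledIoc (lam l))) ∂μ) atTop
      (𝓝 (expProd L)) := by
  set m := L.length with hm
  -- All hits involved occur before rescaled time equal to the sum of the upper end points; adding
  -- `1` keeps `t` positive for the empty list.
  set t : ℝ := (L.map Prod.snd).sum + 1 with ht
  have hb0 := (gapBound_map_scaledIoc_le one_pos hL).1
  have ht0 : 0 < t := by linarith
  rw [Metric.tendsto_nhds]
  intro ε hε
  -- The truncation order depends on `ε` and on the intervals but not on `l`: the remainder is
  -- bounded through `elemSymm_le`, with total weight at most `t + 1`.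
  obtain ⟨J, hJ⟩ : ∃ J : ℕ, (t + 1) ^ m * ((t + 1) ^ J / J.factorial) < ε / 8 := by
    have := (FloorSemiring.tendsto_pow_div_factorial_atTop (t + 1)).const_mul ((t + 1) ^ m)
    rw [mul_zero] at this
    exact (this.eventually_lt_const (by positivity)).exists
  have hsumΔ : Tendsto (fun l => ∑ j ∈ Finset.range (J + 1), ((m + j).choose m : ℝ) *
        ∑ Q ∈ (Finset.Ioc 0 ⌊t / lam l⌋₊).powersetCard (m + j),
          |(∫ x, ∏ n ∈ Q, ξ l x n ∂μ) - ∏ n ∈ Q, w l n|) atTop (𝓝 0) := by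
    have := tendsto_finsetSum (Finset.range (J + 1)) fun j _ =>
      (hmom (m + j) t ht0).const_mul ((m + j).choose m : ℝ)
    simpa using this
  filter_upwards [hsumΔ.eventually_lt_const (by positivity : 0 < ε / 4),
    (hsum t ht0).eventually_lt_const (lt_add_one t),
    eventually_abs_gapPoly_sub_le hlam hlam0 hw0 hw1 hC hwC hsum hL (Tm := 0) le_rfl
      (ε := ε / 4) (by positivity)] with l h1 h2 h3
  have hl := hlam l
  have hI : ∀ J ∈ L.map (scaledIoc (lam l)), ∀ k ∈ J, 1 ≤ k := by
    intro J hJ k hk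
    obtain ⟨ab, -, rfl⟩ := List.mem_map.1 hJ
    have := (Finset.mem_Ioc.1 hk).1
    omega
  have hN : gapBound (L.map (scaledIoc (lam l))) ≤ ⌊t / lam l⌋₊ := by
    apply Nat.le_floor
    rw [le_div_iff₀ hl]
    linarith [(gapBound_map_scaledIoc_le hl hL).2]
  have key := abs_integral_gapPoly_sub_le (μ := μ) (hξm l) (hξ0 l) (hξ1 l) (hw0 l) (hw1 l) hI hN J
  rw [List.length_map, ← hm] at key
  have hes : ((m + J).choose m : ℝ) * elemSymm (w l) (Finset.Ioc 0 ⌊t / lam l⌋₊) (m + J) ≤ ε / 8 := by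
    refine le_trans ?_ hJ.le
    have e1 := elemSymm_le (ξ := w l) (U := Finset.Ioc 0 ⌊t / lam l⌋₊) (fun n _ => hw0 l n) (m + J)
    have e2 : ((m + J).choose m : ℝ) * m.factorial * J.factorial = (m + J).factorial := by
      have := Nat.add_choose_mul_factorial_mul_factorial m J
      rw [← Nat.choose_symm_add] at this
      exact_mod_cast this
    have e3 : (1 : ℝ) ≤ m.factorial := by exact_mod_cast Nat.one_le_iff_ne_zero.2 m.factorial_ne_zero
    have hs0 : 0 ≤ ∑ n ∈ Finset.Ioc 0 ⌊t / lam l⌋₊, w l n := Finset.sum_nonneg fun n _ => hw0 l n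
    have e4 : ((m + J).choose m : ℝ) / (m + J).factorial ≤ 1 / J.factorial := by
      rw [div_le_div_iff₀ (by positivity) (by positivity), ← e2]
      have : (0 : ℝ) ≤ (m + J).choose m * J.factorial := by positivity
      nlinarith
    calc _ ≤ ((m + J).choose m : ℝ) * ((t + 1) ^ (m + J) / (m + J).factorial) := by
          gcongr
          refine e1.trans ?_
          gcongr
      _ = (t + 1) ^ (m + J) * ((m + J).choose m / (m + J).factorial) := by ring
      _ ≤ (t + 1) ^ (m + J) * (1 / J.factorial) := by gcongr
      _ = _ := by rw [pow_add]; ring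
  have h3' := h3 0 (by simp)
  rw [Real.dist_eq]
  calc _ ≤ _ := abs_sub_le _ (gapPoly (w l) 0 (L.map (scaledIoc (lam l)))) _
    _ ≤ (ε / 4 + 2 * (ε / 8)) + ε / 4 := by
        refine add_le_add (key.trans ?_) h3'
        linarith
    _ < ε := by linarith

end GapAsymptotics

/-! ### Boxes and convergence in distribution -/

section Boxes

/-- The box of sequences whose first `k` entries lie in the intervals `(a i, b i]`. -/
def extBox (k : ℕ) (a b : ℕ → ℝ) : Set (ℕ → ℝ≥0∞) :=
  {z | ∀ i < k, z i ∈ Set.Ioc (ENNReal.ofReal (a i)) (ENNReal.ofReal (b i))}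

lemma measurableSet_extBox (k : ℕ) (a b : ℕ → ℝ) : MeasurableSet (extBox k a b) := by
  have : extBox k a b = ⋂ i, ⋂ (_ : i < k), (fun z : ℕ → ℝ≥0∞ => z i) ⁻¹'
      Set.Ioc (ENNReal.ofReal (a i)) (ENNReal.ofReal (b i)) := by
    ext z; simp [extBox]
  rw [this]
  exact MeasurableSet.iInter fun i => MeasurableSet.iInter fun _ =>
    measurable_pi_apply i measurableSet_Ioc

lemma expMeasure_one_Ioc {a b : ℝ} (ha : 0 ≤ a) (hab : a ≤ b) :
    expMeasure 1 (Set.Ioc a b) = ENNReal.ofReal (Real.exp (-a) - Real.exp (-b)) := by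
  have : IsProbabilityMeasure (expMeasure 1) := isProbabilityMeasure_expMeasure one_pos
  rw [← measure_cdf (expMeasure 1), StieltjesFunction.measure_Ioc, cdf_expMeasure_eq one_pos,
    cdf_expMeasure_eq one_pos, if_pos ha, if_pos (ha.trans hab)]
  congr 1
  simp only [one_mul]
  ring

lemma stdExpSeq_map_extBox {k : ℕ} {a b : ℕ → ℝ} (hab : ∀ i < k, 0 ≤ a i ∧ a i ≤ b i) :
    (stdExpSeq.map fun (z : ℕ → ℝ) (m : ℕ) => ENNReal.ofReal (z m)).real (extBox k a b) =
      expProd ((List.range k).map fun i => (a i, b i)) := by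
  have : ∀ _ : ℕ, IsProbabilityMeasure (expMeasure 1) :=
    fun _ => isProbabilityMeasure_expMeasure one_pos
  have : IsProbabilityMeasure (expMeasure 1) := isProbabilityMeasure_expMeasure one_pos
  have hm : Measurable fun (z : ℕ → ℝ) (m : ℕ) => ENNReal.ofReal (z m) :=
    measurable_pi_lambda _ fun m => ENNReal.measurable_ofReal.comp (measurable_pi_apply m)
  have hpre : (fun (z : ℕ → ℝ) (m : ℕ) => ENNReal.ofReal (z m)) ⁻¹' extBox k a b =
      Set.pi (Finset.range k : Set ℕ) fun i => Set.Ioc (a i) (b i) := by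
    ext z
    simp only [extBox, Set.mem_preimage, Set.mem_ofPred_eq, Set.mem_pi, Finset.coe_range,
      Set.mem_Iio, Set.mem_Ioc]
    refine forall_congr' fun i => forall_congr' fun hi => ?_
    obtain ⟨h1, h2⟩ := hab i hi
    rw [ENNReal.ofReal_lt_ofReal_iff_of_nonneg h1, ENNReal.ofReal_le_ofReal_iff (h1.trans h2)]
  rw [measureReal_def, Measure.map_apply hm (measurableSet_extBox _ _ _), hpre, stdExpSeq,
    Measure.infinitePi_pi (μ := fun _ : ℕ => expMeasure 1) (fun i _ => measurableSet_Ioc),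
    ENNReal.toReal_prod, expProd, List.map_map]
  have e : ∀ f : ℕ → ℝ, ((List.range k).map f).prod = ∏ i ∈ Finset.range k, f i := fun _ => rfl
  rw [e]
  refine Finset.prod_congr rfl fun i hi => ?_
  obtain ⟨h1, h2⟩ := hab i (Finset.mem_range.1 hi)
  rw [expMeasure_one_Ioc h1 h2, ENNReal.toReal_ofReal]
  · rfl
  · rw [sub_nonneg]; exact Real.exp_le_exp.2 (by linarith)

lemma ae_stdExpSeq_pos : ∀ᵐ z ∂stdExpSeq, ∀ i, 0 < z i := by
  have : ∀ _ : ℕ, IsProbabilityMeasure (expMeasure 1) :=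
    fun _ => isProbabilityMeasure_expMeasure one_pos
  have : IsProbabilityMeasure (expMeasure 1) := isProbabilityMeasure_expMeasure one_pos
  rw [ae_all_iff]
  intro i
  have h0 : ∀ᵐ x ∂(expMeasure 1), 0 < x := by
    have h : expMeasure 1 (Set.Iic 0) = 0 := by
      rw [← measure_cdf (expMeasure 1), StieltjesFunction.measure_Iic _ (tendsto_cdf_atBot _),
        cdf_expMeasure_eq one_pos]
      simp
    rw [ae_iff]
    convert h using 2
    ext x; simp
  exact (measurePreserving_eval_infinitePi (fun _ : ℕ => expMeasure 1) i).quasiMeasurePreserving.ae h0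

/-- The boxes with nonnegative finite end points. -/
def extBoxes : Set (Set (ℕ → ℝ≥0∞)) :=
  {s | ∃ (k : ℕ) (a b : ℕ → ℝ), (∀ i < k, 0 ≤ a i ∧ a i ≤ b i) ∧ s = extBox k a b}

/-- Only nonempty intersections matter: a common point ensures that the intersected intervals still
have ordered end points. A coordinate constrained by one box alone keeps the interval of that box.
-/
lemma isPiSystem_extBoxes : IsPiSystem extBoxes := by
  rintro _ ⟨k, a, b, h, rfl⟩ _ ⟨k', a', b', h', rfl⟩ ⟨z, hz, hz'⟩
  refine ⟨max k k', fun i => if i < k then if i < k' then max (a i) (a' i) else a i else a' i,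
    fun i => if i < k then if i < k' then min (b i) (b' i) else b i else b' i, fun i hi => ?_, ?_⟩
  · dsimp only
    split_ifs with h1 h2
    · obtain ⟨p1, p2⟩ := h i h1
      obtain ⟨p1', p2'⟩ := h' i h2
      have q := hz i h1
      have q' := hz' i h2
      have lt1 := q.1.trans_le q'.2
      have lt2 := q'.1.trans_le q.2
      rw [ENNReal.ofReal_lt_ofReal_iff_of_nonneg (by assumption)] at lt1 lt2
      exact ⟨le_max_of_le_left p1, max_le (le_min p2 lt1.le) (le_min lt2.le p2')⟩
    · exact h i h1
    · exact h' i (by omega)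
  · ext w
    simp only [extBox, Set.mem_inter_iff, Set.mem_ofPred_eq]
    constructor
    · rintro ⟨w1, w2⟩ i hi
      split_ifs with h1 h2
      · have u := w1 i h1
        have u' := w2 i h2
        rw [ENNReal.ofReal_max, ENNReal.ofReal_min]
        exact ⟨max_lt u.1 u'.1, le_min u.2 u'.2⟩
      · exact w1 i h1
      · exact w2 i (by omega)
    · intro hw
      constructor
      · intro i hi
        have u := hw i (by omega)
        rw [if_pos hi, if_pos hi] at u
        split_ifs at u with h2
        · rw [ENNReal.ofReal_max, ENNReal.ofReal_min] at u
          exact ⟨(le_max_left _ _).trans_lt u.1, u.2.trans (min_le_left _ _)⟩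
        · exact u
      · intro i hi
        have u := hw i (by omega)
        split_ifs at u with h2
        · rw [ENNReal.ofReal_max, ENNReal.ofReal_min] at u
          exact ⟨(le_max_right _ _).trans_lt u.1, u.2.trans (min_le_right _ _)⟩
        · exact u

lemma exists_rat_Ioc_subset {u : Set ℝ≥0∞} (hu : IsOpen u) {x : ℝ} (hx : 0 < x)
    (hxu : ENNReal.ofReal x ∈ u) :
    ∃ ab : ℚ × ℚ, 0 ≤ (ab.1 : ℝ) ∧ (ab.1 : ℝ) ≤ ab.2 ∧
      ENNReal.ofReal x ∈ Set.Ioc (ENNReal.ofReal ab.1) (ENNReal.ofReal ab.2) ∧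
      Set.Ioc (ENNReal.ofReal ab.1) (ENNReal.ofReal ab.2) ⊆ u := by
  obtain ⟨ε, hε, hball⟩ := Metric.isOpen_iff.1 (hu.preimage ENNReal.continuous_ofReal) x hxu
  obtain ⟨a, ha1, ha2⟩ := exists_rat_btwn (max_lt hx (sub_lt_self x hε))
  obtain ⟨b, hb1, hb2⟩ := exists_rat_btwn (lt_add_of_pos_right x hε)
  have ha0 := (le_max_left _ _).trans_lt ha1
  have haε := (le_max_right _ _).trans_lt ha1
  refine ⟨(a, b), ha0.le, (ha2.trans hb1).le,
    ⟨(ENNReal.ofReal_lt_ofReal_iff hx).2 ha2, ENNReal.ofReal_le_ofReal hb1.le⟩, ?_⟩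
  rintro w ⟨hw1, hw2⟩
  have hwt : w ≠ ⊤ := (hw2.trans_lt ENNReal.ofReal_lt_top).ne
  have e := ENNReal.ofReal_toReal hwt
  have h1 : (a : ℝ) < w.toReal := by
    rw [← e, ENNReal.ofReal_lt_ofReal_iff_of_nonneg ha0.le] at hw1; exact hw1
  have h2 : w.toReal ≤ b := by
    rw [← e, ENNReal.ofReal_le_ofReal_iff (by linarith)] at hw2; exact hw2
  rw [← e]
  apply hball
  rw [Metric.mem_ball, Real.dist_eq, abs_lt]
  constructor <;> linarith

/-- Convergence of the probabilities of boxes implies convergence in distribution to a sequence of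
independent standard exponential random variables. -/
lemma tendstoInDistribution_of_tendsto_extBox {X : Type*} [MeasurableSpace X] {μ : Measure X}
    [IsProbabilityMeasure μ] {Z : ℕ → X → ℕ → ℝ≥0∞} (hZ : ∀ l, Measurable (Z l))
    (h : ∀ (k : ℕ) (a b : ℕ → ℝ), (∀ i < k, 0 ≤ a i ∧ a i ≤ b i) →
      Tendsto (fun l => μ.real (Z l ⁻¹' extBox k a b)) atTop
        (𝓝 (expProd ((List.range k).map fun i => (a i, b i))))) :
    TendstoInDistribution Z atTop (fun (z : ℕ → ℝ) (m : ℕ) => ENNReal.ofReal (z m))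
      (fun _ => μ) stdExpSeq := by
  have hm : Measurable fun (z : ℕ → ℝ) (m : ℕ) => ENNReal.ofReal (z m) :=
    measurable_pi_lambda _ fun m => ENNReal.measurable_ofReal.comp (measurable_pi_apply m)
  refine ⟨fun l => (hZ l).aemeasurable, hm.aemeasurable, ?_⟩
  set P : ℕ → ProbabilityMeasure (ℕ → ℝ≥0∞) := fun l =>
    ⟨μ.map (Z l), Measure.isProbabilityMeasure_map (hZ l).aemeasurable⟩ with hP
  set ν : ProbabilityMeasure (ℕ → ℝ≥0∞) :=
    ⟨stdExpSeq.map fun (z : ℕ → ℝ) (m : ℕ) => ENNReal.ofReal (z m),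
      Measure.isProbabilityMeasure_map hm.aemeasurable⟩ with hν
  change Tendsto P atTop (𝓝 ν)
  have hbox : ∀ s ∈ extBoxes, Tendsto (fun l => P l s) atTop (𝓝 (ν s)) := by
    rintro _ ⟨k, a, b, hab, rfl⟩
    rw [← NNReal.tendsto_coe]
    have e : ((ν (extBox k a b) : ℝ≥0) : ℝ) = expProd ((List.range k).map fun i => (a i, b i)) :=
      stdExpSeq_map_extBox hab
    rw [e]
    refine (h k a b hab).congr fun l => ?_
    change _ = (μ.map (Z l)).real (extBox k a b)
    rw [map_measureReal_apply (hZ l) (measurableSet_extBox _ _ _)]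
  have hboxm : ∀ s ∈ extBoxes, MeasurableSet s := by
    rintro _ ⟨k, a, b, -, rfl⟩; exact measurableSet_extBox _ _ _
  -- Portmanteau: it suffices to bound the lower limit on open sets, by exhausting them with boxes
  -- from inside.
  apply tendsto_of_forall_isOpen_le_liminf
  intro G hG
  refine (le_liminf_iff (isCoboundedUnder_ge_of_le (x := 1) atTop
    fun l => ProbabilityMeasure.apply_le_one (P l) G) (by isBoundedDefault)).2 (fun r hr => ?_)
  -- Only finitely many end points of a box matter; coding them by a list of rational pairs makes
  -- the family countable.
  set 𝒞 : Set (Set (ℕ → ℝ≥0∞)) := {s | s ∈ extBoxes ∧ s ⊆ G ∧ ∃ L : List (ℚ × ℚ),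
    s = extBox L.length (fun i => ((L.getD i 0).1 : ℝ)) (fun i => ((L.getD i 0).2 : ℝ))} with h𝒞
  have hcount : 𝒞.Countable := by
    refine (Set.countable_range fun L : List (ℚ × ℚ) => extBox L.length
      (fun i => ((L.getD i 0).1 : ℝ)) (fun i => ((L.getD i 0).2 : ℝ))).mono ?_
    rintro s ⟨-, -, L, rfl⟩
    exact ⟨L, rfl⟩
  -- Boxes need not cover points of `G` with a coordinate `0` or `∞`, but the limit law gives such
  -- points no mass.
  have hcover : ∀ᵐ z ∂(ν : Measure (ℕ → ℝ≥0∞)), z ∈ G → z ∈ ⋃₀ 𝒞 := by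
    have hGm : MeasurableSet G := hG.measurableSet
    have hCm : MeasurableSet (⋃₀ 𝒞) := MeasurableSet.sUnion hcount fun s hs => hboxm s hs.1
    change ∀ᵐ z ∂(stdExpSeq.map fun (z : ℕ → ℝ) (m : ℕ) => ENNReal.ofReal (z m)),
      z ∈ G → z ∈ ⋃₀ 𝒞
    rw [ae_map_iff hm.aemeasurable (by
      have : {z | z ∈ G → z ∈ ⋃₀ 𝒞} = Gᶜ ∪ ⋃₀ 𝒞 := by
        ext z; simp only [Set.mem_ofPred_eq, Set.mem_union, Set.mem_compl_iff, imp_iff_not_or]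
      exact this ▸ hGm.compl.union hCm)]
    filter_upwards [ae_stdExpSeq_pos] with z hz hzG
    obtain ⟨I, u, hu, hIG⟩ := isOpen_pi_iff.1 hG _ hzG
    have hex : ∀ i, ∃ ab : ℚ × ℚ, 0 ≤ (ab.1 : ℝ) ∧ (ab.1 : ℝ) ≤ ab.2 ∧
        ENNReal.ofReal (z i) ∈ Set.Ioc (ENNReal.ofReal ab.1) (ENNReal.ofReal ab.2) ∧
        (i ∈ I → Set.Ioc (ENNReal.ofReal ab.1) (ENNReal.ofReal ab.2) ⊆ u i) := by
      intro i
      by_cases hi : i ∈ I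
      · obtain ⟨ab, h1, h2, h3, h4⟩ := exists_rat_Ioc_subset (hu i hi).1 (hz i) (hu i hi).2
        exact ⟨ab, h1, h2, h3, fun _ => h4⟩
      · obtain ⟨ab, h1, h2, h3, -⟩ := exists_rat_Ioc_subset isOpen_univ (hz i) (Set.mem_univ _)
        exact ⟨ab, h1, h2, h3, fun h => absurd h hi⟩
    choose ab h1 h2 h3 h4 using hex
    set k := I.sup id + 1 with hk
    refine ⟨extBox k (fun i => (ab i).1) (fun i => (ab i).2),
      ⟨⟨k, _, _, fun i _ => ⟨h1 i, h2 i⟩, rfl⟩, fun w hw => hIG ?_, (List.range k).map ab, ?_⟩,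
      fun i _ => h3 i⟩
    · intro i hi
      exact h4 i hi (hw i (Nat.lt_succ_of_le (Finset.le_sup (f := id) hi)))
    · ext w
      simp only [extBox, Set.mem_ofPred_eq, List.length_map, List.length_range]
      refine forall_congr' fun i => forall_congr' fun hi => ?_
      simp [List.getD_eq_getElem?_getD, hi]
  have hνC : ν G ≤ ν (⋃₀ 𝒞) := by
    have : (ν : Measure (ℕ → ℝ≥0∞)) G ≤ (ν : Measure (ℕ → ℝ≥0∞)) (⋃₀ 𝒞) :=
      measure_mono_ae hcover
    exact ENNReal.toNNReal_mono (measure_ne_top _ _) this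
  obtain ⟨t, ht, hrt⟩ : ∃ t : Finset (Set (ℕ → ℝ≥0∞)), (∀ s ∈ t, s ∈ 𝒞) ∧ r < ν (⋃ s ∈ t, s) := by
    have hlt : (r : ℝ≥0∞) < (ν : Measure (ℕ → ℝ≥0∞)) (⋃₀ 𝒞) := by
      have := hr.trans_le hνC
      rw [← ENNReal.coe_lt_coe] at this
      simpa using this
    rcases 𝒞.eq_empty_or_nonempty with he | hne
    · rw [he] at hlt; simp at hlt
    obtain ⟨f, hf⟩ := hcount.exists_eq_range hne
    rw [hf, Set.sUnion_range] at hlt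
    have htend := tendsto_measure_iUnion_accumulate (μ := (ν : Measure (ℕ → ℝ≥0∞))) (f := f)
    obtain ⟨n, hn⟩ := (htend.eventually_const_lt hlt).exists
    classical
    refine ⟨(Finset.range (n + 1)).image f, fun s hs => ?_, ?_⟩
    · obtain ⟨i, -, rfl⟩ := Finset.mem_image.1 hs
      rw [hf]; exact ⟨i, rfl⟩
    · rw [← ENNReal.coe_lt_coe]
      have e : (⋃ s ∈ (Finset.range (n + 1)).image f, s) = Set.accumulate f n := by
        ext w; simp [Set.accumulate]
      rw [e]
      simpa using hn
  -- Inclusion–exclusion: on a π-system, convergence passes to finite unions.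
  have hconv := isPiSystem_extBoxes.tendsto_probabilityMeasure_biUnion
    (fun s hs => (ht s hs).1) hboxm hbox
  filter_upwards [(tendsto_order.1 hconv).1 r hrt] with l hl
  exact hl.trans_le (ProbabilityMeasure.apply_mono _ (Set.iUnion₂_subset fun s hs => (ht s hs).2.1))

end Boxes

/-! ### Waiting times as gap polynomials of hit indicators -/

section Waiting

variable {X Y : Type*} {K : ℕ} {T : Y → X → X} {R : Y → Y} {A : Fin K → Set X} {κ : ℕ → Fin K}
  {α : ℕ → ℕ} {y : Y} {x : X} {m : ℕ}

/-- A nonempty set of natural numbers attains its infimum in `ℕ∞`, so a finite hit index is an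
actual first hit. -/
lemma hitIndex_succ_eq_coe_iff (n : ℕ) : hitIndex T R A κ α y x (m + 1) = n ↔
    (hitIndex T R A κ α y x m < n ∧ IsHit T R A κ α y x n) ∧
      ∀ n' < n, ¬ (hitIndex T R A κ α y x m < n' ∧ IsHit T R A κ α y x n') := by
  rw [hitIndex]
  set P : ℕ → Prop := fun n => hitIndex T R A κ α y x m < n ∧ IsHit T R A κ α y x n with hP
  change (⨅ (n : ℕ) (_ : P n), (n : ℕ∞)) = n ↔ P n ∧ ∀ n' < n, ¬ P n'
  constructor
  · intro h
    have hex : ∃ n', P n' := by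
      by_contra hno
      push Not at hno
      have : (⨅ (n : ℕ) (_ : P n), (n : ℕ∞)) = ⊤ := by simp [hno]
      rw [this] at h
      exact ENat.top_ne_natCast n h
    classical
    have hle : (⨅ (n : ℕ) (_ : P n), (n : ℕ∞)) = (Nat.find hex : ℕ) :=
      le_antisymm (iInf₂_le _ (Nat.find_spec hex))
        (le_iInf₂ fun n' hn' => Nat.cast_le.2 (Nat.find_min' hex hn'))
    rw [hle, Nat.cast_inj] at h
    rw [← h]
    exact ⟨Nat.find_spec hex, fun n' hn' => Nat.find_min hex hn'⟩
  · rintro ⟨h1, h2⟩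
    refine le_antisymm (iInf₂_le _ h1) (le_iInf₂ fun n' hn' => Nat.cast_le.2 ?_)
    by_contra hlt
    exact h2 n' (not_le.1 hlt) hn'

lemma hitIndex_succ_eq_top_iff : hitIndex T R A κ α y x (m + 1) = ⊤ ↔
    ∀ n : ℕ, ¬ (hitIndex T R A κ α y x m < n ∧ IsHit T R A κ α y x n) := by
  rw [hitIndex]
  simp only [iInf_eq_top, ENat.natCast_ne_top, imp_false]

section Measurability

variable [MeasurableSpace X] {μ : Measure X}

lemma measurableSet_isHit (hT : ∀ y, MeasurePreserving (T y) μ μ) (hA : ∀ k, MeasurableSet (A k))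
    (n : ℕ) : MeasurableSet {x | IsHit T R A κ α y x n} :=
  (measurePreserving_fiberIter hT y _).measurable (hA _)

lemma measurable_hitIndex (hT : ∀ y, MeasurePreserving (T y) μ μ)
    (hA : ∀ k, MeasurableSet (A k)) (m : ℕ) :
    Measurable fun x => hitIndex T R A κ α y x m := by
  induction m with
  | zero => exact measurable_const
  | succ m ih =>
    rw [ENat.measurable_iff]
    intro n
    have hb : ∀ n : ℕ, MeasurableSet
        {x | hitIndex T R A κ α y x m < n ∧ IsHit T R A κ α y x n} := fun n =>
      (ih (MeasurableSet.of_discrete (s := Set.Iio (n : ℕ∞)))).inter (measurableSet_isHit hT hA n)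
    have e : (fun x => hitIndex T R A κ α y x (m + 1)) ⁻¹' {(n : ℕ∞)} =
        {x | hitIndex T R A κ α y x m < n ∧ IsHit T R A κ α y x n} ∩
          ⋂ n' : ℕ, ⋂ _ : n' < n,
            {x | hitIndex T R A κ α y x m < n' ∧ IsHit T R A κ α y x n'}ᶜ := by
      ext x
      rw [Set.mem_preimage, Set.mem_singleton_iff, hitIndex_succ_eq_coe_iff]
      simp
    rw [e]
    exact (hb n).inter (MeasurableSet.iInter fun n' => MeasurableSet.iInter fun _ => (hb n').compl)

lemma measurable_scaled_waitingProcess (hT : ∀ y, MeasurePreserving (T y) μ μ)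
    (hA : ∀ k, MeasurableSet (A k)) (c : ℝ≥0∞) :
    Measurable fun (x : X) (m : ℕ) => c * (waitingProcess T R A κ α y x m : ℝ≥0∞) := by
  refine measurable_pi_lambda _ fun m => ?_
  have h : Measurable fun x => (hitIndex T R A κ α y x m, hitIndex T R A κ α y x (m + 1)) :=
    (measurable_hitIndex hT hA m).prodMk (measurable_hitIndex hT hA (m + 1))
  -- The waiting time is a function of two consecutive hit indices, which take values in a discrete
  -- space, so truncated subtraction raises no measurability issue.
  exact (Measurable.of_discrete (f := fun p : ℕ∞ × ℕ∞ =>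
    c * ((if p.1 = ⊤ then ⊤ else p.2 - p.1 : ℕ∞) : ℝ≥0∞))).comp h

end Measurability

open Classical in
/-- The indicator of the hit with index `n`. -/
def hitInd (T : Y → X → X) (R : Y → Y) (A : Fin K → Set X) (κ : ℕ → Fin K) (α : ℕ → ℕ) (y : Y)
    (x : X) (n : ℕ) : ℝ := if IsHit T R A κ α y x n then 1 else 0

lemma hitInd_of_isHit {n : ℕ} (h : IsHit T R A κ α y x n) : hitInd T R A κ α y x n = 1 := if_pos h

lemma hitInd_of_not_isHit {n : ℕ} (h : ¬ IsHit T R A κ α y x n) : hitInd T R A κ α y x n = 0 :=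
  if_neg h

open Classical in
-- Started at a hit, the sum has at most one nonzero term: smaller gaps miss a hit at their end,
-- larger ones have a hit in the stretch that should be empty. If there is no further hit every term
-- vanishes, and a waiting time `⊤` lies in no finite interval.
lemma gapPoly_hitInd {I : List (Finset ℕ)} (hI : ∀ J ∈ I, ∀ k ∈ J, 1 ≤ k) {n₀ : ℕ}
    (hm : hitIndex T R A κ α y x m = n₀) :
    gapPoly (hitInd T R A κ α y x) n₀ I =
      if ∀ (i : ℕ) (hi : i < I.length), ∃ k ∈ I[i], waitingProcess T R A κ α y x (m + i) = k
      then 1 else 0 := by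
  induction I generalizing m n₀ with
  | nil => simp [gapPoly]
  | cons J I ih =>
    have hI' : ∀ J ∈ I, ∀ k ∈ J, 1 ≤ k := fun J' hJ' => hI J' (List.mem_cons_of_mem _ hJ')
    have hw : waitingProcess T R A κ α y x m = hitIndex T R A κ α y x (m + 1) - n₀ := by
      rw [waitingProcess, hm, if_neg (ENat.natCast_ne_top _)]
    have hsplit : (∀ (i : ℕ) (hi : i < (J :: I).length),
        ∃ k ∈ (J :: I)[i], waitingProcess T R A κ α y x (m + i) = k) ↔
        (∃ k ∈ J, waitingProcess T R A κ α y x m = k) ∧ ∀ (i : ℕ) (hi : i < I.length),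
          ∃ k ∈ I[i], waitingProcess T R A κ α y x (m + 1 + i) = k := by
      constructor
      · intro h
        refine ⟨h 0 (by simp), fun i hi => ?_⟩
        have := h (i + 1) (by simpa using hi)
        rw [List.getElem_cons_succ] at this
        rwa [add_right_comm, add_assoc]
      · rintro ⟨h1, h2⟩ i hi
        rcases i with _ | i
        · exact h1
        · have := h2 i (by simpa using hi)
          rw [List.getElem_cons_succ, ← add_assoc, add_right_comm]
          exact this
    rw [if_congr hsplit rfl rfl, gapPoly]
    rcases eq_or_ne (hitIndex T R A κ α y x (m + 1)) ⊤ with htop | hne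
    · rw [if_neg]
      · refine Finset.sum_eq_zero fun k hk => ?_
        have hk1 := hI J List.mem_cons_self k hk
        have := hitIndex_succ_eq_top_iff.1 htop (n₀ + k)
        rw [hm] at this
        have hnot : ¬ IsHit T R A κ α y x (n₀ + k) := fun h =>
          this ⟨by rw [Nat.cast_lt]; omega, h⟩
        rw [hitInd_of_not_isHit hnot]; ring
      · rintro ⟨⟨k, -, hk⟩, -⟩
        rw [hw, htop, ENat.top_sub_natCast] at hk
        exact ENat.top_ne_natCast k hk
    · obtain ⟨n₁, hn₁⟩ := ENat.ne_top_iff_exists.1 hne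
      have hspec := (hitIndex_succ_eq_coe_iff n₁).1 hn₁.symm
      rw [hm] at hspec
      simp only [Nat.cast_lt] at hspec
      obtain ⟨⟨hlt, hhit⟩, hmin⟩ := hspec
      obtain ⟨g, rfl⟩ : ∃ g, n₁ = n₀ + g := ⟨n₁ - n₀, by omega⟩
      have hwg : waitingProcess T R A κ α y x m = g := by
        rw [hw, ← hn₁, Nat.cast_add]
        exact (ENat.addLECancellable_of_ne_top (ENat.natCast_ne_top _)).add_tsub_cancel_left
      have hterm : ∀ k ∈ J, k ≠ g → hitInd T R A κ α y x (n₀ + k) *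
          (∏ i ∈ Finset.Ioo n₀ (n₀ + k), (1 - hitInd T R A κ α y x i)) *
          gapPoly (hitInd T R A κ α y x) (n₀ + k) I = 0 := by
        intro k hk hkg
        have hk1 := hI J List.mem_cons_self k hk
        rcases lt_or_gt_of_ne hkg with h | h
        · have hnot : ¬ IsHit T R A κ α y x (n₀ + k) := fun hh =>
            hmin (n₀ + k) (by omega) ⟨by omega, hh⟩
          rw [hitInd_of_not_isHit hnot]; ring
        · rw [Finset.prod_eq_zero (i := n₀ + g) (Finset.mem_Ioo.2 ⟨hlt, by omega⟩)]
          · ring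
          · rw [hitInd_of_isHit hhit, sub_self]
      by_cases hgJ : g ∈ J
      · rw [Finset.sum_eq_single_of_mem g hgJ hterm, hitInd_of_isHit hhit, Finset.prod_eq_one,
          ih hI' hn₁.symm]
        · have : (∃ k ∈ J, waitingProcess T R A κ α y x m = k) := ⟨g, hgJ, hwg⟩
          simp only [this, true_and, one_mul]
        · intro i hi
          obtain ⟨h1, h2⟩ := Finset.mem_Ioo.1 hi
          have hnot : ¬ IsHit T R A κ α y x i := fun hh => hmin i h2 ⟨h1, hh⟩
          rw [hitInd_of_not_isHit hnot, sub_zero]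
      · rw [if_neg, Finset.sum_eq_zero]
        · intro k hk
          exact hterm k hk (fun h => hgJ (h ▸ hk))
        · rintro ⟨⟨k, hk, hk'⟩, -⟩
          rw [hwg, Nat.cast_inj] at hk'
          exact hgJ (hk' ▸ hk)

/-- Half-open intervals match the rounding exactly: `a < lam * n` means `⌊a / lam⌋₊ < n`, and `lam *
n ≤ b` means `n ≤ ⌊b / lam⌋₊`. -/
lemma scaled_mem_Ioc_iff {lam a b : ℝ} (hlam : 0 < lam) (ha : 0 ≤ a) (hab : a ≤ b) (W : ℕ∞) :
    ENNReal.ofReal lam * (W : ℝ≥0∞) ∈ Set.Ioc (ENNReal.ofReal a) (ENNReal.ofReal b) ↔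
      ∃ k ∈ scaledIoc lam (a, b), W = k := by
  induction W using ENat.recTopCoe with
  | top =>
    simp only [ENat.toENNReal_top, Set.mem_Ioc]
    rw [ENNReal.mul_top (by simpa using hlam)]
    simp
  | coe n =>
    have e : ENNReal.ofReal lam * ((n : ℕ∞) : ℝ≥0∞) = ENNReal.ofReal (lam * n) := by
      rw [ENNReal.ofReal_mul hlam.le, ENat.toENNReal_coe, ENNReal.ofReal_natCast]
    rw [e, Set.mem_Ioc, ENNReal.ofReal_lt_ofReal_iff_of_nonneg ha,
      ENNReal.ofReal_le_ofReal_iff (ha.trans hab)]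
    simp only [Nat.cast_inj, exists_eq_right', scaledIoc, Finset.mem_Ioc]
    rw [Nat.floor_lt (by positivity), div_lt_iff₀ hlam, Nat.le_floor_iff
      (div_nonneg (ha.trans hab) hlam.le), le_div_iff₀ hlam, mul_comm]

variable [MeasurableSpace X] {μ : Measure X}

lemma integral_gapPoly_hitInd (hT : ∀ y, MeasurePreserving (T y) μ μ)
    (hA : ∀ k, MeasurableSet (A k)) {lam : ℝ} (hlam : 0 < lam) {k : ℕ} {a b : ℕ → ℝ}
    (hab : ∀ i < k, 0 ≤ a i ∧ a i ≤ b i) :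
    ∫ x, gapPoly (hitInd T R A κ α y x) 0
      (((List.range k).map fun i => (a i, b i)).map (scaledIoc lam)) ∂μ =
    μ.real ((fun (x : X) (m : ℕ) =>
      ENNReal.ofReal lam * (waitingProcess T R A κ α y x m : ℝ≥0∞)) ⁻¹' extBox k a b) := by
  classical
  rw [← integral_indicator_one (measurable_scaled_waitingProcess hT hA _
    (measurableSet_extBox k a b))]
  refine integral_congr_ae (ae_of_all _ fun x => ?_)
  dsimp only
  rw [gapPoly_hitInd (m := 0) (n₀ := 0), Set.indicator_apply]
  · refine if_congr ?_ rfl rfl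
    simp only [extBox, Set.mem_preimage, Set.mem_ofPred_eq, List.length_map, List.length_range]
    refine forall_congr' fun i => forall_congr' fun hi => ?_
    obtain ⟨h1, h2⟩ := hab i hi
    rw [scaled_mem_Ioc_iff hlam h1 h2]
    simp
  · intro J hJ n hn
    obtain ⟨ab, -, rfl⟩ := List.mem_map.1 hJ
    have := (Finset.mem_Ioc.1 hn).1
    omega
  · rfl

end Waiting

/-! ### Counting separated and non-separated sets of times -/

section Separated

/-- The times `s n`, `n ∈ S`, have pairwise gaps at least `p`. -/
def IsSeparated (s : ℕ → ℕ) (p : ℕ) (S : Finset ℕ) : Prop :=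
  ∀ n ∈ S, ∀ m ∈ S, n < m → s n + p ≤ s m

variable {s : ℕ → ℕ} {p : ℕ}

/-- Cut time into bins of length `g`, so that different elements of `H` fall into different bins.
Some residue class of bins modulo `L` contains at least a fraction `1 / L` of `H`; within it bins
differ by at least `L`, hence times by more than `(L - 1) * g ≥ p`. -/
lemma exists_isSeparated_subset {g : ℝ} (hg : 0 < g) {L : ℕ} (hL : 1 ≤ L)
    (hLp : (p : ℝ) ≤ ((L : ℝ) - 1) * g) {H : Finset ℕ}
    (hH : ∀ n ∈ H, ∀ m ∈ H, n < m → (s n : ℝ) + g ≤ s m) :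
    ∃ D ⊆ H, IsSeparated s p D ∧ H.card ≤ L * D.card := by
  have hL0 : (0 : ℝ) < L := by exact_mod_cast hL
  obtain ⟨c, -, hc⟩ := Finset.exists_le_card_fiber_of_nsmul_le_card_of_maps_to
    (s := H) (t := Finset.range L) (f := fun n => ⌊(s n : ℝ) / g⌋₊ % L) (b := (H.card : ℝ) / L)
    (fun n _ => Finset.mem_range.2 (Nat.mod_lt _ hL)) ⟨0, Finset.mem_range.2 hL⟩ (by
      rw [Finset.card_range, nsmul_eq_mul, mul_div_cancel₀ _ hL0.ne'])
  refine ⟨H.filter fun n => ⌊(s n : ℝ) / g⌋₊ % L = c, Finset.filter_subset _ _, fun n hn m hm hnm => ?_, ?_⟩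
  rotate_left
  · rw [div_le_iff₀ hL0] at hc
    rw [mul_comm]
    exact_mod_cast hc
  · obtain ⟨hnH, hnc⟩ := Finset.mem_filter.1 hn
    obtain ⟨hmH, hmc⟩ := Finset.mem_filter.1 hm
    have h1 := hH n hnH m hmH hnm
    set a := ⌊(s n : ℝ) / g⌋₊ with ha
    set b := ⌊(s m : ℝ) / g⌋₊ with hb
    have h2 : (s n : ℝ) / g + 1 ≤ s m / g := by
      rw [le_div_iff₀ hg, add_mul, div_mul_cancel₀ _ hg.ne']; linarith
    have h3 : a + 1 ≤ b := by
      rw [ha, ← Nat.floor_add_one (by positivity)]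
      exact Nat.floor_le_floor h2
    have h4 : a + L ≤ b := by
      have h5 : L ∣ b - a := (Nat.modEq_iff_dvd' (by omega)).1 (hnc.trans hmc.symm)
      have := Nat.le_of_dvd (by omega) h5
      omega
    have h5 : (s n : ℝ) / g < a + 1 := Nat.lt_floor_add_one _
    have h6 : (b : ℝ) ≤ s m / g := Nat.floor_le (by positivity)
    have h7 : (a : ℝ) + L ≤ b := by exact_mod_cast h4
    rw [div_lt_iff₀ hg] at h5
    rw [le_div_iff₀ hg] at h6
    have h8 : (s n : ℝ) + p ≤ s m := by nlinarith
    exact_mod_cast h8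

/-- For `D ≥ 2 * q` every factor of the falling factorial is at least `D / 2`; small `D` are
absorbed by the additive constant. -/
lemma Nat.pow_le_add_choose (D q : ℕ) :
    D ^ q ≤ (2 * q) ^ q + 2 ^ q * q.factorial * D.choose q := by
  rcases le_total D (2 * q) with h | h
  · exact (Nat.pow_le_pow_left h q).trans (Nat.le_add_right _ _)
  · have h1 : (D + 1 - q) ^ q ≤ q.factorial * D.choose q := by
      rw [← Nat.descFactorial_eq_factorial_mul_choose]
      exact Nat.pow_sub_le_descFactorial D q
    calc D ^ q ≤ (2 * (D + 1 - q)) ^ q := Nat.pow_le_pow_left (by omega) q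
      _ = 2 ^ q * (D + 1 - q) ^ q := mul_pow _ _ _
      _ ≤ 2 ^ q * (q.factorial * D.choose q) := by gcongr
      _ ≤ _ := by rw [mul_assoc]; exact Nat.le_add_left _ _

open Classical in
/-- The subsets of `W` with `q` elements and separated times. -/
def sepSets (s : ℕ → ℕ) (p : ℕ) (W : Finset ℕ) (q : ℕ) : Finset (Finset ℕ) :=
  (W.powersetCard q).filter (IsSeparated s p)

open Classical in
/-- The subsets of `W` with `q` elements whose times are not separated. -/
def nonsepSets (s : ℕ → ℕ) (p : ℕ) (W : Finset ℕ) (q : ℕ) : Finset (Finset ℕ) :=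
  (W.powersetCard q).filter fun S => ¬ IsSeparated s p S

lemma mem_sepSets {W S : Finset ℕ} {q : ℕ} :
    S ∈ sepSets s p W q ↔ (S ⊆ W ∧ S.card = q) ∧ IsSeparated s p S := by
  simp [sepSets, Finset.mem_powersetCard]

lemma mem_nonsepSets {W S : Finset ℕ} {q : ℕ} :
    S ∈ nonsepSets s p W q ↔ (S ⊆ W ∧ S.card = q) ∧ ¬ IsSeparated s p S := by
  simp [nonsepSets, Finset.mem_powersetCard]

lemma sum_sepSets_add_sum_nonsepSets (W : Finset ℕ) (q : ℕ) (F : Finset ℕ → ℝ) :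
    ∑ S ∈ W.powersetCard q, F S = ∑ S ∈ sepSets s p W q, F S + ∑ S ∈ nonsepSets s p W q, F S := by
  classical
  exact (Finset.sum_filter_add_sum_filter_not _ _ _).symm

/-- Controls powers of the number of hits by a count of separated sets, whose mean mixing can
estimate. -/
lemma card_pow_le_of_separated {g : ℝ} (hg : 0 < g) {L : ℕ} (hL : 1 ≤ L)
    (hLp : (p : ℝ) ≤ ((L : ℝ) - 1) * g) {H : Finset ℕ}
    (hH : ∀ n ∈ H, ∀ m ∈ H, n < m → (s n : ℝ) + g ≤ s m) (q : ℕ) :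
    H.card ^ q ≤ L ^ q * ((2 * q) ^ q + 2 ^ q * q.factorial) * (1 + (sepSets s p H q).card) := by
  obtain ⟨D, hDH, hD, hcard⟩ := exists_isSeparated_subset hg hL hLp hH
  have h1 : D.card.choose q ≤ (sepSets s p H q).card := by
    rw [← Finset.card_powersetCard]
    refine Finset.card_le_card fun S hS => ?_
    obtain ⟨hSD, hSq⟩ := Finset.mem_powersetCard.1 hS
    exact mem_sepSets.2 ⟨⟨hSD.trans hDH, hSq⟩, fun n hn m hm => hD n (hSD hn) m (hSD hm)⟩
  calc H.card ^ q ≤ (L * D.card) ^ q := Nat.pow_le_pow_left hcard q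
    _ = L ^ q * D.card ^ q := mul_pow _ _ _
    _ ≤ L ^ q * ((2 * q) ^ q + 2 ^ q * q.factorial * D.card.choose q) := by
        gcongr; exact Nat.pow_le_add_choose _ _
    _ ≤ L ^ q * ((2 * q) ^ q + 2 ^ q * q.factorial * (sepSets s p H q).card) := by gcongr
    _ ≤ L ^ q * (((2 * q) ^ q + 2 ^ q * q.factorial) * (1 + (sepSets s p H q).card)) := by
        gcongr
        nlinarith [Nat.zero_le ((2 * q) ^ q * (sepSets s p H q).card),
          Nat.zero_le (2 ^ q * q.factorial)]
    _ = _ := by ring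

/-- A non-separated set contains a pair `n < m` with times closer than `p`. For given `n` there are
at most `p` such `m` because the times increase strictly, and the other `q - 2` elements are free.
Multiplication by `W.card` avoids the exponent `q - 1`, meaningless at `q = 0`. -/
lemma card_nonsepSets_mul_le (hs : StrictMono s) (W : Finset ℕ) (q : ℕ) :
    (nonsepSets s p W q).card * W.card ≤ p * W.card ^ q := by
  classical
  rcases lt_or_ge q 2 with hq | hq
  · have : nonsepSets s p W q = ∅ := by
      refine Finset.eq_empty_of_forall_notMem fun S hS => ?_
      obtain ⟨⟨-, hSq⟩, hn⟩ := mem_nonsepSets.1 hS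
      refine hn fun n hnS m hmS hnm => ?_
      have := Finset.card_le_one.1 (by omega : S.card ≤ 1) n hnS m hmS
      omega
    simp [this]
  obtain ⟨r, rfl⟩ : ∃ r, q = r + 2 := ⟨q - 2, by omega⟩
  set c : ℕ → Finset ℕ := fun n => W.filter fun m => n < m ∧ s m < s n + p with hc
  have hcc : ∀ n, (c n).card ≤ p := by
    intro n
    calc (c n).card ≤ (Finset.Ico n (n + p)).card := by
          refine Finset.card_le_card fun m hm => ?_
          obtain ⟨-, h1, h2⟩ := Finset.mem_filter.1 hm
          have h3 := hs.add_le_nat (m - n) n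
          rw [Nat.sub_add_cancel h1.le] at h3
          exact Finset.mem_Ico.2 ⟨h1.le, by omega⟩
      _ = p := by simp
  have hfib : ∀ n m, n < m →
      ((W.powersetCard (r + 2)).filter fun S => n ∈ S ∧ m ∈ S).card ≤ W.card ^ r := by
    intro n m hnm
    calc _ ≤ (W.powersetCard r).card := by
          refine Finset.card_le_card_of_injOn (fun S => (S.erase n).erase m) (fun S hS => ?_) ?_
          · obtain ⟨hS, hn, hm⟩ := Finset.mem_filter.1 (Finset.mem_coe.1 hS)
            obtain ⟨hSW, hcard⟩ := Finset.mem_powersetCard.1 hS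
            refine Finset.mem_coe.2 (Finset.mem_powersetCard.2
              ⟨(Finset.erase_subset _ _).trans ((Finset.erase_subset _ _).trans hSW), ?_⟩)
            rw [Finset.card_erase_of_mem (Finset.mem_erase.2 ⟨hnm.ne', hm⟩),
              Finset.card_erase_of_mem hn, hcard]
            rfl
          · intro S hS S' hS' h
            obtain ⟨-, hn, hm⟩ := Finset.mem_filter.1 (Finset.mem_coe.1 hS)
            obtain ⟨-, hn', hm'⟩ := Finset.mem_filter.1 (Finset.mem_coe.1 hS')
            have e : ∀ S : Finset ℕ, n ∈ S → m ∈ S → insert n (insert m ((S.erase n).erase m)) = S := by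
              intro S hn hm
              rw [Finset.insert_erase (Finset.mem_erase.2 ⟨hnm.ne', hm⟩), Finset.insert_erase hn]
            rw [← e S hn hm, ← e S' hn' hm']
            exact congrArg (fun Z => insert n (insert m Z)) h
      _ = W.card.choose r := Finset.card_powersetCard _ _
      _ ≤ W.card ^ r := Nat.choose_le_pow _ _
  have hsub : nonsepSets s p W (r + 2) ⊆ W.biUnion fun n => (c n).biUnion fun m =>
      (W.powersetCard (r + 2)).filter fun S => n ∈ S ∧ m ∈ S := by
    intro S hS
    obtain ⟨⟨hSW, hSq⟩, hn⟩ := mem_nonsepSets.1 hS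
    unfold IsSeparated at hn
    push Not at hn
    obtain ⟨n, hnS, m, hmS, hnm, hlt⟩ := hn
    refine Finset.mem_biUnion.2 ⟨n, hSW hnS, Finset.mem_biUnion.2 ⟨m, Finset.mem_filter.2
      ⟨hSW hmS, hnm, hlt⟩, Finset.mem_filter.2 ⟨Finset.mem_powersetCard.2 ⟨hSW, hSq⟩, hnS, hmS⟩⟩⟩
  have hcard : (nonsepSets s p W (r + 2)).card ≤ W.card * (p * W.card ^ r) := by
    refine (Finset.card_le_card hsub).trans (Finset.card_biUnion_le_card_mul _ _ _ fun n _ => ?_)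
    refine (Finset.card_biUnion_le_card_mul _ _ _ fun m hm => ?_).trans
      (Nat.mul_le_mul_right _ (hcc n))
    exact hfib n m (Finset.mem_filter.1 hm).2.1
  calc _ ≤ W.card * (p * W.card ^ r) * W.card := Nat.mul_le_mul_right _ hcard
    _ = _ := by ring

end Separated

/-! ### Comparison of moments with the independent case -/

section MomentBound

variable {X : Type*} [MeasurableSpace X] {μ : Measure X} [IsProbabilityMeasure μ]

/-- The event that index `n` is a hit which is followed too closely by another one. -/
def closeHit (ξ : X → ℕ → ℝ) (s : ℕ → ℕ) (p : ℕ) (W : Finset ℕ) (n : ℕ) : Set X :=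
  {x | ξ x n = 1 ∧ ∃ m ∈ W, n < m ∧ s m < s n + p ∧ ξ x m = 1}

lemma measurableSet_closeHit {ξ : X → ℕ → ℝ} (hξm : ∀ n, Measurable fun x => ξ x n) (s : ℕ → ℕ)
    (p : ℕ) (W : Finset ℕ) (n : ℕ) : MeasurableSet (closeHit ξ s p W n) := by
  have h1 : ∀ n, MeasurableSet {x | ξ x n = 1} := fun n => hξm n (measurableSet_singleton 1)
  have e : closeHit ξ s p W n = {x | ξ x n = 1} ∩
      ⋃ m ∈ W, ⋃ (_ : n < m), ⋃ (_ : s m < s n + p), {x | ξ x m = 1} := by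
    ext x
    simp only [closeHit, Set.mem_ofPred_eq, Set.mem_inter_iff, Set.mem_iUnion, exists_prop]
  rw [e]
  exact (h1 n).inter (Finset.measurableSet_biUnion _ fun m _ => MeasurableSet.iUnion fun _ =>
    MeasurableSet.iUnion fun _ => h1 m)

/-- Comparison of the moments of a sequence of hits with those of independent events, when the
comparison holds for separated indices and close hits are rare and of bounded multiplicity. -/
lemma sum_abs_moment_sub_le {ξ : X → ℕ → ℝ} (hξm : ∀ n, Measurable fun x => ξ x n)
    (hξ : ∀ x n, ξ x n = 0 ∨ ξ x n = 1) {w : ℕ → ℝ} {wbar : ℝ} {W : Finset ℕ} {s : ℕ → ℕ} {p : ℕ}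
    (hs : StrictMono s) (hw0 : ∀ n, 0 ≤ w n) (hw : ∀ n ∈ W, w n ≤ wbar) (hwbar : 0 ≤ wbar)
    {g δ β V : ℝ} (hg : 0 < g) {L : ℕ} (hL : 1 ≤ L) (hLp : (p : ℝ) ≤ ((L : ℝ) - 1) * g)
    (hV : 0 < V) (hδ0 : 0 ≤ δ) (q : ℕ)
    (hgood : ∀ S ⊆ W, IsSeparated s p S → (S.card = q ∨ S.card = 2 * q) →
      |(∫ x, ∏ n ∈ S, ξ x n ∂μ) - ∏ n ∈ S, w n| ≤ δ)
    (hsep : ∀ᵐ x ∂μ, ∀ n ∈ W, ∀ m ∈ W, n < m → ξ x n = 1 → ξ x m = 1 → (s n : ℝ) + g ≤ s m)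
    (hclose : ∑ n ∈ W, μ.real (closeHit ξ s p W n) ≤ β) (hW : 0 < W.card) :
    ∑ S ∈ W.powersetCard q, |(∫ x, ∏ n ∈ S, ξ x n ∂μ) - ∏ n ∈ S, w n| ≤
      W.card ^ q * δ + (wbar * W.card) ^ q * (p / W.card) + V * β +
      (L ^ (2 * q) * ((2 * (2 * q : ℕ)) ^ (2 * q) + 2 ^ (2 * q) * (2 * q).factorial : ℕ) *
        (1 + (W.card ^ (2 * q) * δ + (wbar * W.card) ^ (2 * q)))) / V := by
  classical
  have hξ0 : ∀ x n, 0 ≤ ξ x n := fun x n => by rcases hξ x n with h | h <;> simp [h]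
  have hξ1 : ∀ x n, ξ x n ≤ 1 := fun x n => by rcases hξ x n with h | h <;> simp [h]
  have hprod0 : ∀ S : Finset ℕ, ∀ x, 0 ≤ ∏ n ∈ S, ξ x n := fun S x =>
    Finset.prod_nonneg fun n _ => hξ0 x n
  have hint : ∀ S : Finset ℕ, Integrable (fun x => ∏ n ∈ S, ξ x n) μ := fun S =>
    Integrable.of_bound (Finset.measurable_prod _ fun n _ => hξm n).aestronglyMeasurable 1
      (ae_of_all _ fun x => by
        rw [Real.norm_of_nonneg (hprod0 S x)]
        exact Finset.prod_le_one (fun n _ => hξ0 x n) (fun n _ => hξ1 x n))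
  have hcount : ∀ q : ℕ, (((W.powersetCard q).card : ℕ) : ℝ) ≤ W.card ^ q := by
    intro q
    rw [Finset.card_powersetCard]
    exact_mod_cast Nat.choose_le_pow _ _
  have hsepcount : ∀ q : ℕ, ((sepSets s p W q).card : ℝ) ≤ W.card ^ q := fun q =>
    le_trans (Nat.cast_le.2 (Finset.card_le_card (Finset.filter_subset _ _))) (hcount q)
  have hprodw : ∀ S ⊆ W, ∏ n ∈ S, w n ≤ wbar ^ S.card := by
    intro S hS
    calc ∏ n ∈ S, w n ≤ ∏ _n ∈ S, wbar :=
          Finset.prod_le_prod (fun n _ => hw0 n) fun n hn => hw n (hS hn)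
      _ = _ := by simp
  set c₁ : ℝ := L ^ (2 * q) *
    ((2 * (2 * q : ℕ)) ^ (2 * q) + 2 ^ (2 * q) * (2 * q).factorial : ℕ) with hc₁
  have hc0 : 0 ≤ c₁ := by positivity
  -- The sum counts the non-separated `q`-sets of hits: it vanishes unless some hit is close to the
  -- next, and is otherwise at most `Z ^ q`, with `Z` the number of hits.
  have hpt : ∀ᵐ x ∂μ, ∑ S ∈ nonsepSets s p W q, ∏ n ∈ S, ξ x n ≤
      V * (∑ n ∈ W, (closeHit ξ s p W n).indicator 1 x) +
        c₁ / V * (1 + ∑ S ∈ sepSets s p W (2 * q), ∏ n ∈ S, ξ x n) := by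
    filter_upwards [hsep] with x hx
    set H : Finset ℕ := W.filter fun n => ξ x n = 1 with hH
    have hprodH : ∀ S ⊆ W, ∏ n ∈ S, ξ x n = if S ⊆ H then 1 else 0 := by
      intro S hS
      split_ifs with h
      · exact Finset.prod_eq_one fun n hn => (Finset.mem_filter.1 (h hn)).2
      · obtain ⟨n, hnS, hnH⟩ := Finset.not_subset.1 h
        refine Finset.prod_eq_zero hnS ((hξ x n).resolve_right fun h1 => ?_)
        exact hnH (Finset.mem_filter.2 ⟨hS hnS, h1⟩)
    have hind0 : ∀ n, 0 ≤ (closeHit ξ s p W n).indicator (1 : X → ℝ) x := fun n =>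
      Set.indicator_nonneg (fun _ _ => zero_le_one) x
    have hG0 : 0 ≤ ∑ S ∈ sepSets s p W (2 * q), ∏ n ∈ S, ξ x n :=
      Finset.sum_nonneg fun S _ => hprod0 S x
    have hRHS : 0 ≤ c₁ / V * (1 + ∑ S ∈ sepSets s p W (2 * q), ∏ n ∈ S, ξ x n) := by positivity
    have hb0 : 0 ≤ ∑ n ∈ W, (closeHit ξ s p W n).indicator (1 : X → ℝ) x :=
      Finset.sum_nonneg fun n _ => hind0 n
    by_cases hex : ∃ S ∈ nonsepSets s p W q, S ⊆ H
    · obtain ⟨S, hS, hSH⟩ := hex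
      obtain ⟨⟨hSW, -⟩, hn⟩ := mem_nonsepSets.1 hS
      unfold IsSeparated at hn
      push Not at hn
      obtain ⟨n, hnS, m, hmS, hnm, hlt⟩ := hn
      have hb1 : 1 ≤ ∑ n ∈ W, (closeHit ξ s p W n).indicator (1 : X → ℝ) x := by
        have hmem : x ∈ closeHit ξ s p W n := ⟨(Finset.mem_filter.1 (hSH hnS)).2, m, hSW hmS, hnm,
          hlt, (Finset.mem_filter.1 (hSH hmS)).2⟩
        calc (1 : ℝ) = (closeHit ξ s p W n).indicator (1 : X → ℝ) x := by
              rw [Set.indicator_of_mem hmem]; rfl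
          _ ≤ _ := Finset.single_le_sum
              (f := fun n => (closeHit ξ s p W n).indicator (1 : X → ℝ) x)
              (fun n _ => hind0 n) (hSW hnS)
      have hbad : ∑ S ∈ nonsepSets s p W q, ∏ n ∈ S, ξ x n ≤ (H.card : ℝ) ^ q := by
        calc _ = ∑ S ∈ nonsepSets s p W q, if S ⊆ H then (1 : ℝ) else 0 :=
              Finset.sum_congr rfl fun S hS => hprodH S (mem_nonsepSets.1 hS).1.1
          _ = (((nonsepSets s p W q).filter fun S => S ⊆ H).card : ℝ) := by
              rw [Finset.sum_boole]
          _ ≤ ((H.powersetCard q).card : ℝ) := by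
              refine Nat.cast_le.2 (Finset.card_le_card fun S hS => ?_)
              obtain ⟨h1, h2⟩ := Finset.mem_filter.1 hS
              exact Finset.mem_powersetCard.2 ⟨h2, (mem_nonsepSets.1 h1).1.2⟩
          _ ≤ (H.card : ℝ) ^ q := by
              rw [Finset.card_powersetCard]
              exact_mod_cast Nat.choose_le_pow _ _
      have hZ : (H.card : ℝ) ^ (2 * q) ≤
          c₁ * (1 + ∑ S ∈ sepSets s p W (2 * q), ∏ n ∈ S, ξ x n) := by
        have h1 := card_pow_le_of_separated hg hL hLp (H := H) (fun n hn m hm hnm =>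
          hx n (Finset.mem_filter.1 hn).1 m (Finset.mem_filter.1 hm).1 hnm
            (Finset.mem_filter.1 hn).2 (Finset.mem_filter.1 hm).2) (2 * q)
        have h2 : ((sepSets s p H (2 * q)).card : ℝ) ≤
            ∑ S ∈ sepSets s p W (2 * q), ∏ n ∈ S, ξ x n := by
          calc ((sepSets s p H (2 * q)).card : ℝ)
              ≤ (((sepSets s p W (2 * q)).filter fun S => S ⊆ H).card : ℝ) := by
                refine Nat.cast_le.2 (Finset.card_le_card fun S hS => ?_)
                obtain ⟨⟨h3, h4⟩, h5⟩ := mem_sepSets.1 hS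
                exact Finset.mem_filter.2 ⟨mem_sepSets.2
                  ⟨⟨h3.trans (Finset.filter_subset _ _), h4⟩, h5⟩, h3⟩
            _ = ∑ S ∈ sepSets s p W (2 * q), if S ⊆ H then (1 : ℝ) else 0 := by
                rw [Finset.sum_boole]
            _ = _ := (Finset.sum_congr rfl fun S hS => hprodH S (mem_sepSets.1 hS).1.1).symm
        calc (H.card : ℝ) ^ (2 * q) ≤ c₁ * (1 + (sepSets s p H (2 * q)).card) := by
              rw [hc₁]; exact_mod_cast h1
          _ ≤ _ := by gcongr
      -- This decouples the two mechanisms: `V` is paid only on the rare event of close hits, and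
      -- the higher moment carries the small factor `1 / V`.
      have hamgm : (H.card : ℝ) ^ q ≤ V + (H.card : ℝ) ^ (2 * q) / V := by
        have h1 : (H.card : ℝ) ^ (2 * q) = (H.card ^ q) ^ 2 := by rw [← pow_mul]; ring_nf
        set a : ℝ := (H.card : ℝ) ^ q with ha
        have ha0 : 0 ≤ a := by positivity
        rw [h1, ← sub_le_iff_le_add', le_div_iff₀ hV]
        nlinarith [sq_nonneg (a - V)]
      calc _ ≤ V + (H.card : ℝ) ^ (2 * q) / V := hbad.trans hamgm
        _ ≤ V * 1 + c₁ * (1 + ∑ S ∈ sepSets s p W (2 * q), ∏ n ∈ S, ξ x n) / V := by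
            rw [mul_one]; gcongr
        _ ≤ _ := by
            rw [div_mul_eq_mul_div]
            gcongr
    · push Not at hex
      rw [Finset.sum_eq_zero fun S hS => by
        rw [hprodH S (mem_nonsepSets.1 hS).1.1, if_neg (hex S hS)]]
      positivity
  have i0 : ∀ n ∈ W, Integrable ((closeHit ξ s p W n).indicator (1 : X → ℝ)) μ := fun n _ =>
    (integrable_const (1 : ℝ)).indicator (measurableSet_closeHit hξm s p W n)
  -- Integrate the pointwise bound; the mean of the sum over separated `2 * q`-sets is estimated by
  -- `hgood`, which is why both sizes are required there.
  have hbadint : ∑ S ∈ nonsepSets s p W q, ∫ x, ∏ n ∈ S, ξ x n ∂μ ≤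
      V * β + c₁ / V * (1 + (W.card ^ (2 * q) * δ + (wbar * W.card) ^ (2 * q))) := by
    have i1 : Integrable (fun x => ∑ n ∈ W, (closeHit ξ s p W n).indicator (1 : X → ℝ) x) μ :=
      integrable_finsetSum _ i0
    have i2 : Integrable (fun x => ∑ S ∈ sepSets s p W (2 * q), ∏ n ∈ S, ξ x n) μ :=
      integrable_finsetSum _ fun S _ => hint S
    have i3 : Integrable (fun x => 1 + ∑ S ∈ sepSets s p W (2 * q), ∏ n ∈ S, ξ x n) μ :=
      (integrable_const (1 : ℝ)).add i2
    rw [← integral_finsetSum _ fun S _ => hint S]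
    refine (integral_mono_ae (integrable_finsetSum _ fun S _ => hint S)
      ((i1.const_mul V).add (i3.const_mul (c₁ / V))) hpt).trans ?_
    have e : ∫ x, (V * (∑ n ∈ W, (closeHit ξ s p W n).indicator (1 : X → ℝ) x) +
        c₁ / V * (1 + ∑ S ∈ sepSets s p W (2 * q), ∏ n ∈ S, ξ x n)) ∂μ =
        V * ∑ n ∈ W, μ.real (closeHit ξ s p W n) +
        c₁ / V * (1 + ∑ S ∈ sepSets s p W (2 * q), ∫ x, ∏ n ∈ S, ξ x n ∂μ) := by
      rw [integral_add (i1.const_mul V) (i3.const_mul (c₁ / V)), integral_const_mul,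
        integral_const_mul, integral_add (integrable_const _) i2,
        integral_finsetSum _ fun S _ => hint S, integral_finsetSum _ i0]
      simp only [integral_const, probReal_univ, smul_eq_mul, one_mul]
      congr 2
      exact Finset.sum_congr rfl fun n _ =>
        integral_indicator_one (measurableSet_closeHit hξm s p W n)
    refine e.le.trans ?_
    have h1 : ∑ S ∈ sepSets s p W (2 * q), ∫ x, ∏ n ∈ S, ξ x n ∂μ ≤
        W.card ^ (2 * q) * δ + (wbar * W.card) ^ (2 * q) := by
      calc _ ≤ ∑ _S ∈ sepSets s p W (2 * q), (δ + wbar ^ (2 * q)) := by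
            refine Finset.sum_le_sum fun S hS => ?_
            obtain ⟨⟨h1, h2⟩, h3⟩ := mem_sepSets.1 hS
            have h4 := (abs_le.1 (hgood S h1 h3 (Or.inr h2))).2
            have h5 := hprodw S h1
            rw [h2] at h5
            linarith
        _ = (sepSets s p W (2 * q)).card * (δ + wbar ^ (2 * q)) := by
            rw [Finset.sum_const, nsmul_eq_mul]
        _ ≤ W.card ^ (2 * q) * (δ + wbar ^ (2 * q)) := by
            have := hsepcount (2 * q)
            gcongr
        _ = _ := by rw [mul_pow]; ring
    gcongr
  have hbadw : ∑ S ∈ nonsepSets s p W q, ∏ n ∈ S, w n ≤ (wbar * W.card) ^ q * (p / W.card) := by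
    have hW' : (0 : ℝ) < W.card := by exact_mod_cast hW
    have h1 : ((nonsepSets s p W q).card : ℝ) ≤ p * W.card ^ q / W.card := by
      rw [le_div_iff₀ hW']
      exact_mod_cast card_nonsepSets_mul_le hs W q
    calc _ ≤ ∑ _S ∈ nonsepSets s p W q, wbar ^ q := by
          refine Finset.sum_le_sum fun S hS => ?_
          obtain ⟨⟨h1, h2⟩, -⟩ := mem_nonsepSets.1 hS
          rw [← h2]; exact hprodw S h1
      _ = (nonsepSets s p W q).card * wbar ^ q := by rw [Finset.sum_const, nsmul_eq_mul]
      _ ≤ p * W.card ^ q / W.card * wbar ^ q := by gcongr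
      _ = _ := by rw [mul_pow]; ring
  have hgoodsum : ∑ S ∈ sepSets s p W q, |(∫ x, ∏ n ∈ S, ξ x n ∂μ) - ∏ n ∈ S, w n| ≤
      W.card ^ q * δ := by
    calc _ ≤ ∑ _S ∈ sepSets s p W q, δ := by
          refine Finset.sum_le_sum fun S hS => ?_
          obtain ⟨⟨h1, h2⟩, h3⟩ := mem_sepSets.1 hS
          exact hgood S h1 h3 (Or.inl h2)
      _ = (sepSets s p W q).card * δ := by rw [Finset.sum_const, nsmul_eq_mul]
      _ ≤ _ := by
          have := hsepcount q
          gcongr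
  have hbadsum : ∑ S ∈ nonsepSets s p W q, |(∫ x, ∏ n ∈ S, ξ x n ∂μ) - ∏ n ∈ S, w n| ≤
      ∑ S ∈ nonsepSets s p W q, ∫ x, ∏ n ∈ S, ξ x n ∂μ +
        ∑ S ∈ nonsepSets s p W q, ∏ n ∈ S, w n := by
    rw [← Finset.sum_add_distrib]
    refine Finset.sum_le_sum fun S _ => ?_
    have h1 : 0 ≤ ∫ x, ∏ n ∈ S, ξ x n ∂μ := integral_nonneg (hprod0 S)
    have h2 : 0 ≤ ∏ n ∈ S, w n := Finset.prod_nonneg fun n _ => hw0 n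
    rw [abs_le]; constructor <;> linarith
  rw [sum_sepSets_add_sum_nonsepSets (s := s) (p := p)]
  rw [mul_div_right_comm]
  linarith

end MomentBound

/-! ### Consequences of the three return conditions -/

section Delays

lemma delaySum_succ (α : ℕ → ℕ) (n : ℕ) : delaySum α (n + 1) = delaySum α n + α (n + 1) :=
  Finset.sum_Icc_succ_top (by omega) _

lemma strictMono_delaySum {α : ℕ → ℕ} (hα : ∀ n, 1 ≤ n → 1 ≤ α n) : StrictMono (delaySum α) :=
  strictMono_nat_of_lt_succ fun n => by
    have := hα (n + 1) (by omega)
    rw [delaySum_succ]; omega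

/-- From index `n ≥ 1` to a later one at least one delay of index `≥ 2` is added; the first delay is
never involved. -/
lemma delaySum_add_minDelay_le {α : ℕ → ℕ} (hα : ∀ n, 1 ≤ n → 1 ≤ α n) {n m : ℕ} (hn : 1 ≤ n)
    (hnm : n < m) : delaySum α n + minDelay α ≤ delaySum α m := by
  obtain ⟨m, rfl⟩ : ∃ m', m = m' + 1 := ⟨m - 1, by omega⟩
  have h1 : minDelay α ≤ α (m + 1) := Nat.sInf_le ⟨m + 1, by simp; omega, rfl⟩
  have h2 := (strictMono_delaySum hα).monotone (by omega : n ≤ m)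
  rw [delaySum_succ]
  omega

end Delays

section Returns

variable {X Y : Type*} {K : ℕ} {T : Y → X → X} {R : Y → Y} {A : Fin K → Set X} {κ : ℕ → Fin K}
  {α : ℕ → ℕ} {y : Y} {x : X}

/-- Two hits, of whatever types, form a return to the union, seen from the fibre at the time of the
first one; hence return conditions in all fibres along the orbit of `y`. -/
lemma fiberReturn_le_of_isHit {n m : ℕ} (hnm : delaySum α n < delaySum α m)
    (hm : IsHit T R A κ α y x m) :
    fiberReturn T R (⋃ k, A k) (R^[delaySum α n] y) (fiberIter T R y (delaySum α n) x) ≤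
      ((delaySum α m - delaySum α n : ℕ) : ℕ∞) := by
  refine iInf₂_le _ ⟨by omega, ?_⟩
  rw [← fiberIter_add, Nat.add_sub_cancel' hnm.le]
  exact Set.mem_iUnion.2 ⟨_, hm⟩

lemma isHit_of_hitInd_eq_one {n : ℕ} (h : hitInd T R A κ α y x n = 1) : IsHit T R A κ α y x n := by
  by_contra hn
  rw [hitInd_of_not_isHit hn] at h
  exact zero_ne_one h

lemma hitInd_eq_zero_or_one (x : X) (n : ℕ) :
    hitInd T R A κ α y x n = 0 ∨ hitInd T R A κ α y x n = 1 := by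
  by_cases h : IsHit T R A κ α y x n
  · exact Or.inr (hitInd_of_isHit h)
  · exact Or.inl (hitInd_of_not_isHit h)

variable [MeasurableSpace X] {μ : Measure X}

lemma absLogMeas_nonneg (μ : Measure X) (A : ℕ → Set X) (l : ℕ) : 0 ≤ absLogMeas μ A l :=
  abs_nonneg _

lemma integral_prod_hitInd (hT : ∀ y, MeasurePreserving (T y) μ μ)
    (hA : ∀ k, MeasurableSet (A k)) (S : Finset ℕ) :
    ∫ x, ∏ n ∈ S, hitInd T R A κ α y x n ∂μ = μ.real {x | ∀ n ∈ S, IsHit T R A κ α y x n} := by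
  have hm : MeasurableSet {x | ∀ n ∈ S, IsHit T R A κ α y x n} := by
    have : {x | ∀ n ∈ S, IsHit T R A κ α y x n} = ⋂ n ∈ S, {x | IsHit T R A κ α y x n} := by
      ext x; simp
    rw [this]
    exact Finset.measurableSet_biInter _ fun n _ => measurableSet_isHit hT hA n
  rw [← integral_indicator_one hm]
  refine integral_congr_ae (ae_of_all _ fun x => ?_)
  dsimp only
  by_cases h : ∀ n ∈ S, IsHit T R A κ α y x n
  · rw [Set.indicator_of_mem (show x ∈ {x | ∀ n ∈ S, IsHit T R A κ α y x n} from h)]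
    exact Finset.prod_eq_one fun n hn => hitInd_of_isHit (h n hn)
  · rw [Set.indicator_of_notMem (show x ∉ {x | ∀ n ∈ S, IsHit T R A κ α y x n} from h)]
    push Not at h
    obtain ⟨n, hn, hh⟩ := h
    exact Finset.prod_eq_zero hn (hitInd_of_not_isHit hh)

lemma measurable_hitInd (hT : ∀ y, MeasurePreserving (T y) μ μ)
    (hA : ∀ k, MeasurableSet (A k)) (n : ℕ) : Measurable fun x => hitInd T R A κ α y x n := by
  classical
  exact Measurable.ite (measurableSet_isHit hT hA n) measurable_const measurable_const

end Returns

section Conditions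

variable {X Y : Type*} [MeasurableSpace X] {μ : Measure X} {K : ℕ}
  {T : Y → X → X} {R : Y → Y} {A : ℕ → Fin K → Set X} {κ : ℕ → ℕ → Fin K} {α : ℕ → ℕ → ℕ} {y : Y}

/-- Under each of the three conditions, hits are separated on the logarithmic scale. -/
lemma exists_hits_separated (hT : ∀ y, MeasurePreserving (T y) μ μ)
    (hα : ∀ l n, 1 ≤ n → 1 ≤ α l n)
    (hcond : (absLogMeas μ (fun l => ⋃ k, A l k) =O[atTop] (fun l => (minDelay (α l) : ℝ))) ∨
      ReturnsLogLarge μ T R y (fun l => ⋃ k, A l k)) :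
    ∃ c : ℝ, 0 < c ∧ ∀ᶠ l in atTop, ∀ᵐ x ∂μ, ∀ n m : ℕ, 1 ≤ n → n < m →
      IsHit T R (A l) (κ l) (α l) y x n → IsHit T R (A l) (κ l) (α l) y x m →
      (delaySum (α l) n : ℝ) + c * absLogMeas μ (fun l => ⋃ k, A l k) l ≤ delaySum (α l) m := by
  rcases hcond with h | ⟨c, hc, h⟩
  · obtain ⟨C, hC, hb⟩ := h.exists_pos
    refine ⟨C⁻¹, inv_pos.2 hC, ?_⟩
    filter_upwards [hb.bound] with l hl
    refine ae_of_all _ fun x n m hn hnm _ _ => ?_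
    have h1 : (delaySum (α l) n : ℝ) + minDelay (α l) ≤ delaySum (α l) m := by
      exact_mod_cast delaySum_add_minDelay_le (hα l) hn hnm
    rw [Real.norm_of_nonneg (absLogMeas_nonneg _ _ _), Real.norm_of_nonneg (Nat.cast_nonneg _)] at hl
    have h2 : C⁻¹ * absLogMeas μ (fun l => ⋃ k, A l k) l ≤ minDelay (α l) := by
      rw [inv_mul_le_iff₀ hC]; exact hl
    linarith
  · refine ⟨c, hc, Eventually.of_forall fun l => ?_⟩
    -- Invariance of `μ` transports the almost sure lower bound to the point reached at each of the
    -- countably many times.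
    have h1 : ∀ᵐ x ∂μ, ∀ n : ℕ, fiberIter T R y (delaySum (α l) n) x ∈ (⋃ k, A l k) →
        ENNReal.ofReal (c * absLogMeas μ (fun l => ⋃ k, A l k) l) ≤
          (fiberReturn T R (⋃ k, A l k) (R^[delaySum (α l) n] y)
            (fiberIter T R y (delaySum (α l) n) x) : ℝ≥0∞) := by
      rw [ae_all_iff]
      exact fun n => (measurePreserving_fiberIter hT y _).quasiMeasurePreserving.ae
        (h l (delaySum (α l) n))
    filter_upwards [h1] with x hx n m _ hnm hhn hhm
    have hlt := strictMono_delaySum (hα l) hnm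
    have h2 := hx n (Set.mem_iUnion.2 ⟨_, hhn⟩)
    have h3 : (fiberReturn T R (⋃ k, A l k) (R^[delaySum (α l) n] y)
        (fiberIter T R y (delaySum (α l) n) x) : ℝ≥0∞) ≤
        ((delaySum (α l) m - delaySum (α l) n : ℕ) : ℝ≥0∞) := by
      have := ENat.toENNReal_le.2 (fiberReturn_le_of_isHit (A := A l) (κ := κ l) hlt hhm)
      simpa using this
    have h4 := h2.trans h3
    rw [← ENNReal.ofReal_natCast, ENNReal.ofReal_le_ofReal_iff (Nat.cast_nonneg _),
      Nat.cast_sub hlt.le] at h4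
    linarith

/-- Under each of the three conditions, close hits are rare. -/
lemma exists_closeHit_rare [IsProbabilityMeasure μ] (hT : ∀ y, MeasurePreserving (T y) μ μ)
    (hA : ∀ l k, MeasurableSet (A l k)) (hα : ∀ l n, 1 ≤ n → 1 ≤ α l n)
    (hcond : (absLogMeas μ (fun l => ⋃ k, A l k) =o[atTop] (fun l => (minDelay (α l) : ℝ))) ∨
      ShortReturnsRare μ T R y (fun l => ⋃ k, A l k)) {M : ℝ} (hM : 0 < M) :
    ∃ e : ℕ → ℝ, Tendsto e atTop (𝓝 0) ∧ (∀ l, 0 ≤ e l) ∧ ∀ᶠ l in atTop, ∀ p : ℕ,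
      p ≤ M * absLogMeas μ (fun l => ⋃ k, A l k) l → ∀ (W : Finset ℕ) (n : ℕ), 1 ≤ n →
      μ.real (closeHit (fun x => hitInd T R (A l) (κ l) (α l) y x) (delaySum (α l)) p W n) ≤
        e l * μ.real (⋃ k, A l k) := by
  rcases hcond with h | ⟨a, ha, hrare⟩
  · refine ⟨fun _ => 0, tendsto_const_nhds, fun _ => le_rfl, ?_⟩
    filter_upwards [h.def (inv_pos.2 hM)] with l hl p hp W n hn
    rw [Real.norm_of_nonneg (absLogMeas_nonneg _ _ _), Real.norm_of_nonneg (Nat.cast_nonneg _),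
      inv_mul_eq_div, le_div_iff₀' hM] at hl
    -- When the delays dominate the logarithm, the window `p` is too short to contain two of the
    -- times, so close hits do not occur.
    have hpm : p ≤ minDelay (α l) := by exact_mod_cast hp.trans hl
    have : closeHit (fun x => hitInd T R (A l) (κ l) (α l) y x) (delaySum (α l)) p W n = ∅ := by
      refine Set.eq_empty_of_forall_notMem ?_
      rintro x ⟨-, m, -, hnm, hlt, -⟩
      have := delaySum_add_minDelay_le (hα l) hn hnm
      omega
    rw [this]
    simp
  · set e : ℕ → ℝ≥0∞ := fun l => ⨆ n : ℕ,
      μ[{x | (fiberReturn T R (⋃ k, A l k) (R^[n] y) x : ℝ≥0∞) ≤ (a l : ℝ≥0∞)} | ⋃ k, A l k] with he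
    refine ⟨fun l => (e l).toReal, ?_, fun l => ENNReal.toReal_nonneg, ?_⟩
    · have h := (ENNReal.tendsto_toReal ENNReal.zero_ne_top).comp hrare
      rwa [ENNReal.toReal_zero] at h
    filter_upwards [ha.def (inv_pos.2 hM), hrare.eventually_lt_const ENNReal.zero_lt_top]
      with l hl hfin p hp W n hn
    rw [Real.norm_of_nonneg (absLogMeas_nonneg _ _ _), Real.norm_of_nonneg (NNReal.coe_nonneg _),
      inv_mul_eq_div, le_div_iff₀' hM] at hl
    have hpa : (p : ℝ) ≤ a l := hp.trans hl
    have hUm : MeasurableSet (⋃ k, A l k) := MeasurableSet.iUnion (hA l)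
    set F : Set X := {x | (fiberReturn T R (⋃ k, A l k) (R^[delaySum (α l) n] y) x : ℝ≥0∞) ≤
      (a l : ℝ≥0∞)} with hF
    -- A close hit puts the orbit, at the time of the first hit, in the part of the union with
    -- return time less than `p ≤ a l`; by invariance its probability is at most `e l * μ(A_l)`.
    have hsub : closeHit (fun x => hitInd T R (A l) (κ l) (α l) y x) (delaySum (α l)) p W n ⊆
        fiberIter T R y (delaySum (α l) n) ⁻¹' ((⋃ k, A l k) ∩ F) := by
      rintro x ⟨h1, m, -, hnm, hlt, h2⟩
      refine ⟨Set.mem_iUnion.2 ⟨_, isHit_of_hitInd_eq_one h1⟩, ?_⟩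
      have hlt' := strictMono_delaySum (hα l) hnm
      have h3 := ENat.toENNReal_le.2
        (fiberReturn_le_of_isHit (A := A l) (κ := κ l) hlt' (isHit_of_hitInd_eq_one h2))
      refine h3.trans ?_
      have h4 : ((delaySum (α l) m - delaySum (α l) n : ℕ) : ℝ) ≤ a l :=
        le_trans (Nat.cast_le.2 (by omega)) hpa
      have h5 : ((delaySum (α l) m - delaySum (α l) n : ℕ) : ℝ≥0) ≤ a l := by exact_mod_cast h4
      rw [ENat.toENNReal_coe]
      exact_mod_cast ENNReal.coe_le_coe.2 h5
    have hmeasle : μ ((⋃ k, A l k) ∩ F) ≤ e l * μ (⋃ k, A l k) := by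
      rw [← cond_mul_eq_inter hUm F μ]
      gcongr
      exact le_iSup (fun n : ℕ => μ[{x | (fiberReturn T R (⋃ k, A l k) (R^[n] y) x : ℝ≥0∞) ≤
        (a l : ℝ≥0∞)} | ⋃ k, A l k]) (delaySum (α l) n)
    have h1 : μ (closeHit (fun x => hitInd T R (A l) (κ l) (α l) y x) (delaySum (α l)) p W n) ≤
        e l * μ (⋃ k, A l k) := by
      refine (measure_mono hsub).trans (le_trans ?_ hmeasle)
      exact (measurePreserving_fiberIter hT y _).measure_preimage_le _
    rw [measureReal_def, measureReal_def, ← ENNReal.toReal_mul]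
    exact ENNReal.toReal_mono (ENNReal.mul_ne_top hfin.ne (measure_ne_top _ _)) h1

end Conditions

/-! ### Convergence of the moments -/

section Moments

variable {X Y : Type*} [MeasurableSpace X] {μ : Measure X} {K : ℕ}
  {T : Y → X → X} {R : Y → Y} {y : Y}

/-- Mixing estimates indexed by increasing families, rewritten for separated finite sets. -/
lemma abs_integral_prod_hitInd_sub_le {A : Fin K → Set X} {κ : ℕ → Fin K} {α : ℕ → ℕ}
    (hT : ∀ y, MeasurePreserving (T y) μ μ) (hA : ∀ k, MeasurableSet (A k))
    (hα : ∀ n, 1 ≤ n → 1 ≤ α n) {q p : ℕ} {D : ℝ}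
    (hmix : ∀ (κ : Fin q → Fin K) (k : Fin q → ℕ), Monotone k → (∀ i j, i < j → k i + p ≤ k j) →
      |μ.real {x | ∀ j, fiberIter T R y (k j) x ∈ A (κ j)} - ∏ j, μ.real (A (κ j))| ≤ D)
    {S : Finset ℕ} (hS : S.card = q) (hsep : IsSeparated (delaySum α) p S) :
    |(∫ x, ∏ n ∈ S, hitInd T R A κ α y x n ∂μ) - ∏ n ∈ S, μ.real (A (κ n))| ≤ D := by
  rw [integral_prod_hitInd hT hA]
  have h := hmix (fun j => κ (S.orderEmbOfFin hS j)) (fun j => delaySum α (S.orderEmbOfFin hS j))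
    ((strictMono_delaySum hα).monotone.comp (S.orderEmbOfFin hS).monotone)
    (fun i j hij => hsep _ (S.orderEmbOfFin_mem hS i) _ (S.orderEmbOfFin_mem hS j)
      ((S.orderEmbOfFin hS).strictMono hij))
  have e1 : {x | ∀ n ∈ S, IsHit T R A κ α y x n} =
      {x | ∀ j : Fin q, fiberIter T R y (delaySum α (S.orderEmbOfFin hS j)) x ∈
        A (κ (S.orderEmbOfFin hS j))} := by
    ext x
    refine ⟨fun hx j => hx _ (S.orderEmbOfFin_mem hS j), fun hx n hn => ?_⟩
    have : n ∈ Set.range (S.orderEmbOfFin hS) := by rw [Finset.range_orderEmbOfFin]; exact hn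
    obtain ⟨j, rfl⟩ := this
    exact hx j
  have e2 : ∏ n ∈ S, μ.real (A (κ n)) = ∏ j : Fin q, μ.real (A (κ (S.orderEmbOfFin hS j))) := by
    conv_lhs => rw [← Finset.map_orderEmbOfFin_univ S hS]
    rw [Finset.prod_map]
    rfl
  rw [e1, e2]
  exact h

/-- Substitutes `n ≈ τ / u`, where `n` is the number of indices. The mixing exponent `2 * d * q + 2`
is chosen so that even `n ^ (2 * q)` sets leave a factor `ρ ^ 2`; the window `p = O(Λ)` gives `Λ *
u`. -/
lemma moment_bound_le {q d : ℕ} {n u ρ C C' τ p B Λ V e E : ℝ} (hn1 : 1 ≤ n) (hρ : 0 < ρ)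
    (hu : u = ρ ^ d) (hC : 0 < C) (hC' : 0 < C') (hτ : 0 < τ) (hnu : n * u ≤ τ)
    (hun : τ ≤ 2 * u * n) (hp0 : 0 ≤ p) (hp : p ≤ B * Λ) (hV : 0 < V) (he : 0 ≤ e) (hE : 0 ≤ E) :
    n ^ q * (C' * ρ ^ (2 * d * q + 2)) + (C * u * n) ^ q * (p / n) + V * (n * (e * (C * u))) +
        E * (1 + (n ^ (2 * q) * (C' * ρ ^ (2 * d * q + 2)) + (C * u * n) ^ (2 * q))) / V ≤
      C' * τ ^ (2 * q) * ρ ^ 2 + (C * τ) ^ q * (2 * B / τ) * (Λ * u) + V * C * τ * e +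
        E * (1 + (C' * τ ^ (2 * q) * ρ ^ 2 + (C * τ) ^ (2 * q))) / V := by
  have hu0 : 0 < u := by rw [hu]; positivity
  have hn0 : 0 < n := by linarith
  have e1 : n ^ (2 * q) * (C' * ρ ^ (2 * d * q + 2)) = C' * (n * u) ^ (2 * q) * ρ ^ 2 := by
    have : ρ ^ (2 * d * q + 2) = u ^ (2 * q) * ρ ^ 2 := by
      rw [hu, ← pow_mul, pow_add]; congr 2; ring
    rw [this, mul_pow]; ring
  have h1 : n ^ (2 * q) * (C' * ρ ^ (2 * d * q + 2)) ≤ C' * τ ^ (2 * q) * ρ ^ 2 := by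
    rw [e1]; gcongr
  have h2 : n ^ q * (C' * ρ ^ (2 * d * q + 2)) ≤ C' * τ ^ (2 * q) * ρ ^ 2 :=
    le_trans (by gcongr; omega) h1
  have h3 : C * u * n ≤ C * τ := by
    calc C * u * n = C * (n * u) := by ring
      _ ≤ C * τ := by gcongr
  have h4 : p / n ≤ 2 * B / τ * (Λ * u) := by
    rw [div_mul_eq_mul_div, div_le_div_iff₀ hn0 hτ]
    calc p * τ ≤ B * Λ * (2 * u * n) := mul_le_mul hp hun hτ.le (hp0.trans hp)
      _ = _ := by ring
  have h5 : V * (n * (e * (C * u))) ≤ V * C * τ * e := by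
    calc V * (n * (e * (C * u))) = V * C * (n * u) * e := by ring
      _ ≤ _ := by gcongr
  have h6 : (C * u * n) ^ q * (p / n) ≤ (C * τ) ^ q * (2 * B / τ) * (Λ * u) := by
    rw [mul_assoc ((C * τ) ^ q)]
    exact mul_le_mul (by gcongr) h4 (by positivity) (by positivity)
  have h7 : (C * u * n) ^ (2 * q) ≤ (C * τ) ^ (2 * q) := by gcongr
  gcongr

end Moments

section MomentConvergence

variable {d : ℕ} {r : ℝ} {X Y : Type*} [TopologicalSpace X]
  [ChartedSpace (EuclideanSpace ℝ (Fin d)) X] [MeasurableSpace X] [BorelSpace X]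

/-- The mixed moments of the hits are asymptotically those of independent events. -/
lemma tendsto_sum_abs_moment_sub (hd : 1 ≤ d) (hr : 0 < r) (N : BallCover d r X) (μ : Measure X)
    [IsProbabilityMeasure μ] {T : Y → X → X} {R : Y → Y}
    (hT : ∀ y, MeasurePreserving (T y) μ μ) {y : Y} (hy : ExpMixingAt N μ T R y)
    {K : ℕ} {A : ℕ → Fin K → Set X} {ρ : ℕ → ℝ}
    (hA : RegApproxFamily N μ (fun q : ℕ × Fin K => A q.1 q.2))
    (hρ : ∀ l, 0 < ρ l) (hρ0 : Tendsto ρ atTop (𝓝 0)) {c C : ℝ} (hc : 0 < c) (hC : 0 < C)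
    (hm : ∀ᶠ l in atTop, (∀ k, c * ρ l ^ d ≤ μ.real (A l k) ∧ μ.real (A l k) ≤ C * ρ l ^ d) ∧
      c * ρ l ^ d ≤ μ.real (⋃ k, A l k) ∧ μ.real (⋃ k, A l k) ≤ C * ρ l ^ d)
    {κ : ℕ → ℕ → Fin K} {α : ℕ → ℕ → ℕ} (hα : ∀ l n, 1 ≤ n → 1 ≤ α l n)
    (hsep : (absLogMeas μ (fun l => ⋃ k, A l k) =O[atTop] (fun l => (minDelay (α l) : ℝ))) ∨
      ReturnsLogLarge μ T R y (fun l => ⋃ k, A l k))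
    (hrare : (absLogMeas μ (fun l => ⋃ k, A l k) =o[atTop] (fun l => (minDelay (α l) : ℝ))) ∨
      ShortReturnsRare μ T R y (fun l => ⋃ k, A l k))
    (q : ℕ) {τ : ℝ} (hτ : 0 < τ) :
    Tendsto (fun l => ∑ S ∈ (Finset.Ioc 0 ⌊τ / ρ l ^ d⌋₊).powersetCard q,
      |(∫ x, ∏ n ∈ S, hitInd T R (A l) (κ l) (α l) y x n ∂μ) - ∏ n ∈ S, μ.real (A l (κ l n))|)
      atTop (𝓝 0) := by
  have hAm : ∀ l k, MeasurableSet (A l k) := fun l k => by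
    obtain ⟨_, _, h⟩ := hA
    exact (h (l, k)).1
  set Λ : ℕ → ℝ := absLogMeas μ (fun l => ⋃ k, A l k) with hΛ
  obtain ⟨hΛtop, hΛu⟩ := tendsto_absLogMeas (μ := μ) hd hc hρ hρ0 (hm.mono fun l hl => hl.2)
  -- Mixing is needed for the moments of order `q` themselves, and for order `2 * q` to control the
  -- second moment of the number of non-separated sets.
  obtain ⟨M₁, C₁, hM₁, hC₁, hmix₁⟩ :=
    exists_mixing_rate hd hr N μ hT hy hA hρ hρ0 hc hC hm q (2 * d * q + 2) (by omega)
  obtain ⟨M₂, C₂, hM₂, hC₂, hmix₂⟩ :=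
    exists_mixing_rate hd hr N μ hT hy hA hρ hρ0 hc hC hm (2 * q) (2 * d * q + 2) (by omega)
  set M : ℝ := max M₁ M₂ with hMdef
  have hM : 0 < M := lt_max_of_lt_left hM₁
  set C' : ℝ := C₁ + C₂ with hC'def
  have hC' : 0 < C' := by positivity
  obtain ⟨g, hg, hsep⟩ := exists_hits_separated (κ := κ) hT hα hsep
  obtain ⟨e, he0, hepos, hclose⟩ :=
    exists_closeHit_rare (κ := κ) hT hAm hα hrare (M := M + 1) (by positivity)
  -- The ratio of the mixing window to the guaranteed spacing of hits. Both are of order `Λ`, so it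
  -- does not depend on `l`.
  set L : ℕ := ⌈(M + 1) / g⌉₊ + 1 with hL
  set E : ℝ := ((L ^ (2 * q) * ((2 * (2 * q : ℕ)) ^ (2 * q) + 2 ^ (2 * q) * (2 * q).factorial : ℕ)
    : ℕ) : ℝ) with hE
  have hE0 : 0 ≤ E := Nat.cast_nonneg _
  have hu0 : Tendsto (fun l => ρ l ^ d) atTop (𝓝 0) := by
    have := hρ0.pow d
    rwa [zero_pow (by omega)] at this
  rw [Metric.tendsto_nhds]
  intro ε hε
  -- `V` is fixed before `l → ∞`, large enough that the one term which does not tend to `0` with `l`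
  -- stays below `ε`.
  obtain ⟨V, hV, hVε⟩ : ∃ V : ℝ, 0 < V ∧ E * (1 + (0 + (C * τ) ^ (2 * q))) / V < ε := by
    refine ⟨(E * (1 + (0 + (C * τ) ^ (2 * q))) + 1) / ε, by positivity, ?_⟩
    rw [div_lt_iff₀ (by positivity)]
    field_simp
    linarith
  have hlim : Tendsto (fun l => C' * τ ^ (2 * q) * ρ l ^ 2 +
      (C * τ) ^ q * (2 * (M + 1) / τ) * (Λ l * ρ l ^ d) + V * C * τ * e l +
        E * (1 + (C' * τ ^ (2 * q) * ρ l ^ 2 + (C * τ) ^ (2 * q))) / V) atTop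
      (𝓝 (C' * τ ^ (2 * q) * 0 ^ 2 + (C * τ) ^ q * (2 * (M + 1) / τ) * 0 + V * C * τ * 0 +
        E * (1 + (C' * τ ^ (2 * q) * 0 ^ 2 + (C * τ) ^ (2 * q))) / V)) := by
    have h2 := (hρ0.pow 2).const_mul (C' * τ ^ (2 * q))
    exact ((h2.add (hΛu.const_mul _)).add (he0.const_mul _)).add
      ((((h2.add_const _).const_add _).const_mul _).div_const _)
  have hlt := hlim.eventually_lt_const (u := ε) (by simpa using hVε)
  filter_upwards [hlt, hm, hmix₁, hmix₂, hsep, hclose, hΛtop.eventually_ge_atTop 1,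
    hu0.eventually_le_const (half_pos hτ)] with l hlt hm hmix₁ hmix₂ hsep hclose hΛ1 hul
  have hu : 0 < ρ l ^ d := pow_pos (hρ l) d
  set W : Finset ℕ := Finset.Ioc 0 ⌊τ / ρ l ^ d⌋₊ with hW
  have hcard : W.card = ⌊τ / ρ l ^ d⌋₊ := by simp [hW]
  have hfl : (W.card : ℝ) ≤ τ / ρ l ^ d := by
    rw [hcard]; exact Nat.floor_le (by positivity)
  have hfl2 : τ / ρ l ^ d < W.card + 1 := by
    rw [hcard]; exact Nat.lt_floor_add_one _
  have hnu : (W.card : ℝ) * ρ l ^ d ≤ τ := by rwa [le_div_iff₀ hu] at hfl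
  have hlt2 : τ < (W.card + 1) * ρ l ^ d := by rwa [div_lt_iff₀ hu] at hfl2
  have hun : τ ≤ 2 * ρ l ^ d * W.card := by linarith
  have hcard1 : 1 ≤ W.card := by
    rcases Nat.eq_zero_or_pos W.card with h | h
    · rw [h] at hun; simp at hun; linarith
    · exact h
  -- Rounding up costs at most `Λ l`, because `Λ l ≥ 1` eventually; hence `M + 1` in the rarity of
  -- close hits and in `L`.
  set p : ℕ := ⌈M * Λ l⌉₊ with hp
  have hMΛ : 0 ≤ M * Λ l := by positivity
  have hp1 : M * Λ l ≤ p := Nat.le_ceil _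
  have hp2 : (p : ℝ) ≤ (M + 1) * Λ l := by
    have := (Nat.ceil_lt_add_one hMΛ).le
    linarith
  have hLp : (p : ℝ) ≤ ((L : ℝ) - 1) * (g * Λ l) := by
    have h1 : (M + 1) / g ≤ (L : ℝ) - 1 := by
      rw [hL]; push_cast; linarith [Nat.le_ceil ((M + 1) / g)]
    have h2 : M + 1 ≤ ((L : ℝ) - 1) * g := by rwa [div_le_iff₀ hg] at h1
    calc (p : ℝ) ≤ (M + 1) * Λ l := hp2
      _ ≤ ((L : ℝ) - 1) * g * Λ l := by gcongr
      _ = _ := by ring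
  have hρQ : 0 < ρ l ^ (2 * d * q + 2) := pow_pos (hρ l) _
  have hbound := sum_abs_moment_sub_le (μ := μ) (ξ := fun x => hitInd T R (A l) (κ l) (α l) y x)
    (fun n => measurable_hitInd hT (hAm l) n) (fun x n => hitInd_eq_zero_or_one x n)
    (w := fun n => μ.real (A l (κ l n))) (wbar := C * ρ l ^ d) (W := W) (p := p)
    (strictMono_delaySum (hα l)) (fun _ => measureReal_nonneg) (fun n _ => (hm.1 _).2)
    (by positivity) (g := g * Λ l) (δ := C' * ρ l ^ (2 * d * q + 2))
    (β := W.card * (e l * (C * ρ l ^ d))) (V := V) (by positivity) (L := L) (by omega) hLp hV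
    (by positivity) q ?_ ?_ ?_ (by omega)
  · have hfinal := hbound.trans ((le_of_eq ?_).trans
      (moment_bound_le (q := q) (E := E) (Nat.one_le_cast.2 hcard1) (hρ l) rfl hC hC' hτ hnu hun
        (Nat.cast_nonneg p) hp2 hV (hepos l) hE0))
    · rw [Real.dist_eq, sub_zero, abs_of_nonneg (Finset.sum_nonneg fun _ _ => abs_nonneg _)]
      exact hfinal.trans_lt hlt
    · rw [hE]
      push_cast
      ring
  · intro S hSW hS hSq
    rcases hSq with hSq | hSq
    · refine (abs_integral_prod_hitInd_sub_le hT (hAm l) (hα l) (hmix₁ p (le_trans ?_ hp1))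
        hSq hS).trans ?_
      · gcongr; exact le_max_left _ _
      · gcongr; linarith
    · refine (abs_integral_prod_hitInd_sub_le hT (hAm l) (hα l) (hmix₂ p (le_trans ?_ hp1))
        hSq hS).trans ?_
      · gcongr; exact le_max_right _ _
      · gcongr; linarith
  · filter_upwards [hsep] with x hx n hn m _ hnm h1 h2
    exact hx n m (Finset.mem_Ioc.1 hn).1 hnm (isHit_of_hitInd_eq_one h1)
      (isHit_of_hitInd_eq_one h2)
  · refine (Finset.sum_le_card_nsmul W _ (e l * (C * ρ l ^ d)) fun n hn => ?_).trans
      (by rw [nsmul_eq_mul])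
    refine (hclose p hp2 W n (Finset.mem_Ioc.1 hn).1).trans ?_
    gcongr
    · exact hepos l
    · exact hm.2.2

end MomentConvergence

/-! ### Total intensity of the hits -/

section Intensities

variable {X : Type*} [MeasurableSpace X] {μ : Measure X} {K : ℕ}

/-- Group the indices by type: each type contributes its measure, its frequency and the number of
indices, and `ρ ^ d` cancels between the first and the last. -/
lemma tendsto_sum_measureReal {d : ℕ} (hd : 1 ≤ d) {A : ℕ → Fin K → Set X} {ω p : Fin K → ℝ}
    {ρ : ℕ → ℝ} (hρ : ∀ l, 0 < ρ l) (hρ0 : Tendsto ρ atTop (𝓝 0))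
    (hmeas : ∀ k, (fun l => μ.real (A l k) - ω k * ρ l ^ d) =o[atTop] (fun l => ρ l ^ d))
    {κ : ℕ → ℕ → Fin K} {τ : ℝ} (hτ : 0 < τ)
    (hκ : ∀ k, Tendsto (fun l => typeFreq (κ l) ⌊τ / ρ l ^ d⌋₊ k) atTop (𝓝 (p k))) :
    Tendsto (fun l => ∑ n ∈ Finset.Ioc 0 ⌊τ / ρ l ^ d⌋₊, μ.real (A l (κ l n))) atTop
      (𝓝 ((∑ k, ω k * p k) * τ)) := by
  have hu0 : Tendsto (fun l => ρ l ^ d) atTop (𝓝[>] 0) := by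
    have := hρ0.pow d
    rw [zero_pow (by omega)] at this
    exact tendsto_nhdsWithin_iff.2 ⟨this, Eventually.of_forall fun l => pow_pos (hρ l) d⟩
  have hA : ∀ k, Tendsto (fun l => μ.real (A l k) / ρ l ^ d) atTop (𝓝 (ω k)) := by
    intro k
    have := (hmeas k).tendsto_div_nhds_zero.add_const (ω k)
    rw [zero_add] at this
    refine this.congr fun l => ?_
    have := (pow_pos (hρ l) d).ne'
    field_simp
    ring
  have hN : Tendsto (fun l => (⌊τ / ρ l ^ d⌋₊ : ℝ) * ρ l ^ d) atTop (𝓝 τ) := by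
    have := (tendsto_nat_floor_mul_div_atTop hτ.le).comp (tendsto_inv_nhdsGT_zero.comp hu0)
    refine this.congr fun l => ?_
    simp [div_eq_mul_inv]
  have hlim : Tendsto (fun l => ∑ k, (μ.real (A l k) / ρ l ^ d) *
      typeFreq (κ l) ⌊τ / ρ l ^ d⌋₊ k * ((⌊τ / ρ l ^ d⌋₊ : ℝ) * ρ l ^ d)) atTop
      (𝓝 (∑ k, ω k * p k * τ)) :=
    tendsto_finsetSum _ fun k _ => ((hA k).mul (hκ k)).mul hN
  rw [Finset.sum_mul]
  refine hlim.congr fun l => ?_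
  set n := ⌊τ / ρ l ^ d⌋₊
  have hu := (pow_pos (hρ l) d).ne'
  have e : Finset.Ioc 0 n = Finset.Icc 1 n := by ext; simp [Nat.succ_le_iff]
  rw [e, ← Finset.sum_fiberwise (Finset.Icc 1 n) (κ l)]
  refine Finset.sum_congr rfl fun k _ => ?_
  have h1 : ∑ j ∈ (Finset.Icc 1 n).filter (fun j => κ l j = k), μ.real (A l (κ l j)) =
      ((Finset.Icc 1 n).filter (fun j => κ l j = k)).card * μ.real (A l k) := by
    rw [← nsmul_eq_mul]
    refine Finset.sum_eq_card_nsmul fun j hj => ?_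
    rw [(Finset.mem_filter.1 hj).2]
  rw [h1, typeFreq]
  rcases Nat.eq_zero_or_pos n with h | h
  · simp [h]
  · have : (n : ℝ) ≠ 0 := by positivity
    field_simp

end Intensities

end

/-! ### The limit theorem -/

theorem mainTheorem7
    {d : ℕ} (hd : 1 ≤ d) {r : ℝ} (hr : 0 < r)
    {X : Type*} [TopologicalSpace X] [T2Space X] [SecondCountableTopology X]
    [ChartedSpace (EuclideanSpace ℝ (Fin d)) X]
    [IsManifold (𝓡 d) ((⌊r⌋₊ : ℕ) : WithTop ℕ∞) X]
    [MeasurableSpace X] [BorelSpace X] (N : BallCover d r X)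
    (μ : Measure X) [IsProbabilityMeasure μ]
    {Y : Type*} [MeasurableSpace Y] (ν : Measure Y) [IsProbabilityMeasure ν]
    (R : Y → Y) (hR : MeasurePreserving R ν ν)
    (T : Y → X → X) (hT : ∀ y, MeasurePreserving (T y) μ μ)
    (hMEM : ∀ᵐ y ∂ν, ExpMixingAt N μ T R y)
    {K : ℕ} (A : ℕ → Fin K → Set X)
    (hA : RegApproxFamily N μ (fun q : ℕ × Fin K => A q.1 q.2))
    (ω : Fin K → ℝ) (hω : ∀ k, 0 < ω k)
    (ρ : ℕ → ℝ) (hρ : ∀ l, 0 < ρ l) (hρ0 : Tendsto ρ atTop (𝓝 0))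
    (hmeas : ∀ k, (fun l => μ.real (A l k) - ω k * ρ l ^ d) =o[atTop] (fun l => ρ l ^ d))
    (p : Fin K → ℝ) (hp : ∀ k, 0 < p k) (hpsum : ∑ k, p k = 1) :
    ∀ᵐ y ∂ν, ∀ (κ : ℕ → ℕ → Fin K) (α : ℕ → ℕ → ℕ),
      (∀ k, ∀ t : ℝ, 0 < t →
        Tendsto (fun l => typeFreq (κ l) ⌊t / ρ l ^ d⌋₊ k) atTop (𝓝 (p k))) →
      (∀ l n, 1 ≤ n → 1 ≤ α l n) →
      ((absLogMeas μ (fun l => ⋃ k, A l k) =o[atTop] (fun l => (minDelay (α l) : ℝ))) ∨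
        (ShortReturnsRare μ T R y (fun l => ⋃ k, A l k) ∧
          absLogMeas μ (fun l => ⋃ k, A l k) =O[atTop] (fun l => (minDelay (α l) : ℝ))) ∨
        (ShortReturnsRare μ T R y (fun l => ⋃ k, A l k) ∧
          ReturnsLogLarge μ T R y (fun l => ⋃ k, A l k))) →
      TendstoInDistribution
        (fun (l : ℕ) (x : X) (m : ℕ) =>
          ENNReal.ofReal ((∑ k, ω k * p k) * ρ l ^ d) *
            (waitingProcess T R (A l) (κ l) (α l) y x m : ℝ≥0∞))
        atTop
        (fun (z : ℕ → ℝ) (m : ℕ) => ENNReal.ofReal (z m))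
        (fun _ => μ) stdExpSeq := by
  have hK : (Finset.univ : Finset (Fin K)).Nonempty := by
    rw [Finset.nonempty_iff_ne_empty]
    intro h
    rw [h, Finset.sum_empty] at hpsum
    exact zero_ne_one hpsum
  obtain ⟨k₀, -⟩ := hK
  set Ω : ℝ := ∑ k, ω k * p k with hΩ
  have hΩ0 : 0 < Ω := Finset.sum_pos (fun k _ => mul_pos (hω k) (hp k)) ⟨k₀, Finset.mem_univ _⟩
  have hAm : ∀ l k, MeasurableSet (A l k) := fun l k => by
    obtain ⟨_, _, h⟩ := hA
    exact (h (l, k)).1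
  obtain ⟨c, C, hc, hC, hm⟩ := exists_measureReal_bounds (μ := μ) hω hρ hmeas k₀
  have hlam : ∀ l, 0 < Ω * ρ l ^ d := fun l => mul_pos hΩ0 (pow_pos (hρ l) d)
  have hlam0 : Tendsto (fun l => Ω * ρ l ^ d) atTop (𝓝 0) := by
    have := (hρ0.pow d).const_mul Ω
    rwa [zero_pow (by omega), mul_zero] at this
  -- Rescaled time `t` in units of `Ω * ρ ^ d` is time `t / Ω` in units of `ρ ^ d`, where the total
  -- intensity is `Ω * (t / Ω) = t`; this normalizes the limit to rate one.
  have hdiv : ∀ (t : ℝ) (l : ℕ), t / (Ω * ρ l ^ d) = t / Ω / ρ l ^ d := fun t l =>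
    (div_div _ _ _).symm
  filter_upwards [hMEM] with y hy κ α hκ hα hcond
  -- The three cases enter only through this and the next disjunction. Case (I) gives both, since
  -- little-o implies big-O.
  have hsep : (absLogMeas μ (fun l => ⋃ k, A l k) =O[atTop] (fun l => (minDelay (α l) : ℝ))) ∨
      ReturnsLogLarge μ T R y (fun l => ⋃ k, A l k) := by
    rcases hcond with h | h | h
    · exact Or.inl h.isBigO
    · exact Or.inl h.2
    · exact Or.inr h.2
  have hrare : (absLogMeas μ (fun l => ⋃ k, A l k) =o[atTop] (fun l => (minDelay (α l) : ℝ))) ∨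
      ShortReturnsRare μ T R y (fun l => ⋃ k, A l k) := by
    rcases hcond with h | h | h
    · exact Or.inl h
    · exact Or.inr h.1
    · exact Or.inr h.1
  refine tendstoInDistribution_of_tendsto_extBox
    (fun l => measurable_scaled_waitingProcess hT (hAm l) _) fun k a b hab => ?_
  have hgap := tendsto_integral_gapPoly (μ := μ) (lam := fun l => Ω * ρ l ^ d) (C := C / Ω)
    (w := fun l n => μ.real (A l (κ l n))) (ξ := fun l x n => hitInd T R (A l) (κ l) (α l) y x n)
    (L := (List.range k).map fun i => (a i, b i))
    (fun l n => measurable_hitInd hT (hAm l) n)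
    (fun l x n => by
      rcases hitInd_eq_zero_or_one (T := T) (R := R) (A := A l) (κ := κ l) (α := α l) (y := y) x n
        with h | h <;> simp [h])
    (fun l x n => by
      rcases hitInd_eq_zero_or_one (T := T) (R := R) (A := A l) (κ := κ l) (α := α l) (y := y) x n
        with h | h <;> simp [h])
    hlam hlam0 (fun _ _ => measureReal_nonneg) (fun _ _ => measureReal_le_one) (by positivity)
    (by
      filter_upwards [hm] with l hl n _
      refine (hl.1 _).2.trans (le_of_eq ?_)
      field_simp)
    (fun t ht => by
      simp only [hdiv]
      have := tendsto_sum_measureReal (p := p) hd hρ hρ0 hmeas (div_pos ht hΩ0)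
        fun k => hκ k _ (div_pos ht hΩ0)
      rwa [← hΩ, mul_div_cancel₀ _ hΩ0.ne'] at this)
    (fun q t ht => by
      simp only [hdiv]
      exact tendsto_sum_abs_moment_sub hd hr N μ hT hy hA hρ hρ0 hc hC hm hα hsep hrare q
        (div_pos ht hΩ0))
    (by
      intro ab hab'
      obtain ⟨i, hi, rfl⟩ := List.mem_map.1 hab'
      exact hab i (List.mem_range.1 hi))
  exact hgap.congr fun l => integral_gapPoly_hitInd hT (hAm l) (hlam l) hab
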